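/- **Setting.** The universe is $\{1,\dots,n\}$, $\mathcal J$ is a family of feasible subsets, $v\in\mathbb R_{\ge 0}^n$ a vector of values, and $\mathrm{OPT}(v)=\max_{A\in\mathcal J}\sum_{i\in A}v_i$. *Single-sample prophet inequality.* A randomized online algorithm $\mathcal P$, which knows $\mathcal J$, is given offline a vector $s$; then the pairs $(i,v_i)$ are revealed one at a time, and each element must be accepted or rejected irrevocably when it is revealed, the accepted set being feasible at all times. $\mathcal P$ is an $\alpha$-competitive single-sample prophet inequality for $\mathcal J$ if, for all product distributions $\mathcal D=\mathcal D_1\times\dots\times\mathcal D_n$ on $\mathbb R_{\ge0}^n$ (unknown to $\mathcal P$), for independent $s,v\sim\mathcal D$, and for every order of revelation, which an adversary may choose (measurably) knowing $s$ and $v$ but not the coins of $\mathcal P$, $$\mathbb E\Big[\sum_{i\text{ accepted}}v_i\Big]\ \ge\ \alpha\,\mathbb E[\mathrm{OPT}(v)]\qquad(\text{in }[0,\infty]).$$ It is so for i.i.d. weights if this holds whenever $\mathcal D_1=\dots=\mathcal D_n$. *Order-oblivious secretary algorithms.* A randomized algorithm $\mathcal S$ chooses a (possibly random) number $k\le n$,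 observes without accepting the first $k$ elements of a uniformly random order with their values, and then makes irrevocable decisions on the remaining elements, keeping the accepted set feasible. It is order-oblivious with ratio $\alpha$ if for every $v\in\mathbb R_{\ge0}^n$ its expected accepted weight is at least $\alpha\,\mathrm{OPT}(v)$ even when the elements after the first $k$ are revealed in an order chosen by an adversary who knows $v$ and the observed elements. It is so in the random assignment model if, for every list $w$ of $n$ nonnegative weights assigned to the elements by a uniformly random permutation, its expected accepted weight, with such an adversary, who sees the assignment, is at least $\alpha$ times the expectation of $\mathrm{OPT}$. *The reduction.* $\mathcal P_{\mathcal S}$ draws a uniformly random permutation $j_1,\dots,j_n$, passes $(j_1,s_{j_1}),\dots,(j_k,s_{j_k})$ to $\mathcal S$ as the observed elements, and online ignores the elements $j_1,\dots,j_k$, passes every other $(i,v_i)$ to $\mathcal S$, and accepts $i$ if and only if $\mathcal S$ does. **Corollary.** 1. For every graphic matroid (universe: the edges of a finite multigraph; feasible: the edge sets without cycles) there is an order-oblivious secretary algorithm $\mathcal S$ with ratio $\frac18$ such that $\mathcal P_{\mathcal S}$ is a $\frac18$-competitive single-sample prophet inequality. 2. For every transversal matroid (universe: the left vertices of a finite bipartite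 graph; feasible: the sets of left vertices that can be matched into the right side) the same holds with ratio $\frac1{16}$. 3. For every laminar matroid (given by a laminar family $\mathcal F$ of subsets of the universe with positive integer capacities $c_B$; feasible: the $A$ with $|A\cap B|\le c_B$ for all $B\in\mathcal F$) the same holds with ratio $\frac1{12\sqrt3}$. 4. For every matroid there is a secretary algorithm $\mathcal S$ that is order-oblivious with ratio $\frac{1-1/e}{20}$ in the random assignment model and such that $\mathcal P_{\mathcal S}$ is a $\frac{1-1/e}{20}$-competitive single-sample prophet inequality for i.i.d. weights. In particular, single-sample prophet inequalities with these ratios exist. -/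

import Mathlib

open MeasureTheory
open scoped NNReal ENNReal

noncomputable section

namespace SSPI

/-! Universe of elements: `Fin n`.  A family of feasible sets is a predicate
`J : Finset (Fin n) → Prop`, and weights are vectors `v : Fin n → ℝ≥0`. -/

variable {n : ℕ}

/-- Total weight of a set of elements. -/
def weight (v : Fin n → ℝ≥0) (A : Finset (Fin n)) : ℝ≥0∞ := ∑ i ∈ A, (v i : ℝ≥0∞)

/-- `OPT(v)`: the maximum weight of a feasible set. -/
def opt (J : Finset (Fin n) → Prop) (v : Fin n → ℝ≥0) : ℝ≥0∞ :=
  ⨆ (A : Finset (Fin n)) (_ : J A), weight v A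

/-- The elements of a list together with their values. -/
def labelled (v : Fin n → ℝ≥0) (l : List (Fin n)) : List (Fin n × ℝ≥0) :=
  l.map fun j => (j, v j)

/-- Run an online acceptance rule.  The elements of `past` have already been revealed; those of the
second list are revealed one after the other.  The decision on an element depends only on the
elements and values revealed before it and on the element itself with its value. -/
def acceptedFrom (rule : List (Fin n × ℝ≥0) → Fin n → ℝ≥0 → Bool) (v : Fin n → ℝ≥0) :
    List (Fin n) → List (Fin n) → Finset (Fin n)
  | _, [] => ∅
  | past, i :: rest =>
      (if rule (labelled v past) i (v i) then {i} else ∅) ∪ acceptedFrom rule v (past ++ [i]) rest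

/-- The order in which a permutation `π` lists the elements: `π 0, π 1, …`. -/
def orderList (π : Equiv.Perm (Fin n)) : List (Fin n) := List.ofFn π

/-- The elements outside `obs`, listed in the order `π`. -/
def remaining (obs : List (Fin n)) (π : Equiv.Perm (Fin n)) : List (Fin n) :=
  (orderList π).filter fun i => decide (i ∉ obs)

/-- A randomized online selection algorithm with one offline sample vector.  `accept c s h i x` is
the decision on element `i` of value `x` when the coins are `c`, the sample vector is `s`, and `h` is
the list of the elements and values revealed so far.  The algorithm knows nothing else about the
distribution of the values. -/
structure SingleSampleAlgorithm (n : ℕ) where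
  Coin : Type
  [coinFintype : Fintype Coin]
  law : PMF Coin
  accept : Coin → (Fin n → ℝ≥0) → List (Fin n × ℝ≥0) → Fin n → ℝ≥0 → Bool
  measurable_accept : ∀ (c : Coin) (l : List (Fin n)) (i : Fin n),
    Measurable fun p : (Fin n → ℝ≥0) × (Fin n → ℝ≥0) =>
      accept c p.1 (labelled p.2 l) i (p.2 i)

attribute [instance] SingleSampleAlgorithm.coinFintype

namespace SingleSampleAlgorithm

/-- The set accepted with coins `c` and samples `s` when the values `v` are revealed along `l`. -/
def accepted (P : SingleSampleAlgorithm n) (c : P.Coin) (s v : Fin n → ℝ≥0)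
    (l : List (Fin n)) : Finset (Fin n) :=
  acceptedFrom (P.accept c s) v [] l

/-- At all times the accepted set is feasible (`l` ranges over all lists without repetition, hence
over all initial segments of all orders). -/
def IsFeasible (P : SingleSampleAlgorithm n) (J : Finset (Fin n) → Prop) : Prop :=
  ∀ (c : P.Coin) (s v : Fin n → ℝ≥0) (l : List (Fin n)), l.Nodup → J (P.accepted c s v l)

/-- Expected accepted weight, over the coins, for given samples `s`, values `v` and order `π`. -/
def expectedWeight (P : SingleSampleAlgorithm n) (s v : Fin n → ℝ≥0)
    (π : Equiv.Perm (Fin n)) : ℝ≥0∞ :=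
  ∑ c : P.Coin, P.law c * weight v (P.accepted c s v (orderList π))

/-- The inequality `E[∑_{i accepted} v_i] ≥ α · E[OPT(v)]` when samples and values are independent
draws from the product of the `D i`.  The adversary sees all samples and all values before
choosing the order `σ (s, v)`.  Expectations lie in `[0, ∞]`. -/
def CompetitiveFor (P : SingleSampleAlgorithm n) (J : Finset (Fin n) → Prop) (α : ℝ)
    (D : Fin n → Measure ℝ≥0) : Prop :=
  ∀ σ : (Fin n → ℝ≥0) × (Fin n → ℝ≥0) → Equiv.Perm (Fin n),
    (∀ π, MeasurableSet {p | σ p = π}) →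
      ENNReal.ofReal α * ∫⁻ v, opt J v ∂(Measure.pi D) ≤
        ∫⁻ p, P.expectedWeight p.1 p.2 (σ p) ∂((Measure.pi D).prod (Measure.pi D))

/-- `P` is an `α`-competitive single-sample prophet inequality for `J`. -/
def IsProphetInequality (P : SingleSampleAlgorithm n) (J : Finset (Fin n) → Prop)
    (α : ℝ) : Prop :=
  P.IsFeasible J ∧
    ∀ D : Fin n → Measure ℝ≥0, (∀ i, IsProbabilityMeasure (D i)) → P.CompetitiveFor J α D

/-- `P` is an `α`-competitive single-sample prophet inequality for `J` when the values are
independent and identically distributed. -/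
def IsIIDProphetInequality (P : SingleSampleAlgorithm n) (J : Finset (Fin n) → Prop)
    (α : ℝ) : Prop :=
  P.IsFeasible J ∧
    ∀ D : Measure ℝ≥0, IsProbabilityMeasure D → P.CompetitiveFor J α fun _ => D

end SingleSampleAlgorithm

/-- A secretary algorithm that first only observes.  With coins `c` it observes, without accepting,
the first `sampleSize c` elements; afterwards `accept c o h i x` is the decision on element `i` of
value `x`, where `o` lists the observed elements and values and `h` those revealed after the
observation phase and before `i`. -/
structure ObserveFirstAlgorithm (n : ℕ) where
  Coin : Type
  [coinFintype : Fintype Coin]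
  law : PMF Coin
  sampleSize : Coin → ℕ
  sampleSize_le : ∀ c, sampleSize c ≤ n
  accept : Coin → List (Fin n × ℝ≥0) → List (Fin n × ℝ≥0) → Fin n → ℝ≥0 → Bool
  measurable_accept : ∀ (c : Coin) (o l : List (Fin n)) (i : Fin n),
    Measurable fun p : (Fin n → ℝ≥0) × (Fin n → ℝ≥0) =>
      accept c (labelled p.1 o) (labelled p.2 l) i (p.2 i)

attribute [instance] ObserveFirstAlgorithm.coinFintype

namespace ObserveFirstAlgorithm

/-- The elements observed with coins `c` when the random order is `π`. -/
def observed (S : ObserveFirstAlgorithm n) (c : S.Coin) (π : Equiv.Perm (Fin n)) :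
    List (Fin n) :=
  (orderList π).take (S.sampleSize c)

/-- The set accepted when the elements of `o` are observed and then those of `l` are revealed. -/
def accepted (S : ObserveFirstAlgorithm n) (c : S.Coin) (v : Fin n → ℝ≥0)
    (o l : List (Fin n)) : Finset (Fin n) :=
  acceptedFrom (S.accept c (labelled v o)) v [] l

/-- At all times the accepted set is feasible. -/
def IsFeasible (S : ObserveFirstAlgorithm n) (J : Finset (Fin n) → Prop) : Prop :=
  ∀ (c : S.Coin) (v : Fin n → ℝ≥0) (o l : List (Fin n)),
    o.length = S.sampleSize c → (o ++ l).Nodup → J (S.accepted c v o l)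

/-- Expected accepted weight for the values `v`, over the coins and a uniformly random order, when
the elements after the observation phase are rearranged by the adversary `τ`, which knows all values
and the list of observed elements. -/
def expectedWeight (S : ObserveFirstAlgorithm n)
    (τ : (Fin n → ℝ≥0) → List (Fin n) → Equiv.Perm (Fin n)) (v : Fin n → ℝ≥0) : ℝ≥0∞ :=
  ∑ c : S.Coin, S.law c * ∑ π : Equiv.Perm (Fin n),
    PMF.uniformOfFintype (Equiv.Perm (Fin n)) π *
      weight v (S.accepted c v (S.observed c π)
        (remaining (S.observed c π) (τ v (S.observed c π))))

/-- `S` is an order-oblivious secretary algorithm of competitive ratio `α`: for arbitrary values, it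
keeps its ratio in whatever order the elements after the observation phase are revealed. -/
def IsOrderOblivious (S : ObserveFirstAlgorithm n) (J : Finset (Fin n) → Prop) (α : ℝ) : Prop :=
  S.IsFeasible J ∧
    ∀ (τ : (Fin n → ℝ≥0) → List (Fin n) → Equiv.Perm (Fin n)) (v : Fin n → ℝ≥0),
      ENNReal.ofReal α * opt J v ≤ S.expectedWeight τ v

/-- The same in the random assignment model: an arbitrary list `w` of weights is assigned to the
elements by a uniformly random permutation. -/
def IsOrderObliviousRandomAssignment (S : ObserveFirstAlgorithm n) (J : Finset (Fin n) → Prop)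
    (α : ℝ) : Prop :=
  S.IsFeasible J ∧
    ∀ (τ : (Fin n → ℝ≥0) → List (Fin n) → Equiv.Perm (Fin n)) (w : Fin n → ℝ≥0),
      ENNReal.ofReal α * ∑ ρ : Equiv.Perm (Fin n),
          PMF.uniformOfFintype (Equiv.Perm (Fin n)) ρ * opt J (w ∘ ρ) ≤
        ∑ ρ : Equiv.Perm (Fin n),
          PMF.uniformOfFintype (Equiv.Perm (Fin n)) ρ * S.expectedWeight τ (w ∘ ρ)

theorem labelled_filter (v : Fin n → ℝ≥0) (o l : List (Fin n)) :
    (labelled v l).filter (fun q => decide (q.1 ∉ o)) =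
      labelled v (l.filter fun i => decide (i ∉ o)) := by
  simp only [labelled, List.filter_map]
  rfl

/-- The reduction `P_S`.  Offline: the coins of `S` and an independent uniformly random permutation
are drawn, and the first `sampleSize` elements of the permutation are observed by `S` with their
sampled values.  Online: observed elements are skipped, and every other element is passed to `S`
with its true value and accepted if and only if `S` accepts it. -/
def reduction (S : ObserveFirstAlgorithm n) : SingleSampleAlgorithm n where
  Coin := S.Coin × Equiv.Perm (Fin n)
  law := S.law.bind fun c => (PMF.uniformOfFintype (Equiv.Perm (Fin n))).map fun π => (c, π)
  accept := fun c s h i x =>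
    decide (i ∉ S.observed c.1 c.2) &&
      S.accept c.1 (labelled s (S.observed c.1 c.2))
        (h.filter fun q => decide (q.1 ∉ S.observed c.1 c.2)) i x
  measurable_accept := by
    intro c l i
    simp only [labelled_filter]
    by_cases hi : i ∈ S.observed c.1 c.2
    · simp [hi]
    · simpa [hi] using S.measurable_accept c.1 (S.observed c.1 c.2)
        (l.filter fun j => decide (j ∉ S.observed c.1 c.2)) i

end ObserveFirstAlgorithm

/-- Independent sets of the graphic matroid of a (multi)graph: edge sets that contain no cycle.  A
cycle of length `k + 1` has distinct vertices `x 0, …, x k` and distinct edges `e j` from `x j` to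
`x (j + 1)`, with indices modulo `k + 1`; loops and pairs of parallel edges are cycles. -/
def GraphicIndep {V : Type*} (G : Graph V (Fin n)) (A : Finset (Fin n)) : Prop :=
  ¬ ∃ (k : ℕ) (x : Fin (k + 1) → V) (e : Fin (k + 1) → Fin n),
      Function.Injective x ∧ Function.Injective e ∧ (∀ j, e j ∈ A) ∧
        ∀ j, G.IsLink (e j) (x j) (x (j + 1))

/-- Independent sets of the transversal matroid of a bipartite graph with left vertices `Fin n`,
right vertices `R` and adjacency `adj`: the sets of left vertices that can be matched. -/
def TransversalIndep {R : Type*} (adj : Fin n → R → Prop) (A : Finset (Fin n)) : Prop :=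
  ∃ f : {i // i ∈ A} → R, Function.Injective f ∧ ∀ i, adj i.1 (f i)

/-- Laminar families of sets. -/
def IsLaminar (F : Finset (Finset (Fin n))) : Prop :=
  ∀ A ∈ F, ∀ B ∈ F, A ⊆ B ∨ B ⊆ A ∨ Disjoint A B

/-- Independent sets of the laminar matroid of the family `F` with capacities `cap`. -/
def LaminarIndep (F : Finset (Finset (Fin n))) (cap : Finset (Fin n) → ℕ)
    (A : Finset (Fin n)) : Prop :=
  ∀ B ∈ F, (A ∩ B).card ≤ cap B

/-- Independent sets of a matroid. -/
def MatroidIndep (M : Matroid (Fin n)) (A : Finset (Fin n)) : Prop := M.Indep (A : Set (Fin n))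

end SSPI

end

noncomputable section

namespace SSPI

variable {n : ℕ}

/-! ### Online rules -/

/-! The reduction loses nothing because a sample and a value of the same element are exchangeable.
Once the coins fix the observed set `o`, `P_S` reads samples only on `o` and values only off `o`, so
it runs `S` on one mixed vector. Exchanging the two vectors off `o` preserves the product law
(`measurePreserving_exchange`) and turns the mixed vector into the first component of the pair. The
second component then serves as advice to the adversary; for each fixed advice this is an admissible
adversary of `S`, so the secretary guarantee holds pointwise and integrates (`lintegral_reduction`).
For i.i.d. values, permuting the first vector while fixing the second also preserves the law, so a
guarantee for random assignments suffices.

The secretary algorithms observe a random set `O` containing each element independently with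
probability `p`, and decide by comparisons of values only. Their weight is bounded below by that of
the elements accepted in every later order, which removes the adversary (`surelyAccepted_subset`).
What remains is a computation about `O`, driven by one principle: an event determined by the
elements above `i` in the ranking is independent of whether `i` is observed (`Ex_mul_of_awayFrom`).

Transversal: each element is labelled by the right vertex it would receive from the greedy matching
on higher observed elements. The first element with a given label is accepted for certain if it is
unobserved and the second such element, if any, is observed (`le_Ex_only_labelled`); greedy charging
costs a further factor 4. Graphic: orienting edges towards larger potential makes edge sets with
distinct heads acyclic, so the matching rule applies to heads. A random choice between the
orientation and its reverse covers any forest.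

Laminar: an element unspanned by the observed elements above it is accepted unless some capacity is
exhausted by unobserved rivals. A product martingale shows that this is exponentially unlikely in
the capacity (`Ex_potential`, `le_potential`), and a union bound over distinct capacities leaves
probability 11/160.

General matroids: minimizing `n * rk A - t * |A|` gives a nested family of sets and hence a level
for each element. The expected optimum is at most a sum over levels (`mul_sum_rk_le`), and an
element of level `l` ranked among the top `l` is accepted with probability at least 7/90, since few
random positions rarely span it (`mul_sum_isBlocked_le`). Both sides reduce to the same sum of
truncated levels. All claimed ratios follow, the last two with room to spare. -/

theorem acceptedFrom_subset (rule : List (Fin n × ℝ≥0) → Fin n → ℝ≥0 → Bool) (v : Fin n → ℝ≥0)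
    (past l : List (Fin n)) : ∀ i ∈ acceptedFrom rule v past l, i ∈ l := by
  induction l generalizing past with
  | nil => simp [acceptedFrom]
  | cons a l ih =>
    intro i hi
    rw [acceptedFrom, Finset.mem_union] at hi
    rcases hi with hi | hi
    · split_ifs at hi <;> simp_all
    · exact List.mem_cons_of_mem _ (ih _ i hi)

theorem acceptedFrom_congr (rule : List (Fin n × ℝ≥0) → Fin n → ℝ≥0 → Bool)
    {v w : Fin n → ℝ≥0} (past l : List (Fin n)) (h : ∀ i, i ∈ past ∨ i ∈ l → v i = w i) :
    acceptedFrom rule v past l = acceptedFrom rule w past l := by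
  induction l generalizing past with
  | nil => rfl
  | cons a l ih =>
    have h1 : labelled v past = labelled w past := by
      refine List.map_congr_left fun i hi => ?_
      rw [h i (Or.inl hi)]
    rw [acceptedFrom, acceptedFrom, h1, h a (Or.inr (by simp)), ih (past ++ [a])]
    intro i hi
    refine h i ?_
    simp only [List.mem_append, List.mem_cons] at hi ⊢
    tauto

/-- Membership in the accepted set, in terms of the elements revealed earlier. -/
theorem mem_acceptedFrom_iff (rule : List (Fin n × ℝ≥0) → Fin n → ℝ≥0 → Bool) (v : Fin n → ℝ≥0)
    (past l : List (Fin n)) (i : Fin n) :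
    i ∈ acceptedFrom rule v past l ↔
      ∃ l₁ l₂, l = l₁ ++ i :: l₂ ∧ rule (labelled v (past ++ l₁)) i (v i) = true := by
  induction l generalizing past with
  | nil => simp [acceptedFrom]
  | cons a l ih =>
    rw [acceptedFrom, Finset.mem_union, ih]
    constructor
    · rintro (h | ⟨l₁, l₂, rfl, h⟩)
      · split_ifs at h with hr
        · rw [Finset.mem_singleton] at h
          subst h
          exact ⟨[], l, rfl, by simpa using hr⟩
        · simp at h
      · exact ⟨a :: l₁, l₂, rfl, by simpa using h⟩
    · rintro ⟨l₁, l₂, h, hr⟩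
      cases l₁ with
      | nil =>
        simp only [List.nil_append, List.cons.injEq] at h
        obtain ⟨rfl, rfl⟩ := h
        left
        rw [List.append_nil] at hr
        simp [hr]
      | cons b l₁ =>
        simp only [List.cons_append, List.cons.injEq] at h
        obtain ⟨rfl, rfl⟩ := h
        exact Or.inr ⟨l₁, l₂, rfl, by simpa using hr⟩

/-- Acceptance is a countable union, over splittings of the fixed list, of events on which a single
decision is positive. -/
theorem measurableSet_mem_acceptedFrom {β : Type*} [MeasurableSpace β]
    (rule : β → List (Fin n × ℝ≥0) → Fin n → ℝ≥0 → Bool) (v : β → Fin n → ℝ≥0)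
    (hr : ∀ l i, Measurable fun b => rule b (labelled (v b) l) i (v b i))
    (l : List (Fin n)) (i : Fin n) :
    MeasurableSet {b | i ∈ acceptedFrom (rule b) (v b) [] l} := by
  simp only [mem_acceptedFrom_iff, Set.ofPred_exists, Set.ofPred_and]
  refine MeasurableSet.iUnion fun l₁ => MeasurableSet.iUnion fun l₂ => ?_
  refine MeasurableSet.inter (MeasurableSet.const _) ?_
  exact hr ([] ++ l₁) i (measurableSet_singleton true)

theorem measurable_weight {β : Type*} [MeasurableSpace β] (v : β → Fin n → ℝ≥0)
    (hv : Measurable v) (A : β → Finset (Fin n)) (hA : ∀ i, MeasurableSet {b | i ∈ A b}) :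
    Measurable fun b => weight (v b) (A b) := by
  classical
  have : (fun b => weight (v b) (A b)) =
      fun b => ∑ i, Set.indicator {b | i ∈ A b} (fun b => (v b i : ℝ≥0∞)) b := by
    ext b
    simp only [weight, Set.indicator_apply, Set.mem_ofPred_eq]
    rw [← Finset.sum_filter]
    congr 1
    ext i
    simp
  rw [this]
  refine Finset.measurable_sum _ fun i _ => Measurable.indicator ?_ (hA i)
  exact ((measurable_pi_apply i).comp hv).coe_nnreal_ennreal

theorem measurable_opt (J : Finset (Fin n) → Prop) : Measurable (opt J) := by
  unfold opt
  refine Measurable.iSup fun A => Measurable.iSup fun _ => ?_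
  exact measurable_weight id measurable_id (fun _ => A) fun i => MeasurableSet.const _

theorem weight_congr {v w : Fin n → ℝ≥0} {A : Finset (Fin n)} (h : ∀ i ∈ A, v i = w i) :
    weight v A = weight w A :=
  Finset.sum_congr rfl fun i hi => by rw [h i hi]

/-! ### Exchanging samples and values -/

/-- `u` on the elements of `o` and `u'` elsewhere. -/
def mix (o : List (Fin n)) (u u' : Fin n → ℝ≥0) : Fin n → ℝ≥0 := fun j =>
  if j ∈ o then u j else u' j

/-- Exchange the two vectors outside `o`. -/
def exchange (o : List (Fin n)) (p : (Fin n → ℝ≥0) × (Fin n → ℝ≥0)) :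
    (Fin n → ℝ≥0) × (Fin n → ℝ≥0) := (mix o p.1 p.2, mix o p.2 p.1)

theorem mix_exchange (o : List (Fin n)) (p : (Fin n → ℝ≥0) × (Fin n → ℝ≥0)) :
    mix o (exchange o p).1 (exchange o p).2 = p.1 := by
  ext j
  simp only [mix, exchange]
  split_ifs <;> rfl

theorem measurable_exchange (o : List (Fin n)) : Measurable (exchange o) := by
  unfold exchange mix
  refine Measurable.prodMk ?_ ?_ <;> refine measurable_pi_lambda _ fun j => ?_ <;>
    split_ifs <;> fun_prop

/-- Regrouped coordinate by coordinate, the map swaps the two independent draws of `D i` for `i ∉ o`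
and fixes the others. -/
theorem measurePreserving_exchange (o : List (Fin n)) (D : Fin n → Measure ℝ≥0)
    [∀ i, IsProbabilityMeasure (D i)] :
    MeasurePreserving (exchange o) ((Measure.pi D).prod (Measure.pi D))
      ((Measure.pi D).prod (Measure.pi D)) := by
  have he := measurePreserving_arrowProdEquivProdArrow ℝ≥0 ℝ≥0 (Fin n) D D
  have hf : MeasurePreserving (fun (x : Fin n → ℝ≥0 × ℝ≥0) i => if i ∈ o then x i else (x i).swap)
      (Measure.pi fun i => (D i).prod (D i)) (Measure.pi fun i => (D i).prod (D i)) := by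
    have hi : ∀ i, MeasurePreserving
        (fun z : ℝ≥0 × ℝ≥0 => if i ∈ o then z else z.swap)
        ((D i).prod (D i)) ((D i).prod (D i)) := by
      intro i
      split_ifs
      · exact MeasurePreserving.id _
      · exact Measure.measurePreserving_swap
    exact measurePreserving_pi _ _ hi
  have := (he.comp hf).comp he.symm
  convert this using 1
  ext p j <;> simp only [exchange, mix, Function.comp, MeasurableEquiv.arrowProdEquivProdArrow,
    Equiv.arrowProdEquivProdArrow] <;> (simp; split_ifs <;> rfl)

/-! ### The reduction as a run of the secretary algorithm on a mixed vector. -/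

namespace ObserveFirstAlgorithm

variable (S : ObserveFirstAlgorithm n)

theorem reduction_acceptedFrom (c : S.Coin) (π : Equiv.Perm (Fin n)) (s v : Fin n → ℝ≥0)
    (past l : List (Fin n)) :
    acceptedFrom (S.reduction.accept (c, π) s) v past l =
      acceptedFrom (S.accept c (labelled s (S.observed c π))) v
        (past.filter fun i => decide (i ∉ S.observed c π))
        (l.filter fun i => decide (i ∉ S.observed c π)) := by
  induction l generalizing past with
  | nil => rfl
  | cons a l ih =>
    rw [acceptedFrom, ih]
    by_cases ha : a ∈ S.observed c π
    · simp [reduction, ha, List.filter_append]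
    · have h1 : S.reduction.accept (c, π) s (labelled v past) a (v a) =
          S.accept c (labelled s (S.observed c π))
            (labelled v (past.filter fun i => decide (i ∉ S.observed c π))) a (v a) := by
        rw [← labelled_filter]
        simp [reduction, ha]
      have h2 : (a :: l).filter (fun i => decide (i ∉ S.observed c π)) =
          a :: l.filter (fun i => decide (i ∉ S.observed c π)) := by
        simp [ha]
      have h3 : (past ++ [a]).filter (fun i => decide (i ∉ S.observed c π)) =
          past.filter (fun i => decide (i ∉ S.observed c π)) ++ [a] := by
        simp [List.filter_append, ha]
      rw [h1, h2, h3, acceptedFrom]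

/-- Samples are read only on the observed elements and values only off them, so a single vector
carries everything the run sees. -/
theorem reduction_accepted (c : S.Coin) (π : Equiv.Perm (Fin n)) (s v : Fin n → ℝ≥0)
    (l : List (Fin n)) :
    S.reduction.accepted (c, π) s v l =
      S.accepted c (mix (S.observed c π) s v) (S.observed c π)
        (l.filter fun i => decide (i ∉ S.observed c π)) := by
  refine (S.reduction_acceptedFrom c π s v [] l).trans ?_
  rw [accepted]
  have h1 : labelled (mix (S.observed c π) s v) (S.observed c π) =
      labelled s (S.observed c π) := by
    refine List.map_congr_left fun i hi => ?_
    simp [mix, hi]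
  rw [h1, List.filter_nil]
  refine acceptedFrom_congr _ _ _ fun i hi => ?_
  simp only [List.not_mem_nil, List.mem_filter, false_or, decide_eq_true_eq] at hi
  simp [mix, hi.2]

theorem weight_reduction_accepted (c : S.Coin) (π : Equiv.Perm (Fin n)) (s v : Fin n → ℝ≥0)
    (l : List (Fin n)) :
    weight v (S.reduction.accepted (c, π) s v l) =
      weight (mix (S.observed c π) s v) (S.accepted c (mix (S.observed c π) s v) (S.observed c π)
        (l.filter fun i => decide (i ∉ S.observed c π))) := by
  rw [reduction_accepted]
  refine weight_congr fun i hi => ?_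
  have := acceptedFrom_subset _ _ _ _ i hi
  simp only [List.mem_filter, decide_eq_true_eq] at this
  simp [mix, this.2]

theorem nodup_orderList (π : Equiv.Perm (Fin n)) : (orderList π).Nodup :=
  List.nodup_ofFn.2 π.injective

theorem length_observed (c : S.Coin) (π : Equiv.Perm (Fin n)) :
    (S.observed c π).length = S.sampleSize c := by
  simp [observed, orderList, S.sampleSize_le c]

theorem nodup_observed (c : S.Coin) (π : Equiv.Perm (Fin n)) : (S.observed c π).Nodup :=
  (nodup_orderList π).sublist (List.take_sublist _ _)

theorem IsFeasible.reduction {S : ObserveFirstAlgorithm n} {J : Finset (Fin n) → Prop}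
    (h : S.IsFeasible J) : S.reduction.IsFeasible J := by
  rintro ⟨c, π⟩ s v l hl
  rw [reduction_accepted]
  refine h c _ _ _ (S.length_observed c π) ?_
  refine List.Nodup.append (S.nodup_observed c π) (hl.filter _) fun i hi hi' => ?_
  simp only [List.mem_filter, decide_eq_true_eq] at hi'
  exact hi'.2 hi

theorem reduction_law (c : S.Coin) (π : Equiv.Perm (Fin n)) :
    S.reduction.law (c, π) = S.law c * PMF.uniformOfFintype (Equiv.Perm (Fin n)) π := by
  classical
  change (S.law.bind fun c => (PMF.uniformOfFintype (Equiv.Perm (Fin n))).map fun π => (c, π))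
    (c, π) = _
  rw [PMF.bind_apply, tsum_fintype, Finset.sum_eq_single c]
  · congr 1
    rw [PMF.map_apply, tsum_fintype, Finset.sum_eq_single π] <;> simp +contextual [eq_comm]
  · intro b _ hb
    rw [PMF.map_apply, ENNReal.tsum_eq_zero.2, mul_zero]
    intro a
    rw [if_neg]
    simp only [Prod.mk.injEq, not_and]
    exact fun h => absurd h.symm hb
  · simp

/-- The weight that the reduction obtains from the vectors `exchange o p`, for coins `c` and `π`. -/
def exchangedWeight (σ : (Fin n → ℝ≥0) × (Fin n → ℝ≥0) → Equiv.Perm (Fin n)) (c : S.Coin)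
    (π : Equiv.Perm (Fin n)) (p : (Fin n → ℝ≥0) × (Fin n → ℝ≥0)) : ℝ≥0∞ :=
  weight p.1 (S.accepted c p.1 (S.observed c π)
    (remaining (S.observed c π) (σ (exchange (S.observed c π) p))))

theorem measurable_reduction_weight
    (σ : (Fin n → ℝ≥0) × (Fin n → ℝ≥0) → Equiv.Perm (Fin n))
    (hσ : ∀ π, MeasurableSet {p | σ p = π}) (c : S.reduction.Coin) :
    Measurable fun p : (Fin n → ℝ≥0) × (Fin n → ℝ≥0) =>
      weight p.2 (S.reduction.accepted c p.1 p.2 (orderList (σ p))) := by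
  refine measurable_weight (fun p : (Fin n → ℝ≥0) × (Fin n → ℝ≥0) => p.2) measurable_snd
    (fun p => S.reduction.accepted c p.1 p.2 (orderList (σ p))) fun i => ?_
  have : {p : (Fin n → ℝ≥0) × (Fin n → ℝ≥0) |
        i ∈ S.reduction.accepted c p.1 p.2 (orderList (σ p))} =
      ⋃ π, {p | σ p = π} ∩ {p | i ∈ S.reduction.accepted c p.1 p.2 (orderList π)} := by
    ext p
    simp
  rw [this]
  refine MeasurableSet.iUnion fun π => (hσ π).inter ?_
  exact measurableSet_mem_acceptedFrom
    (fun p : (Fin n → ℝ≥0) × (Fin n → ℝ≥0) => S.reduction.accept c p.1)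
    (fun p => p.2) (fun l i => S.reduction.measurable_accept c l i) _ _

/-- Exchanging twice is the identity, so the mixed vector of the exchanged pair is `p.1`, on which
the secretary algorithm is run. -/
theorem exchangedWeight_eq (σ : (Fin n → ℝ≥0) × (Fin n → ℝ≥0) → Equiv.Perm (Fin n)) (c : S.Coin)
    (π : Equiv.Perm (Fin n)) (p : (Fin n → ℝ≥0) × (Fin n → ℝ≥0)) :
    S.exchangedWeight σ c π p =
      weight (exchange (S.observed c π) p).2 (S.reduction.accepted (c, π)
        (exchange (S.observed c π) p).1 (exchange (S.observed c π) p).2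
        (orderList (σ (exchange (S.observed c π) p)))) := by
  rw [weight_reduction_accepted, mix_exchange]
  rfl

theorem measurable_exchangedWeight (σ : (Fin n → ℝ≥0) × (Fin n → ℝ≥0) → Equiv.Perm (Fin n))
    (hσ : ∀ π, MeasurableSet {p | σ p = π}) (c : S.Coin) (π : Equiv.Perm (Fin n)) :
    Measurable (S.exchangedWeight σ c π) := by
  have : S.exchangedWeight σ c π = _ := funext fun p => S.exchangedWeight_eq σ c π p
  rw [this]
  exact (S.measurable_reduction_weight σ hσ (c, π)).comp (measurable_exchange _)

/-- The adversary of the secretary algorithm that simulates `σ` when the values that are not passed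
to the algorithm are `u`. -/
def simulate (σ : (Fin n → ℝ≥0) × (Fin n → ℝ≥0) → Equiv.Perm (Fin n)) (u : Fin n → ℝ≥0) :
    (Fin n → ℝ≥0) → List (Fin n) → Equiv.Perm (Fin n) :=
  fun v o => σ (exchange o (v, u))

theorem expectedWeight_simulate (σ : (Fin n → ℝ≥0) × (Fin n → ℝ≥0) → Equiv.Perm (Fin n))
    (p : (Fin n → ℝ≥0) × (Fin n → ℝ≥0)) :
    S.expectedWeight (simulate σ p.2) p.1 =
      ∑ c : S.Coin, ∑ π : Equiv.Perm (Fin n), S.law c *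
        PMF.uniformOfFintype (Equiv.Perm (Fin n)) π * S.exchangedWeight σ c π p := by
  simp only [expectedWeight, Finset.mul_sum, mul_assoc]
  rfl

theorem measurable_expectedWeight_simulate
    (σ : (Fin n → ℝ≥0) × (Fin n → ℝ≥0) → Equiv.Perm (Fin n))
    (hσ : ∀ π, MeasurableSet {p | σ p = π}) :
    Measurable fun p : (Fin n → ℝ≥0) × (Fin n → ℝ≥0) =>
      S.expectedWeight (simulate σ p.2) p.1 := by
  simp only [expectedWeight_simulate]
  exact Finset.measurable_sum _ fun c _ => Finset.measurable_sum _ fun π _ =>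
    (S.measurable_exchangedWeight σ hσ c π).const_mul _

/-- For each fixed `c` and `π` the observed set does not depend on the vectors, so the integral can
be transported along the corresponding exchange. Afterwards `p.2` only informs the adversary. -/
theorem lintegral_reduction (D : Fin n → Measure ℝ≥0) [∀ i, IsProbabilityMeasure (D i)]
    (σ : (Fin n → ℝ≥0) × (Fin n → ℝ≥0) → Equiv.Perm (Fin n))
    (hσ : ∀ π, MeasurableSet {p | σ p = π}) :
    ∫⁻ p, S.reduction.expectedWeight p.1 p.2 (σ p) ∂((Measure.pi D).prod (Measure.pi D)) =
      ∫⁻ p, S.expectedWeight (simulate σ p.2) p.1 ∂((Measure.pi D).prod (Measure.pi D)) := by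
  simp only [expectedWeight_simulate, SingleSampleAlgorithm.expectedWeight]
  rw [lintegral_finsetSum _ fun c _ => (S.measurable_reduction_weight σ hσ c).const_mul _,
    lintegral_finsetSum _ fun c _ => Finset.measurable_sum _ fun π _ =>
      (S.measurable_exchangedWeight σ hσ c π).const_mul _]
  have hsum : ∀ f : S.Coin × Equiv.Perm (Fin n) → ℝ≥0∞,
      ∑ c : S.reduction.Coin, f c = ∑ c : S.Coin, ∑ π : Equiv.Perm (Fin n), f (c, π) :=
    fun f => by
      rw [← Fintype.sum_prod_type]
      exact Finset.sum_congr (by congr) fun _ _ => rfl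
  refine (hsum fun c => ∫⁻ p, S.reduction.law c * weight p.2
    (S.reduction.accepted c p.1 p.2 (orderList (σ p))) ∂_).trans ?_
  refine Finset.sum_congr rfl fun c _ => ?_
  rw [lintegral_finsetSum _ fun π _ => (S.measurable_exchangedWeight σ hσ c π).const_mul _]
  refine Finset.sum_congr rfl fun π _ => ?_
  rw [lintegral_const_mul _ (S.measurable_reduction_weight σ hσ (c, π)),
    lintegral_const_mul _ (S.measurable_exchangedWeight σ hσ c π), reduction_law]
  congr 1
  simp only [exchangedWeight_eq]
  exact ((measurePreserving_exchange (S.observed c π) D).lintegral_comp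
    (S.measurable_reduction_weight σ hσ (c, π))).symm

theorem lintegral_opt_fst (D : Fin n → Measure ℝ≥0) [∀ i, IsProbabilityMeasure (D i)]
    (J : Finset (Fin n) → Prop) :
    ∫⁻ v, opt J v ∂(Measure.pi D) =
      ∫⁻ p, opt J p.1 ∂((Measure.pi D).prod (Measure.pi D)) :=
  (measurePreserving_fst.lintegral_comp (measurable_opt J)).symm

/-- The reduction of an order-oblivious secretary algorithm is a single-sample prophet
inequality. -/
theorem IsOrderOblivious.isProphetInequality {S : ObserveFirstAlgorithm n}
    {J : Finset (Fin n) → Prop} {α : ℝ} (h : S.IsOrderOblivious J α) :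
    S.reduction.IsProphetInequality J α := by
  refine ⟨h.1.reduction, fun D hD σ hσ => ?_⟩
  have := hD
  have hm : Measurable fun p : (Fin n → ℝ≥0) × (Fin n → ℝ≥0) => opt J p.1 :=
    (measurable_opt J).comp measurable_fst
  rw [S.lintegral_reduction D σ hσ, lintegral_opt_fst, ← lintegral_const_mul _ hm]
  exact lintegral_mono fun p => h.2 _ _

theorem measurePreserving_comp_perm (D : Measure ℝ≥0) [IsProbabilityMeasure D]
    (ρ : Equiv.Perm (Fin n)) :
    MeasurePreserving (fun p : (Fin n → ℝ≥0) × (Fin n → ℝ≥0) => (p.1 ∘ ρ, p.2))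
      ((Measure.pi fun _ => D).prod (Measure.pi fun _ => D))
      ((Measure.pi fun _ => D).prod (Measure.pi fun _ => D)) := by
  have h1 : MeasurePreserving (fun u : Fin n → ℝ≥0 => u ∘ ρ)
      (Measure.pi fun _ => D) (Measure.pi fun _ => D) := by
    convert measurePreserving_piCongrLeft (fun _ : Fin n => D) ρ.symm using 1
    ext u i
    simp [MeasurableEquiv.piCongrLeft, Equiv.piCongrLeft, Equiv.piCongrLeft']
  exact h1.prod (MeasurePreserving.id _)

/-- Only the first vector is permuted. The advice `p.2` stays fixed, so one and the same adversary
faces all assignments of the weights `p.1`. -/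
theorem lintegral_eq_average (D : Measure ℝ≥0) [IsProbabilityMeasure D]
    (f : (Fin n → ℝ≥0) × (Fin n → ℝ≥0) → ℝ≥0∞) (hf : Measurable f) :
    ∫⁻ p, f p ∂((Measure.pi fun _ => D).prod (Measure.pi fun _ => D)) =
      ∫⁻ p, ∑ ρ : Equiv.Perm (Fin n), PMF.uniformOfFintype (Equiv.Perm (Fin n)) ρ *
        f (p.1 ∘ ρ, p.2) ∂((Measure.pi fun _ => D).prod (Measure.pi fun _ => D)) := by
  have hm : ∀ ρ : Equiv.Perm (Fin n),
      Measurable fun p : (Fin n → ℝ≥0) × (Fin n → ℝ≥0) => f (p.1 ∘ ρ, p.2) := fun ρ =>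
    hf.comp (measurePreserving_comp_perm D ρ).measurable
  rw [lintegral_finsetSum _ fun ρ _ => (hm ρ).const_mul _]
  have h : ∀ ρ : Equiv.Perm (Fin n),
      ∫⁻ p, PMF.uniformOfFintype (Equiv.Perm (Fin n)) ρ * f (p.1 ∘ ρ, p.2)
        ∂((Measure.pi fun _ => D).prod (Measure.pi fun _ => D)) =
      PMF.uniformOfFintype (Equiv.Perm (Fin n)) ρ *
        ∫⁻ p, f p ∂((Measure.pi fun _ => D).prod (Measure.pi fun _ => D)) := fun ρ => by
    rw [lintegral_const_mul _ (hm ρ)]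
    congr 1
    exact (measurePreserving_comp_perm D ρ).lintegral_comp hf
  simp only [h, ← Finset.sum_mul]
  rw [← tsum_fintype (L := .unconditional _), PMF.tsum_coe, one_mul]

/-- In the random assignment model the reduction yields a single-sample prophet inequality for
independent and identically distributed values. -/
theorem IsOrderObliviousRandomAssignment.isIIDProphetInequality {S : ObserveFirstAlgorithm n}
    {J : Finset (Fin n) → Prop} {α : ℝ} (h : S.IsOrderObliviousRandomAssignment J α) :
    S.reduction.IsIIDProphetInequality J α := by
  refine ⟨h.1.reduction, fun D hD σ hσ => ?_⟩
  have := hD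
  have hm : Measurable fun p : (Fin n → ℝ≥0) × (Fin n → ℝ≥0) => opt J p.1 :=
    (measurable_opt J).comp measurable_fst
  rw [S.lintegral_reduction (fun _ => D) σ hσ, lintegral_opt_fst, lintegral_eq_average D _ hm,
    lintegral_eq_average D _ (S.measurable_expectedWeight_simulate σ hσ),
    ← lintegral_const_mul]
  · exact lintegral_mono fun p => h.2 (simulate σ p.2) p.1
  · exact Finset.measurable_sum _ fun ρ _ =>
      (hm.comp (measurePreserving_comp_perm D ρ).measurable).const_mul _

end ObserveFirstAlgorithm

/-! ### Rankings -/

/-- The ranking of the elements by decreasing value, ties broken by the permutation `t`. -/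
def ranking (v : Fin n → ℝ≥0) (t : Equiv.Perm (Fin n)) : Equiv.Perm (Fin n) :=
  (Tuple.sort fun a => toLex (OrderDual.toDual (v a), t a))⁻¹

theorem ranking_lt_iff (v : Fin n → ℝ≥0) (t : Equiv.Perm (Fin n)) (a b : Fin n) :
    ranking v t a < ranking v t b ↔ v b < v a ∨ (v a = v b ∧ t a < t b) := by
  set f : Fin n → Lex (ℝ≥0ᵒᵈ × Fin n) := fun a => toLex (OrderDual.toDual (v a), t a) with hf
  have hinj : Function.Injective f := by
    intro x y h
    simp only [hf, EmbeddingLike.apply_eq_iff_eq, Prod.mk.injEq] at h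
    exact h.2
  have hmono : StrictMono (f ∘ Tuple.sort f) :=
    (Tuple.monotone_sort f).strictMono_of_injective (hinj.comp (Tuple.sort f).injective)
  have h := hmono.lt_iff_lt (a := ranking v t a) (b := ranking v t b)
  have hx : ∀ x, (f ∘ Tuple.sort f) (ranking v t x) = f x := fun x => by
    simp [ranking, hf]
  rw [hx, hx] at h
  rw [← h, Prod.Lex.lt_iff]
  simp [hf]

theorem value_le_of_ranking_lt {v : Fin n → ℝ≥0} {t : Equiv.Perm (Fin n)} {a b : Fin n}
    (h : ranking v t a < ranking v t b) : v b ≤ v a := by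
  rw [ranking_lt_iff] at h
  rcases h with h | h
  · exact h.le
  · exact h.1.ge

/-- `R' * R⁻¹` is an order automorphism of `Fin n`, hence the identity. -/
theorem perm_eq_of_lt_iff {R R' : Equiv.Perm (Fin n)} (h : ∀ a b, R a < R b ↔ R' a < R' b) :
    R = R' := by
  have h1 : StrictMono (R' * R⁻¹ : Equiv.Perm (Fin n)) := by
    intro a b hab
    have := h (R⁻¹ a) (R⁻¹ b)
    rw [show R (R⁻¹ a) = a from R.apply_symm_apply a,
      show R (R⁻¹ b) = b from R.apply_symm_apply b] at this
    exact this.1 hab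
  let e : Fin n ≃o Fin n := h1.orderIsoOfSurjective _ (R' * R⁻¹).surjective
  have h2 : e = OrderIso.refl _ := Subsingleton.elim _ _
  ext a
  have h3 : e (R a) = R a := by rw [h2]; rfl
  have h4 : e (R a) = R' a := by simp [e]
  rw [← h3, h4]

/-- Equivariance: permuting values and tie-breaks together permutes the ranking. This makes the
ranking of randomly assigned weights with random tie-breaks uniform. -/
theorem ranking_comp (v : Fin n → ℝ≥0) (t π : Equiv.Perm (Fin n)) :
    ranking (v ∘ π) (t * π) = ranking v t * π := by
  refine perm_eq_of_lt_iff fun a b => ?_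
  rw [ranking_lt_iff]
  exact (ranking_lt_iff v t (π a) (π b)).symm

theorem measurableSet_ranking_eq {β : Type*} [MeasurableSpace β] (v : β → Fin n → ℝ≥0)
    (hv : Measurable v) (t R : Equiv.Perm (Fin n)) :
    MeasurableSet {b | ranking (v b) t = R} := by
  have : {b | ranking (v b) t = R} = ⋂ x, ⋂ y,
      {b | (v b y < v b x ∨ (v b x = v b y ∧ t x < t y)) ↔ R x < R y} := by
    ext b
    simp only [Set.mem_ofPred_eq, Set.mem_iInter, ← ranking_lt_iff]
    exact ⟨fun h => by simp [h], perm_eq_of_lt_iff⟩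
  rw [this]
  have hm : ∀ x, Measurable fun b => v b x := fun x => (measurable_pi_apply x).comp hv
  refine MeasurableSet.iInter fun x => MeasurableSet.iInter fun y => ?_
  have h1 : MeasurableSet {b | v b y < v b x ∨ (v b x = v b y ∧ t x < t y)} :=
    (measurableSet_lt (hm y) (hm x)).union
      ((measurableSet_eq_fun (hm x) (hm y)).inter (MeasurableSet.const _))
  by_cases h : R x < R y
  · simpa [h] using h1
  · simp only [h, iff_false]
    exact h1.compl

/-! ### Random subsets -/

/-- Expectation over a random subset that contains every element independently with
probability `p`. -/
def Ex (p : ℝ) (f : Finset (Fin n) → ℝ) : ℝ :=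
  ∑ O : Finset (Fin n), p ^ O.card * (1 - p) ^ (n - O.card) * f O

/-- The elements with index less than `k`. -/
def initialSegment (n k : ℕ) : Finset (Fin n) := Finset.univ.filter fun i => i.1 < k

theorem toFinset_take_orderList (π : Equiv.Perm (Fin n)) (k : ℕ) :
    ((orderList π).take k).toFinset = (initialSegment n k).map π.toEmbedding := by
  ext x
  simp only [List.mem_toFinset, Finset.mem_map, initialSegment, Finset.mem_filter,
    Finset.mem_univ, true_and, Equiv.coe_toEmbedding, List.mem_take_iff_getElem, orderList,
    List.length_ofFn, List.getElem_ofFn]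
  constructor
  · rintro ⟨i, hi, rfl⟩
    exact ⟨⟨i, by omega⟩, by simp; omega, rfl⟩
  · rintro ⟨i, hi, rfl⟩
    exact ⟨i, by have := i.2; omega, rfl⟩

theorem exists_perm_map_initialSegment (T : Finset (Fin n)) :
    ∃ ε : Equiv.Perm (Fin n), (initialSegment n T.card).map ε.toEmbedding = T := by
  have hT : T.card ≤ n := by simpa using T.card_le_univ
  have hc : (initialSegment n T.card).card = T.card := by
    rw [initialSegment, Fin.card_filter_val_lt, min_eq_right hT]
  let e := Finset.equivOfCardEq hc
  refine ⟨e.extendSubtype, Finset.eq_of_subset_of_card_le ?_ (by rw [Finset.card_map, hc])⟩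
  intro x hx
  rw [Finset.mem_map] at hx
  obtain ⟨y, hy, rfl⟩ := hx
  exact Equiv.extendSubtype_mem e y hy

/-- The first `|T|` elements of a uniform order form a uniform set of that size. Hence a set drawn
with weights depending only on its size can be replaced by that initial segment, whose length is all
that `S` controls. -/
theorem sum_take_orderList (m : ℕ → ℝ≥0∞) (F : Finset (Fin n) → ℝ≥0∞) :
    ∑ T : Finset (Fin n), m T.card * ∑ π : Equiv.Perm (Fin n),
      PMF.uniformOfFintype (Equiv.Perm (Fin n)) π * F ((orderList π).take T.card).toFinset =
    ∑ T : Finset (Fin n), m T.card * F T := by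
  have h1 : ∀ T : Finset (Fin n), ∑ π : Equiv.Perm (Fin n),
      PMF.uniformOfFintype (Equiv.Perm (Fin n)) π * F ((orderList π).take T.card).toFinset =
      ∑ π : Equiv.Perm (Fin n),
        PMF.uniformOfFintype (Equiv.Perm (Fin n)) π * F (T.map π.toEmbedding) := by
    intro T
    -- Composing the order with `ε` turns its initial segment into the image of `T`, without
    -- changing the uniform law.
    obtain ⟨ε, hε⟩ := exists_perm_map_initialSegment T
    refine (Fintype.sum_equiv (Equiv.mulRight ε) _ _ fun π => ?_).symm
    rw [toFinset_take_orderList]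
    simp only [PMF.uniformOfFintype_apply]
    congr 2
    conv_lhs => rw [← hε]
    rw [Finset.map_map]
    rfl
  simp only [h1, Finset.mul_sum]
  rw [Finset.sum_comm]
  have h2 : ∀ π : Equiv.Perm (Fin n), ∑ T : Finset (Fin n),
      m T.card * (PMF.uniformOfFintype (Equiv.Perm (Fin n)) π * F (T.map π.toEmbedding)) =
      PMF.uniformOfFintype (Equiv.Perm (Fin n)) π * ∑ T : Finset (Fin n), m T.card * F T := by
    intro π
    rw [Finset.mul_sum]
    refine Fintype.sum_equiv (Equiv.finsetCongr π) _ _ fun T => ?_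
    rw [Equiv.finsetCongr_apply, Finset.card_map]
    ring
  simp only [h2, ← Finset.sum_mul]
  rw [← tsum_fintype (L := .unconditional _), PMF.tsum_coe, one_mul]

/-! ### Algorithms that depend only on the ranking of the values -/

/-- The values in a list of labelled values, extended by `0`. -/
def knownValue (l : List (Fin n × ℝ≥0)) (j : Fin n) : ℝ≥0 := (l.lookup j).getD 0

theorem knownValue_append (a b : Fin n → ℝ≥0) (o l : List (Fin n)) (j : Fin n) :
    knownValue (labelled a o ++ labelled b l) j =
      if j ∈ o then a j else if j ∈ l then b j else 0 := by
  induction o with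
  | nil =>
    induction l with
    | nil => simp [knownValue, labelled]; rfl
    | cons x l ih =>
      simp only [knownValue, labelled, List.map_nil, List.nil_append, List.map_cons,
        List.lookup_cons, List.mem_cons, List.not_mem_nil, if_false] at ih ⊢
      by_cases h : j = x
      · subst h; simp; rfl
      · have : (j == x) = false := by simpa using h
        simp [this, h, ih]
  | cons x o ih =>
    simp only [knownValue, labelled, List.map_cons, List.cons_append,
      List.lookup_cons, List.mem_cons] at ih ⊢
    by_cases h : j = x
    · subst h; simp; rfl
    · have : (j == x) = false := by simpa using h
      simp [this, h, ih]

theorem map_fst_labelled (v : Fin n → ℝ≥0) (l : List (Fin n)) :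
    (labelled v l).map Prod.fst = l := by
  simp [labelled, Function.comp_def]

open Classical in
/-- The decision taken by a selection rule that depends only on the ranking of the known values:
`sel R O H i` is the decision on `i` when `O` was observed and `H` was revealed before `i`. -/
def ordinalAccept (t : Equiv.Perm (Fin n))
    (sel : Equiv.Perm (Fin n) → Finset (Fin n) → Finset (Fin n) → Fin n → Prop)
    (o h : List (Fin n × ℝ≥0)) (i : Fin n) (x : ℝ≥0) : Bool :=
  decide (sel (ranking (knownValue (o ++ (h ++ [(i, x)]))) t) (o.map Prod.fst).toFinset
    (h.map Prod.fst).toFinset i)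

theorem ordinalAccept_eq_true_iff {t : Equiv.Perm (Fin n)}
    {sel : Equiv.Perm (Fin n) → Finset (Fin n) → Finset (Fin n) → Fin n → Prop}
    {o h : List (Fin n × ℝ≥0)} {i : Fin n} {x : ℝ≥0} :
    ordinalAccept t sel o h i x = true ↔
      sel (ranking (knownValue (o ++ (h ++ [(i, x)]))) t) (o.map Prod.fst).toFinset
        (h.map Prod.fst).toFinset i := by
  simp [ordinalAccept]

theorem measurable_ordinalAccept (t : Equiv.Perm (Fin n))
    (sel : Equiv.Perm (Fin n) → Finset (Fin n) → Finset (Fin n) → Fin n → Prop)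
    (o l : List (Fin n)) (i : Fin n) :
    Measurable fun p : (Fin n → ℝ≥0) × (Fin n → ℝ≥0) =>
      ordinalAccept t sel (labelled p.1 o) (labelled p.2 l) i (p.2 i) := by
  have hk : ∀ p : (Fin n → ℝ≥0) × (Fin n → ℝ≥0),
      labelled p.2 l ++ [(i, p.2 i)] = labelled p.2 (l ++ [i]) := fun p => by simp [labelled]
  refine measurable_to_bool ?_
  have : (fun p : (Fin n → ℝ≥0) × (Fin n → ℝ≥0) =>
      ordinalAccept t sel (labelled p.1 o) (labelled p.2 l) i (p.2 i)) ⁻¹' {true} =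
      ⋃ R, ⋃ (_ : sel R o.toFinset l.toFinset i), {p | ranking (fun j =>
        if j ∈ o then p.1 j else if j ∈ l ++ [i] then p.2 j else 0) t = R} := by
    ext p
    simp only [ordinalAccept, map_fst_labelled, hk, Set.mem_preimage, Set.mem_singleton_iff,
      decide_eq_true_eq, Set.mem_iUnion, Set.mem_ofPred_eq, exists_prop, exists_eq_right',
      funext (knownValue_append p.1 p.2 o (l ++ [i]))]
  rw [this]
  refine MeasurableSet.iUnion fun R => MeasurableSet.iUnion fun _ => ?_
  refine measurableSet_ranking_eq _ (measurable_pi_lambda _ fun j => ?_) _ _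
  split_ifs <;> fun_prop

/-- The decision `sel R O H i` depends only on how `R` ranks the known elements. -/
def IsLocal (sel : Equiv.Perm (Fin n) → Finset (Fin n) → Finset (Fin n) → Fin n → Prop) : Prop :=
  ∀ R R' O H i, (∀ a b, (a ∈ O ∨ a ∈ H ∨ a = i) → (b ∈ O ∨ b ∈ H ∨ b = i) →
    (R a < R b ↔ R' a < R' b)) → (sel R O H i ↔ sel R' O H i)

/-- By locality the ranking of the values known so far, padded by `0`, may be replaced by the true
ranking: the two agree on the known elements. -/
theorem mem_acceptedFrom_ordinal {t : Equiv.Perm (Fin n)}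
    {sel : Equiv.Perm (Fin n) → Finset (Fin n) → Finset (Fin n) → Fin n → Prop}
    (hloc : IsLocal sel) (v : Fin n → ℝ≥0) (o l : List (Fin n)) (i : Fin n) :
    i ∈ acceptedFrom (ordinalAccept t sel (labelled v o)) v [] l ↔
      ∃ l₁ l₂, l = l₁ ++ i :: l₂ ∧ sel (ranking v t) o.toFinset l₁.toFinset i := by
  rw [mem_acceptedFrom_iff]
  refine exists_congr fun l₁ => exists_congr fun l₂ => and_congr_right fun _ => ?_
  have hk : labelled v l₁ ++ [(i, v i)] = labelled v (l₁ ++ [i]) := by simp [labelled]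
  rw [List.nil_append, ordinalAccept_eq_true_iff, map_fst_labelled, map_fst_labelled, hk]
  refine hloc _ _ _ _ _ fun a b ha hb => ?_
  have hval : ∀ x, (x ∈ o.toFinset ∨ x ∈ l₁.toFinset ∨ x = i) →
      knownValue (labelled v o ++ labelled v (l₁ ++ [i])) x = v x := by
    intro x hx
    rw [knownValue_append]
    simp only [List.mem_toFinset] at hx
    rcases hx with hx | hx | hx <;> simp [hx]
  rw [ranking_lt_iff, ranking_lt_iff, hval a ha, hval b hb]

theorem toFinset_prefix {l₁ l₂ : List (Fin n)} {i : Fin n} (h : (l₁ ++ i :: l₂).Nodup) :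
    l₁.toFinset = (l₁ ++ i :: l₂).toFinset.filter
      fun j => (l₁ ++ i :: l₂).idxOf j < (l₁ ++ i :: l₂).idxOf i := by
  have hi : i ∉ l₁ := fun hi => by
    rw [List.nodup_append] at h
    exact h.2.2 i hi i (by simp) rfl
  have h1 : (l₁ ++ i :: l₂).idxOf i = l₁.length := by
    rw [List.idxOf_append_of_notMem hi, List.idxOf_cons_self, add_zero]
  ext j
  rw [Finset.mem_filter, List.mem_toFinset, List.mem_toFinset, h1]
  constructor
  · intro hj
    refine ⟨by simp [hj], ?_⟩
    rw [List.idxOf_append_of_mem hj]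
    exact List.idxOf_lt_length_of_mem hj
  · rintro ⟨-, hj⟩
    by_contra hj'
    rw [List.idxOf_append_of_notMem hj'] at hj
    omega

open Classical in
/-- The elements that are accepted in every order after the observation of `O`. -/
def surelyAccepted (sel : Equiv.Perm (Fin n) → Finset (Fin n) → Finset (Fin n) → Fin n → Prop)
    (R : Equiv.Perm (Fin n)) (O : Finset (Fin n)) : Finset (Fin n) :=
  Finset.univ.filter fun i => i ∉ O ∧ sel R O (Oᶜ.erase i) i

theorem mem_surelyAccepted
    {sel : Equiv.Perm (Fin n) → Finset (Fin n) → Finset (Fin n) → Fin n → Prop}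
    {R : Equiv.Perm (Fin n)} {O : Finset (Fin n)} {i : Fin n} :
    i ∈ surelyAccepted sel R O ↔ i ∉ O ∧ sel R O (Oᶜ.erase i) i := by
  simp [surelyAccepted]

/-- Everything revealed before `i` lies in `Oᶜ.erase i`. As acceptance is antitone in the revealed
set, the worst history is all of it. -/
theorem surelyAccepted_subset {t : Equiv.Perm (Fin n)}
    {sel : Equiv.Perm (Fin n) → Finset (Fin n) → Finset (Fin n) → Fin n → Prop}
    (hloc : IsLocal sel) (hanti : ∀ R O H H' i, H' ⊆ H → sel R O H i → sel R O H' i)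
    (v : Fin n → ℝ≥0) (o : List (Fin n)) (π : Equiv.Perm (Fin n)) :
    surelyAccepted sel (ranking v t) o.toFinset ⊆
      acceptedFrom (ordinalAccept t sel (labelled v o)) v [] (remaining o π) := by
  intro i hi
  obtain ⟨hio, hs⟩ := mem_surelyAccepted.1 hi
  rw [mem_acceptedFrom_ordinal hloc]
  have hmem : i ∈ remaining o π := by
    simp only [remaining, List.mem_filter, decide_eq_true_eq, orderList, List.mem_ofFn]
    exact ⟨⟨π⁻¹ i, by simp⟩, by simpa using hio⟩
  obtain ⟨l₁, l₂, h⟩ := List.append_of_mem hmem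
  refine ⟨l₁, l₂, h, hanti _ _ _ _ _ ?_ hs⟩
  have hnd : (l₁ ++ i :: l₂).Nodup := by
    rw [← h]
    exact (ObserveFirstAlgorithm.nodup_orderList π).filter _
  intro j hj
  rw [List.mem_toFinset] at hj
  have hj2 : j ∈ remaining o π := by rw [h]; simp [hj]
  simp only [remaining, List.mem_filter, decide_eq_true_eq] at hj2
  rw [Finset.mem_erase, Finset.mem_compl, List.mem_toFinset]
  refine ⟨?_, hj2.2⟩
  rintro rfl
  rw [List.nodup_append] at hnd
  exact hnd.2.2 j hj j (by simp) rfl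

/-- The law of a uniform coin together with a random set that contains every element independently
with probability `p`. -/
def coinLaw (K : Type) [Fintype K] [Nonempty K] (n : ℕ) (p : ℝ) (hp0 : 0 ≤ p) (hp1 : p ≤ 1) :
    PMF (K × Finset (Fin n)) :=
  PMF.ofFintype (fun c => (Fintype.card K : ℝ≥0∞)⁻¹ *
    (ENNReal.ofReal p ^ c.2.card * ENNReal.ofReal (1 - p) ^ (n - c.2.card))) <| by
    have h := Finset.sum_pow_mul_eq_add_pow (ENNReal.ofReal p) (ENNReal.ofReal (1 - p))
      (Finset.univ : Finset (Fin n))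
    rw [Finset.powerset_univ, Finset.card_univ, Fintype.card_fin,
      ← ENNReal.ofReal_add hp0 (by linarith), add_sub_cancel, ENNReal.ofReal_one, one_pow] at h
    rw [Fintype.sum_prod_type]
    simp only [← Finset.mul_sum, h, mul_one, Finset.sum_const, Finset.card_univ, nsmul_eq_mul]
    exact ENNReal.mul_inv_cancel (by simp) (by simp)

/-- The secretary algorithm that observes a random set containing every element independently with
probability `p` and then decides by the ranking of the values, using a uniformly random coin. -/
def ordinalAlgorithm (K : Type) [Fintype K] [Nonempty K] (p : ℝ) (hp0 : 0 ≤ p) (hp1 : p ≤ 1)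
    (tie : K → Equiv.Perm (Fin n))
    (sel : K → Equiv.Perm (Fin n) → Finset (Fin n) → Finset (Fin n) → Fin n → Prop) :
    ObserveFirstAlgorithm n where
  Coin := K × Finset (Fin n)
  law := coinLaw K n p hp0 hp1
  sampleSize c := c.2.card
  sampleSize_le c := by simpa using c.2.card_le_univ
  accept c := ordinalAccept (tie c.1) (sel c.1)
  measurable_accept c := measurable_ordinalAccept (tie c.1) (sel c.1)

section ordinalAlgorithm

variable {K : Type} [Fintype K] [Nonempty K] {p : ℝ} {hp0 : 0 ≤ p} {hp1 : p ≤ 1}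
  {tie : K → Equiv.Perm (Fin n)}
  {sel : K → Equiv.Perm (Fin n) → Finset (Fin n) → Finset (Fin n) → Fin n → Prop}

open Classical in
-- The arrival order enters only through arrival times `κ`, so feasibility is a statement about
-- sets.
theorem ordinalAlgorithm_isFeasible {J : Finset (Fin n) → Prop} (hloc : ∀ k, IsLocal (sel k))
    (hfeas : ∀ k R (O N : Finset (Fin n)), Disjoint O N → ∀ κ : Fin n → ℕ, Set.InjOn κ N →
      J (N.filter fun i => sel k R O (N.filter fun j => κ j < κ i) i)) :
    (ordinalAlgorithm K p hp0 hp1 tie sel).IsFeasible J := by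
  rintro ⟨k, T⟩ v o l - hnd
  rw [List.nodup_append] at hnd
  have h := hfeas k (ranking v (tie k)) o.toFinset l.toFinset
    (Finset.disjoint_left.2 fun a ha ha' => hnd.2.2 a (by simpa using ha) a (by simpa using ha')
      rfl) (fun j => l.idxOf j) (fun a ha b _ hab => by
        rw [Finset.mem_coe, List.mem_toFinset] at ha
        exact (List.idxOf_inj ha).1 hab)
  convert h using 1
  ext i
  refine (mem_acceptedFrom_ordinal (hloc k) v o l i).trans ?_
  rw [Finset.mem_filter, List.mem_toFinset]
  constructor
  · rintro ⟨l₁, l₂, rfl, hs⟩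
    refine ⟨by simp, ?_⟩
    rwa [← toFinset_prefix hnd.2.1]
  · rintro ⟨hi, hs⟩
    obtain ⟨l₁, l₂, rfl⟩ := List.append_of_mem hi
    refine ⟨l₁, l₂, rfl, ?_⟩
    rwa [← toFinset_prefix hnd.2.1] at hs

/-- The bound no longer mentions `τ`: only the random set `O` and the coin `k` remain. -/
theorem ordinalAlgorithm_expectedWeight (hloc : ∀ k, IsLocal (sel k))
    (hanti : ∀ k R O H H' i, H' ⊆ H → sel k R O H i → sel k R O H' i)
    (τ : (Fin n → ℝ≥0) → List (Fin n) → Equiv.Perm (Fin n)) (v : Fin n → ℝ≥0) :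
    ENNReal.ofReal ((∑ k, Ex p fun O =>
        ∑ i ∈ surelyAccepted (sel k) (ranking v (tie k)) O, (v i : ℝ)) / Fintype.card K) ≤
      (ordinalAlgorithm K p hp0 hp1 tie sel).expectedWeight τ v := by
  have hp2 : 0 ≤ 1 - p := by linarith
  have h1 : ∑ c : K × Finset (Fin n), coinLaw K n p hp0 hp1 c * ∑ π : Equiv.Perm (Fin n),
      PMF.uniformOfFintype (Equiv.Perm (Fin n)) π * weight v (surelyAccepted (sel c.1)
        (ranking v (tie c.1)) ((orderList π).take c.2.card).toFinset) ≤
      (ordinalAlgorithm K p hp0 hp1 tie sel).expectedWeight τ v := by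
    rw [ObserveFirstAlgorithm.expectedWeight]
    refine Finset.sum_le_sum fun c _ => ?_
    refine mul_le_mul_right (Finset.sum_le_sum fun π _ => mul_le_mul_right ?_ _) _
    exact Finset.sum_le_sum_of_subset
      (surelyAccepted_subset (hloc c.1) (hanti c.1) v _ (τ v _))
  refine le_trans (le_of_eq ?_) h1
  rw [Fintype.sum_prod_type, Finset.sum_div, ENNReal.ofReal_sum_of_nonneg]
  · refine Finset.sum_congr rfl fun k _ => ?_
    simp only [coinLaw, PMF.ofFintype_apply, mul_assoc]
    rw [← Finset.mul_sum]
    have h2 := sum_take_orderList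
      (fun m => ENNReal.ofReal p ^ m * ENNReal.ofReal (1 - p) ^ (n - m))
      (fun O => weight v (surelyAccepted (sel k) (ranking v (tie k)) O))
    simp only [mul_assoc] at h2
    rw [h2, Ex, div_eq_inv_mul, ENNReal.ofReal_mul (by positivity),
      ENNReal.ofReal_inv_of_pos (by exact_mod_cast Fintype.card_pos), ENNReal.ofReal_natCast,
      ENNReal.ofReal_sum_of_nonneg fun O _ => by positivity]
    congr 1
    refine Finset.sum_congr rfl fun O _ => ?_
    rw [mul_assoc, ENNReal.ofReal_mul (by positivity), ENNReal.ofReal_mul (by positivity),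
      ENNReal.ofReal_pow hp0, ENNReal.ofReal_pow hp2, weight,
      ENNReal.ofReal_sum_of_nonneg fun i _ => by positivity]
    simp
  · intro k _
    refine div_nonneg (Finset.sum_nonneg fun O _ => ?_) (by positivity)
    positivity

end ordinalAlgorithm

theorem ofReal_mul_opt_le {J : Finset (Fin n) → Prop} {v : Fin n → ℝ≥0} {α : ℝ} (hα : 0 ≤ α)
    {x : ℝ≥0∞} (h : ∀ A, J A → ENNReal.ofReal (α * ∑ i ∈ A, (v i : ℝ)) ≤ x) :
    ENNReal.ofReal α * opt J v ≤ x := by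
  simp only [opt, ENNReal.mul_iSup]
  refine iSup₂_le fun A hA => le_trans (le_of_eq ?_) (h A hA)
  rw [ENNReal.ofReal_mul hα, ENNReal.ofReal_sum_of_nonneg fun i _ => by positivity, weight]
  simp

/-! ### Expectations over random subsets -/

open Classical in
/-- The indicator of a proposition. -/
def ind (P : Prop) : ℝ := if P then 1 else 0

theorem ind_of_true {P : Prop} (h : P) : ind P = 1 := if_pos h

theorem ind_of_false {P : Prop} (h : ¬P) : ind P = 0 := if_neg h

theorem ind_nonneg (P : Prop) : 0 ≤ ind P := by
  unfold ind; split_ifs <;> norm_num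

theorem ind_le_one (P : Prop) : ind P ≤ 1 := by
  unfold ind; split_ifs <;> norm_num

theorem ind_mono {P Q : Prop} (h : P → Q) : ind P ≤ ind Q := by
  by_cases hP : P
  · rw [ind_of_true hP, ind_of_true (h hP)]
  · rw [ind_of_false hP]; exact ind_nonneg _

theorem sum_ind_le_one {ι : Type*} [Fintype ι] (P : ι → Prop) (h : ∀ i j, P i → P j → i = j) :
    ∑ i, ind (P i) ≤ 1 := by
  by_cases hP : ∃ i, P i
  · obtain ⟨i, hi⟩ := hP
    rw [Finset.sum_eq_single i]
    · exact ind_le_one _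
    · exact fun j _ hj => ind_of_false fun hj' => hj (h _ _ hj' hi)
    · simp
  · push Not at hP
    rw [Finset.sum_eq_zero fun i _ => ind_of_false (hP i)]
    norm_num

theorem Ex_mono {p : ℝ} (hp0 : 0 ≤ p) (hp1 : p ≤ 1) {f g : Finset (Fin n) → ℝ}
    (h : ∀ O, f O ≤ g O) : Ex p f ≤ Ex p g := by
  have : 0 ≤ 1 - p := by linarith
  exact Finset.sum_le_sum fun O _ => mul_le_mul_of_nonneg_left (h O) (by positivity)

theorem Ex_add (p : ℝ) (f g : Finset (Fin n) → ℝ) :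
    Ex p (fun O => f O + g O) = Ex p f + Ex p g := by
  simp only [Ex, mul_add, Finset.sum_add_distrib]

theorem Ex_sub (p : ℝ) (f g : Finset (Fin n) → ℝ) :
    Ex p (fun O => f O - g O) = Ex p f - Ex p g := by
  simp only [Ex, mul_sub, Finset.sum_sub_distrib]

theorem Ex_const_mul (p c : ℝ) (f : Finset (Fin n) → ℝ) :
    Ex p (fun O => c * f O) = c * Ex p f := by
  simp only [Ex, Finset.mul_sum]
  exact Finset.sum_congr rfl fun O _ => by ring

theorem Ex_sum {ι : Type*} (s : Finset ι) (p : ℝ) (f : ι → Finset (Fin n) → ℝ) :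
    Ex p (fun O => ∑ i ∈ s, f i O) = ∑ i ∈ s, Ex p (f i) := by
  simp only [Ex, Finset.mul_sum]
  exact Finset.sum_comm

theorem Ex_one (p : ℝ) : Ex p (fun _ : Finset (Fin n) => 1) = 1 := by
  have h := Finset.sum_pow_mul_eq_add_pow p (1 - p) (Finset.univ : Finset (Fin n))
  rw [Finset.powerset_univ, Finset.card_univ, Fintype.card_fin, add_sub_cancel, one_pow] at h
  simpa [Ex] using h

/-- `f O` does not depend on whether `O` contains `i`. -/
def AwayFrom {β : Sort*} (i : Fin n) (f : Finset (Fin n) → β) : Prop :=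
  ∀ O O', (∀ j, j ≠ i → (j ∈ O ↔ j ∈ O')) → f O = f O'

theorem AwayFrom.ind {i : Fin n} {P : Finset (Fin n) → Prop} (h : AwayFrom i P) :
    AwayFrom i fun O => ind (P O) :=
  fun O O' hO => congrArg _ (h O O' hO)

/-- Conditioning on all coins other than that of `i`. -/
theorem Ex_eq_sum_erase (p : ℝ) (i : Fin n) (f : Finset (Fin n) → ℝ) :
    Ex p f = ∑ t ∈ (Finset.univ.erase i).powerset, p ^ t.card * (1 - p) ^ (n - 1 - t.card) *
      ((1 - p) * f t + p * f (insert i t)) := by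
  rw [Ex, ← Finset.powerset_univ,
    show (Finset.univ : Finset (Fin n)).powerset = (insert i (Finset.univ.erase i)).powerset by
      rw [Finset.insert_erase (Finset.mem_univ i)],
    Finset.sum_powerset_insert (Finset.notMem_erase i _), ← Finset.sum_add_distrib]
  refine Finset.sum_congr rfl fun t ht => ?_
  rw [Finset.mem_powerset] at ht
  have hi : i ∉ t := fun h => Finset.notMem_erase i _ (ht h)
  have hc : t.card ≤ n - 1 := by
    have := Finset.card_le_card ht
    rwa [Finset.card_erase_of_mem (Finset.mem_univ i), Finset.card_univ, Fintype.card_fin] at this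
  have hn : 0 < n := i.pos
  rw [Finset.card_insert_of_notMem hi, show n - t.card = (n - 1 - t.card) + 1 by omega,
    show n - (t.card + 1) = n - 1 - t.card by omega]
  ring

/-- Independence of the coin of `i` from any quantity determined by the other coins. -/
theorem Ex_mul_of_awayFrom (p : ℝ) {i : Fin n} {f : Finset (Fin n) → ℝ} (hf : AwayFrom i f)
    (a b : ℝ) :
    Ex p (fun O => (if i ∈ O then a else b) * f O) = (p * a + (1 - p) * b) * Ex p f := by
  rw [Ex_eq_sum_erase p i, Ex_eq_sum_erase p i f, Finset.mul_sum]
  refine Finset.sum_congr rfl fun t ht => ?_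
  rw [Finset.mem_powerset] at ht
  have hi : i ∉ t := fun h => Finset.notMem_erase i _ (ht h)
  have : f (insert i t) = f t := hf _ _ fun j hj => by simp [hj]
  rw [if_neg hi, if_pos (Finset.mem_insert_self i t), this]
  ring

theorem Ex_ind_mem_and (p : ℝ) {i : Fin n} {P : Finset (Fin n) → Prop} (hP : AwayFrom i P) :
    Ex p (fun O => ind (i ∈ O ∧ P O)) = p * Ex p fun O => ind (P O) := by
  have h1 := Ex_mul_of_awayFrom p hP.ind 1 0
  rw [show p * 1 + (1 - p) * 0 = p by ring] at h1
  rw [← h1]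
  congr 1
  ext O
  by_cases h : i ∈ O <;> simp [h, ind_of_false not_false]

theorem Ex_ind_notMem_and (p : ℝ) {i : Fin n} {P : Finset (Fin n) → Prop} (hP : AwayFrom i P) :
    Ex p (fun O => ind (i ∉ O ∧ P O)) = (1 - p) * Ex p fun O => ind (P O) := by
  have h1 := Ex_mul_of_awayFrom p hP.ind 0 1
  rw [show p * 0 + (1 - p) * 1 = 1 - p by ring] at h1
  rw [← h1]
  congr 1
  ext O
  by_cases h : i ∈ O <;> simp [h, ind_of_false not_false]

theorem Ex_ind_mem (p : ℝ) (i : Fin n) : Ex p (fun O => ind (i ∈ O)) = p := by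
  have h := Ex_ind_mem_and p (i := i) (P := fun _ => True) fun _ _ _ => rfl
  simpa [ind_of_true trivial, Ex_one] using h

theorem Ex_ind_notMem (p : ℝ) (i : Fin n) : Ex p (fun O => ind (i ∉ O)) = 1 - p := by
  have h := Ex_ind_notMem_and p (i := i) (P := fun _ => True) fun _ _ _ => rfl
  simpa [ind_of_true trivial, Ex_one] using h

/-! ### Simulated greedy matching -/

section matching

variable {W : Type*}

open Classical in
/-- Some element with a given property. -/
def pick (P : W → Prop) : Option W := if h : ∃ r, P r then some h.choose else none

theorem pick_eq_some {P : W → Prop} {r : W} (h : pick P = some r) : P r := by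
  unfold pick at h
  split_ifs at h with h'
  rw [Option.some.injEq] at h
  exact h ▸ h'.choose_spec

theorem pick_eq_none {P : W → Prop} (h : pick P = none) (r : W) : ¬P r := by
  unfold pick at h
  split_ifs at h with h'
  exact fun hr => h' ⟨r, hr⟩

/-- The right vertex to which the greedy algorithm, run on the observed elements of higher rank,
would match `i`. -/
def greedyLabel (adj : Fin n → W → Prop) (R : Equiv.Perm (Fin n)) (O : Finset (Fin n))
    (i : Fin n) : Option W :=
  pick fun r => adj i r ∧ ∀ j, R j < R i → j ∈ O → greedyLabel adj R O j ≠ some r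
termination_by (R i).val
decreasing_by assumption

variable {adj : Fin n → W → Prop} {R : Equiv.Perm (Fin n)} {O : Finset (Fin n)} {i : Fin n} {r : W}

theorem adj_of_greedyLabel (h : greedyLabel adj R O i = some r) : adj i r := by
  rw [greedyLabel] at h
  exact (pick_eq_some h).1

theorem greedyLabel_ne {j : Fin n} (h : greedyLabel adj R O i = some r) (hj : R j < R i)
    (hjO : j ∈ O) : greedyLabel adj R O j ≠ some r := by
  rw [greedyLabel] at h
  exact (pick_eq_some h).2 j hj hjO

theorem exists_of_greedyLabel_eq_none (h : greedyLabel adj R O i = none) (hr : adj i r) :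
    ∃ j ∈ O, R j < R i ∧ greedyLabel adj R O j = some r := by
  rw [greedyLabel] at h
  have := pick_eq_none h r
  push Not at this
  obtain ⟨j, hj, hjO, h⟩ := this hr
  exact ⟨j, hjO, hj, h⟩

/-- Induction along the ranking: a label is computed from the relative order of the element and the
observed elements above it, and from nothing else. -/
theorem greedyLabel_congr (adj : Fin n → W → Prop) (R R' : Equiv.Perm (Fin n))
    (O O' : Finset (Fin n)) (i : Fin n)
    (h : ∀ a b, (a = i ∨ a ∈ O ∧ R a < R i) → (b = i ∨ b ∈ O ∧ R b < R i) →
      (R a < R b ↔ R' a < R' b))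
    (hO : ∀ j, (j ∈ O ∧ R j < R i) ↔ (j ∈ O' ∧ R' j < R' i)) :
    greedyLabel adj R O i = greedyLabel adj R' O' i := by
  induction hm : (R i).val using Nat.strong_induction_on generalizing i with
  | _ m ih =>
    rw [greedyLabel, greedyLabel]
    congr 1
    ext r
    refine and_congr_right fun _ => forall_congr' fun j => ?_
    have key : j ∈ O → R j < R i → greedyLabel adj R O j = greedyLabel adj R' O' j := by
      intro hjO hj
      refine ih (R j).val (by omega) j (fun a b ha hb => h a b ?_ ?_) (fun a => ?_) rfl
      · rcases ha with rfl | ha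
        · exact Or.inr ⟨hjO, hj⟩
        · exact Or.inr ⟨ha.1, ha.2.trans hj⟩
      · rcases hb with rfl | hb
        · exact Or.inr ⟨hjO, hj⟩
        · exact Or.inr ⟨hb.1, hb.2.trans hj⟩
      · constructor
        · rintro ⟨haO, ha⟩
          refine ⟨((hO a).1 ⟨haO, ha.trans hj⟩).1, ?_⟩
          exact (h a j (Or.inr ⟨haO, ha.trans hj⟩) (Or.inr ⟨hjO, hj⟩)).1 ha
        · rintro ⟨haO, ha⟩
          have h1 := (hO a).2 ⟨haO, ha.trans ((hO j).1 ⟨hjO, hj⟩).2⟩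
          exact ⟨h1.1, (h a j (Or.inr h1) (Or.inr ⟨hjO, hj⟩)).2 ha⟩
    constructor
    · intro hh hj hjO
      have h1 := (hO j).2 ⟨hjO, hj⟩
      rw [← key h1.1 h1.2]
      exact hh h1.2 h1.1
    · intro hh hj hjO
      have h1 := (hO j).1 ⟨hjO, hj⟩
      rw [key hjO hj]
      exact hh h1.2 h1.1

theorem greedyLabel_congr_set {O O' : Finset (Fin n)} {i : Fin n}
    (hO : ∀ j, R j < R i → (j ∈ O ↔ j ∈ O')) :
    greedyLabel adj R O i = greedyLabel adj R O' i :=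
  greedyLabel_congr adj R R O O' i (fun _ _ _ _ => Iff.rfl) fun j =>
    ⟨fun h => ⟨(hO j h.2).1 h.1, h.2⟩, fun h => ⟨(hO j h.2).2 h.1, h.2⟩⟩

theorem greedyLabel_eq_of_agree {i j : Fin n} (h : R i ≤ R j) {O O' : Finset (Fin n)}
    (hO : ∀ k, k ≠ j → (k ∈ O ↔ k ∈ O')) : greedyLabel adj R O i = greedyLabel adj R O' i :=
  greedyLabel_congr_set fun k hk => hO k fun hkj => by
    subst hkj
    exact absurd (lt_of_lt_of_le hk h) (lt_irrefl _)

/-- Accept an element if it has a label and no element with the same label was revealed before. -/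
def matchingRule (adj : Fin n → W → Prop) (R : Equiv.Perm (Fin n)) (O H : Finset (Fin n))
    (i : Fin n) : Prop :=
  ∃ r, greedyLabel adj R O i = some r ∧ ∀ j ∈ H, greedyLabel adj R O j ≠ some r

theorem matchingRule_isLocal (adj : Fin n → W → Prop) : IsLocal (matchingRule adj) := by
  intro R R' O H i h
  have key : ∀ j, (j ∈ H ∨ j = i) → greedyLabel adj R O j = greedyLabel adj R' O j := by
    intro j hj
    have hj' : j ∈ O ∨ j ∈ H ∨ j = i := Or.inr hj
    refine greedyLabel_congr adj R R' O O j (fun a b ha hb => h a b ?_ ?_) fun k => ?_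
    · rcases ha with rfl | ha
      exacts [hj', Or.inl ha.1]
    · rcases hb with rfl | hb
      exacts [hj', Or.inl hb.1]
    · exact and_congr_right fun hk => h k j (Or.inl hk) hj'
  refine exists_congr fun r => ?_
  rw [key i (Or.inr rfl)]
  refine and_congr_right fun _ => forall₂_congr fun j hj => ?_
  rw [key j (Or.inl hj)]

theorem matchingRule_anti (adj : Fin n → W → Prop) (R : Equiv.Perm (Fin n))
    (O H H' : Finset (Fin n)) (i : Fin n) (hH : H' ⊆ H) (h : matchingRule adj R O H i) :
    matchingRule adj R O H' i := by
  obtain ⟨r, h1, h2⟩ := h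
  exact ⟨r, h1, fun j hj => h2 j (hH hj)⟩

open Classical in
-- Labels themselves are the matching: of two elements with the same label, the later one is
-- rejected.
theorem matchingRule_feasible (adj : Fin n → W → Prop) (R : Equiv.Perm (Fin n))
    (O N : Finset (Fin n)) (κ : Fin n → ℕ) (hκ : Set.InjOn κ N) :
    TransversalIndep adj
      (N.filter fun i => matchingRule adj R O (N.filter fun j => κ j < κ i) i) := by
  have h : ∀ i : {i // i ∈ N.filter fun i => matchingRule adj R O (N.filter fun j => κ j < κ i) i},
      ∃ r, greedyLabel adj R O i.1 = some r ∧
        ∀ j ∈ N.filter fun j => κ j < κ i, greedyLabel adj R O j ≠ some r :=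
    fun i => (Finset.mem_filter.1 i.2).2
  choose f hf hf' using h
  refine ⟨f, fun a b hab => ?_, fun i => adj_of_greedyLabel (hf i)⟩
  have ha := (Finset.mem_filter.1 a.2).1
  have hb := (Finset.mem_filter.1 b.2).1
  rcases lt_trichotomy (κ a.1) (κ b.1) with h | h | h
  · exact absurd (hab ▸ hf a) (hf' b a.1 (Finset.mem_filter.2 ⟨ha, h⟩))
  · exact Subtype.ext (hκ ha hb h)
  · exact absurd (hab ▸ hf b) (hf' a b.1 (Finset.mem_filter.2 ⟨hb, h⟩))

/-- `i` is the element of highest rank with label `r`. -/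
def FirstLabelled (adj : Fin n → W → Prop) (R : Equiv.Perm (Fin n)) (r : W) (i : Fin n)
    (O : Finset (Fin n)) : Prop :=
  greedyLabel adj R O i = some r ∧ ∀ j, R j < R i → greedyLabel adj R O j ≠ some r

/-- The event involves only labels of elements ranked no lower than `i`, and these ignore the coin
of any `j` at or below `i`. -/
theorem FirstLabelled.awayFrom {i j : Fin n} (h : R i ≤ R j) :
    AwayFrom j (FirstLabelled adj R r i) := by
  intro O O' hO
  unfold FirstLabelled
  rw [greedyLabel_eq_of_agree h hO]
  refine propext (and_congr_right fun _ => forall₂_congr fun k hk => ?_)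
  rw [greedyLabel_eq_of_agree (hk.le.trans h) hO]

theorem exists_highest {P : Fin n → Prop} (R : Equiv.Perm (Fin n)) (h : ∃ i, P i) :
    ∃ i, P i ∧ ∀ j, R j < R i → ¬P j := by
  classical
  obtain ⟨i, hi⟩ := h
  obtain ⟨k, hk, hmin⟩ := Finset.exists_min_image (Finset.univ.filter P) R
    ⟨i, Finset.mem_filter.2 ⟨Finset.mem_univ _, hi⟩⟩
  refine ⟨k, (Finset.mem_filter.1 hk).2, fun j hj hPj => ?_⟩
  exact absurd (hmin j (Finset.mem_filter.2 ⟨Finset.mem_univ _, hPj⟩)) (not_le.2 hj)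

/-- The probability that the first element with label `r` is `i`, is not observed, and is the only
element with label `r` that is not observed. -/
theorem le_Ex_only_labelled {p : ℝ} (hp0 : 0 ≤ p) (hp1 : p ≤ 1) (adj : Fin n → W → Prop)
    (R : Equiv.Perm (Fin n)) (r : W) (i : Fin n) :
    p * (1 - p) * Ex p (fun O => ind (FirstLabelled adj R r i O)) ≤
      Ex p fun O => ind (i ∉ O ∧ FirstLabelled adj R r i O ∧
        ∀ j, j ∉ O → j ≠ i → greedyLabel adj R O j ≠ some r) := by
  set F : Finset (Fin n) → Prop := fun O => i ∉ O ∧ FirstLabelled adj R r i O with hF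
  -- `S j`: within `F`, the second element with label `r` is `j`.
  set S : Fin n → Finset (Fin n) → Prop := fun j O => F O ∧ j ≠ i ∧
    greedyLabel adj R O j = some r ∧
      ∀ k, R k < R j → k ≠ i → greedyLabel adj R O k ≠ some r with hS
  have hEF : Ex p (fun O => ind (F O)) =
      (1 - p) * Ex p fun O => ind (FirstLabelled adj R r i O) :=
    Ex_ind_notMem_and p (FirstLabelled.awayFrom le_rfl)
  have hSlt : ∀ j O, S j O → R i < R j := by
    rintro j O ⟨⟨_, hf⟩, hji, hj, _⟩
    rcases lt_trichotomy (R i) (R j) with h | h | h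
    · exact h
    · exact absurd (R.injective h).symm hji
    · exact absurd hj (hf.2 j h)
  -- Below `i`, being second is decided by elements above `j` in the ranking, hence independent of
  -- the coin of `j`; otherwise `S j` is impossible.
  have hES : ∀ j, Ex p (fun O => ind (j ∉ O ∧ S j O)) = (1 - p) * Ex p fun O => ind (S j O) := by
    intro j
    refine Ex_ind_notMem_and p fun O O' hO => ?_
    by_cases hij : R i < R j
    · have hne : i ≠ j := fun h => by simp [h] at hij
      simp only [hS, hF]
      rw [hO i hne, FirstLabelled.awayFrom hij.le O O' hO, greedyLabel_eq_of_agree le_rfl hO]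
      refine propext (and_congr_right fun _ => and_congr_right fun _ => and_congr_right fun _ =>
        forall₂_congr fun k hk => ?_)
      rw [greedyLabel_eq_of_agree hk.le hO]
    · exact propext ⟨fun h => absurd (hSlt _ _ h) hij, fun h => absurd (hSlt _ _ h) hij⟩
  have hsum : ∑ j, Ex p (fun O => ind (S j O)) ≤ Ex p fun O => ind (F O) := by
    rw [← Ex_sum]
    refine Ex_mono hp0 hp1 fun O => ?_
    by_cases hFO : F O
    · rw [ind_of_true hFO]
      refine sum_ind_le_one _ fun j k hj hk => ?_
      rcases lt_trichotomy (R j) (R k) with h | h | h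
      · exact absurd hj.2.2.1 (hk.2.2.2 j h hj.2.1)
      · exact R.injective h
      · exact absurd hk.2.2.1 (hj.2.2.2 k h hk.2.1)
    · rw [ind_of_false hFO, Finset.sum_eq_zero fun j _ => ind_of_false fun h => hFO h.1]
  -- Within `F`, failure requires an unobserved second element: an observed one would block the
  -- label for everything below it.
  have hpt : Ex p (fun O => ind (F O) - ∑ j, ind (j ∉ O ∧ S j O)) ≤
      Ex p fun O => ind (i ∉ O ∧ FirstLabelled adj R r i O ∧
        ∀ j, j ∉ O → j ≠ i → greedyLabel adj R O j ≠ some r) := by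
    refine Ex_mono hp0 hp1 fun O => ?_
    have hnn : 0 ≤ ∑ j, ind (j ∉ O ∧ S j O) := Finset.sum_nonneg fun j _ => ind_nonneg _
    by_cases hFO : F O
    · by_cases hg : ∀ j, j ∉ O → j ≠ i → greedyLabel adj R O j ≠ some r
      · rw [ind_of_true hFO, ind_of_true ⟨hFO.1, hFO.2, hg⟩]
        linarith
      · push Not at hg
        obtain ⟨j₀, hj₀O, hj₀i, hj₀⟩ := hg
        obtain ⟨j, ⟨hj, hjr⟩, hmin⟩ := exists_highest
          (P := fun j => j ≠ i ∧ greedyLabel adj R O j = some r) R ⟨j₀, hj₀i, hj₀⟩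
        have hSj : S j O := ⟨hFO, hj, hjr, fun k hk hki hkr => hmin k hk ⟨hki, hkr⟩⟩
        have hjO : j ∉ O := by
          intro hjO
          rcases lt_trichotomy (R j) (R j₀) with h | h | h
          · exact greedyLabel_ne hj₀ h hjO hjr
          · exact hj₀O (R.injective h ▸ hjO)
          · exact hmin j₀ h ⟨hj₀i, hj₀⟩
        have h1 : (1 : ℝ) ≤ ∑ j, ind (j ∉ O ∧ S j O) := by
          rw [← ind_of_true (P := j ∉ O ∧ S j O) ⟨hjO, hSj⟩]
          exact Finset.single_le_sum (f := fun j => ind (j ∉ O ∧ S j O))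
            (fun j _ => ind_nonneg _) (Finset.mem_univ j)
        have h2 := ind_le_one (F O)
        have h3 := ind_nonneg (i ∉ O ∧ FirstLabelled adj R r i O ∧
          ∀ j, j ∉ O → j ≠ i → greedyLabel adj R O j ≠ some r)
        linarith
    · rw [ind_of_false hFO]
      have h3 := ind_nonneg (i ∉ O ∧ FirstLabelled adj R r i O ∧
          ∀ j, j ∉ O → j ≠ i → greedyLabel adj R O j ≠ some r)
      linarith
  refine le_trans ?_ hpt
  rw [Ex_sub, Ex_sum]
  simp only [hES]
  rw [← Finset.mul_sum]
  have := mul_le_mul_of_nonneg_left hsum (by linarith : (0 : ℝ) ≤ 1 - p)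
  rw [hEF] at this ⊢
  nlinarith

/-- The value of the element of highest rank with label `r`. -/
def firstValue (adj : Fin n → W → Prop) (R : Equiv.Perm (Fin n)) (v : Fin n → ℝ≥0) (r : W)
    (O : Finset (Fin n)) : ℝ :=
  ∑ i, (v i : ℝ) * ind (FirstLabelled adj R r i O)

theorem firstValue_nonneg (v : Fin n → ℝ≥0) (r : W) (O : Finset (Fin n)) :
    0 ≤ firstValue adj R v r O :=
  Finset.sum_nonneg fun i _ => mul_nonneg (v i).2 (ind_nonneg _)

theorem le_firstValue {v : Fin n → ℝ≥0} (hv : ∀ a b, R a < R b → v b ≤ v a)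
    (h : greedyLabel adj R O i = some r) : (v i : ℝ) ≤ firstValue adj R v r O := by
  obtain ⟨k, hk, hmin⟩ := exists_highest (P := fun k => greedyLabel adj R O k = some r) R ⟨i, h⟩
  have hik : v i ≤ v k := by
    rcases lt_trichotomy (R k) (R i) with h' | h' | h'
    · exact hv _ _ h'
    · rw [R.injective h']
    · exact absurd h (hmin i h')
  have h1 : (v k : ℝ) * ind (FirstLabelled adj R r k O) ≤ firstValue adj R v r O :=
    Finset.single_le_sum (f := fun i => (v i : ℝ) * ind (FirstLabelled adj R r i O))
      (fun i _ => mul_nonneg (v i).2 (ind_nonneg _)) (Finset.mem_univ k)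
  rw [ind_of_true ⟨hk, hmin⟩, mul_one] at h1
  exact le_trans (by exact_mod_cast hik) h1

variable [Fintype W]

/-- For each label at most one element is first, and an element has only one label, so the
contributions of different `r` can be added. -/
theorem le_Ex_matchingRule {p : ℝ} (hp0 : 0 ≤ p) (hp1 : p ≤ 1) (adj : Fin n → W → Prop)
    (R : Equiv.Perm (Fin n)) (v : Fin n → ℝ≥0) :
    p * (1 - p) * Ex p (fun O => ∑ r, firstValue adj R v r O) ≤
      Ex p fun O => ∑ i ∈ surelyAccepted (matchingRule adj) R O, (v i : ℝ) := by
  set G : W → Fin n → Finset (Fin n) → Prop := fun r i O => i ∉ O ∧ FirstLabelled adj R r i O ∧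
        ∀ j, j ∉ O → j ≠ i → greedyLabel adj R O j ≠ some r with hG
  have h1 : Ex p (fun O => ∑ i, ∑ r, (v i : ℝ) * ind (G r i O)) ≤
      Ex p fun O => ∑ i ∈ surelyAccepted (matchingRule adj) R O, (v i : ℝ) := by
    classical
    refine Ex_mono hp0 hp1 fun O => ?_
    rw [← Finset.sum_filter_add_sum_filter_not Finset.univ
      (fun i => i ∈ surelyAccepted (matchingRule adj) R O), Finset.filter_mem_eq_inter,
      Finset.univ_inter, Finset.sum_eq_zero (s := Finset.univ.filter _), add_zero]
    · refine Finset.sum_le_sum fun i _ => ?_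
      rw [← Finset.mul_sum]
      refine mul_le_of_le_one_right (v i).2 (sum_ind_le_one _ fun r r' hr hr' => ?_)
      exact Option.some.inj (hr.2.1.1.symm.trans hr'.2.1.1)
    · intro i hi
      refine Finset.sum_eq_zero fun r _ => ?_
      rw [ind_of_false, mul_zero]
      intro h
      refine (Finset.mem_filter.1 hi).2 (mem_surelyAccepted.2 ⟨h.1, r, h.2.1.1, fun j hj => ?_⟩)
      rw [Finset.mem_erase, Finset.mem_compl] at hj
      exact h.2.2 j hj.2 hj.1
  refine le_trans ?_ h1
  simp only [firstValue]
  rw [Ex_sum, Ex_sum, Finset.mul_sum]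
  simp only [Ex_sum, Finset.mul_sum, Ex_const_mul]
  rw [Finset.sum_comm]
  refine Finset.sum_le_sum fun i _ => Finset.sum_le_sum fun r _ => ?_
  have := mul_le_mul_of_nonneg_left (le_Ex_only_labelled hp0 hp1 adj R r i) (v i).2
  calc _ = (v i : ℝ) * (p * (1 - p) * Ex p fun O => ind (FirstLabelled adj R r i O)) := by ring
    _ ≤ _ := this

/-- The first labelled elements are worth at least half of the observed part of any matching. -/
theorem sum_observed_le_firstValue {v : Fin n → ℝ≥0} (hv : ∀ a b, R a < R b → v b ≤ v a)
    {A : Finset (Fin n)} (hA : TransversalIndep adj A) (O : Finset (Fin n)) :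
    ∑ i ∈ A, (v i : ℝ) * ind (i ∈ O) ≤ 2 * ∑ r, firstValue adj R v r O := by
  obtain ⟨f, hf, hadj⟩ := hA
  have h1 : ∀ i : A, (v i : ℝ) * ind (i.1 ∈ O) ≤
      ∑ r, firstValue adj R v r O * ind (i.1 ∈ O ∧ greedyLabel adj R O i = some r) +
        firstValue adj R v (f i) O := by
    intro i
    have hnn : 0 ≤ ∑ r, firstValue adj R v r O *
        ind (i.1 ∈ O ∧ greedyLabel adj R O i = some r) :=
      Finset.sum_nonneg fun r _ => mul_nonneg (firstValue_nonneg _ _ _) (ind_nonneg _)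
    have hnn2 := firstValue_nonneg (adj := adj) (R := R) v (f i) O
    by_cases hi : i.1 ∈ O
    · rw [ind_of_true hi, mul_one]
      rcases hl : greedyLabel adj R O i with _ | r
      -- Without a label, `i` is charged to its partner `f i`, which is already the label of an
      -- observed element of at least its value.
      · obtain ⟨j, hjO, hj, hjl⟩ := exists_of_greedyLabel_eq_none hl (hadj i)
        have h2 := le_firstValue hv hjl
        have h3 : (v i : ℝ) ≤ v j := by exact_mod_cast hv _ _ hj
        rw [hl] at hnn
        linarith
      · have h2 := le_firstValue hv hl
        have h3 := Finset.single_le_sum (f := fun r => firstValue adj R v r O *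
          ind (i.1 ∈ O ∧ greedyLabel adj R O i = some r))
          (fun r _ => mul_nonneg (firstValue_nonneg _ _ _) (ind_nonneg _)) (Finset.mem_univ r)
        rw [ind_of_true ⟨hi, hl⟩, mul_one, hl] at h3
        linarith
    · rw [ind_of_false hi, mul_zero]
      linarith
  rw [← Finset.sum_coe_sort]
  refine (Finset.sum_le_sum fun i _ => h1 i).trans ?_
  rw [Finset.sum_add_distrib, Finset.sum_comm, two_mul]
  -- Each kind of charge hits a right vertex at most once: observed elements have distinct labels,
  -- and `f` is injective.
  refine add_le_add (Finset.sum_le_sum fun r _ => ?_) ?_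
  · rw [← Finset.mul_sum]
    refine mul_le_of_le_one_right (firstValue_nonneg _ _ _) (sum_ind_le_one _ ?_)
    rintro i j ⟨hi, hir⟩ ⟨hj, hjr⟩
    rcases lt_trichotomy (R i) (R j) with h | h | h
    · exact absurd hir (greedyLabel_ne hjr h hi)
    · exact Subtype.ext (R.injective h)
    · exact absurd hjr (greedyLabel_ne hir h hj)
  · classical
    rw [← Finset.sum_image (g := f) (f := fun r => firstValue adj R v r O) (fun a _ b _ h => hf h)]
    exact Finset.sum_le_univ_sum_of_nonneg fun r => firstValue_nonneg _ _ _

end matching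

/-- Order-oblivious secretary algorithms for transversal matroids. -/
theorem exists_orderOblivious_transversal {W : Type*} [Finite W] (adj : Fin n → W → Prop) :
    ∃ S : ObserveFirstAlgorithm n, S.IsOrderOblivious (TransversalIndep adj) (1 / 16) := by
  have := Fintype.ofFinite W
  have h0 : (0 : ℝ) ≤ 1 / 2 := by norm_num
  have h1 : (1 / 2 : ℝ) ≤ 1 := by norm_num
  refine ⟨ordinalAlgorithm Unit (1 / 2) h0 h1 (fun _ => 1) (fun _ => matchingRule adj),
    ordinalAlgorithm_isFeasible (fun _ => matchingRule_isLocal adj)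
      (fun _ R O N _ κ hκ => matchingRule_feasible adj R O N κ hκ), fun τ v => ?_⟩
  refine ofReal_mul_opt_le (by norm_num) fun A hA => le_trans (ENNReal.ofReal_le_ofReal ?_)
    (ordinalAlgorithm_expectedWeight (fun _ => matchingRule_isLocal adj)
      (fun _ => matchingRule_anti adj) τ v)
  simp only [Finset.univ_unique, Finset.sum_singleton, Fintype.card_unit, Nat.cast_one, div_one]
  refine le_trans ?_ (le_Ex_matchingRule h0 h1 adj _ v)
  have h2 := Ex_mono h0 h1 fun O => sum_observed_le_firstValue (R := ranking v 1)
    (fun a b h => value_le_of_ranking_lt h) hA O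
  rw [Ex_sum, Ex_const_mul] at h2
  simp only [Ex_const_mul, Ex_ind_mem, ← Finset.sum_mul] at h2
  -- Half of `A` is observed on average and charging costs 2, so the first values total at least a
  -- quarter of `A`; the factor `p * (1 - p) = 1/4` gives 1/16.
  linarith

/-! ### Graphic matroids -/

section graphic

variable {V : Type*} {G : Graph V (Fin n)}

theorem GraphicIndep.mono {A B : Finset (Fin n)} (hB : GraphicIndep G B) (h : A ⊆ B) :
    GraphicIndep G A := by
  rintro ⟨k, x, e, hx, he, hA, hl⟩
  exact hB ⟨k, x, e, hx, he, fun j => h (hA j), hl⟩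

/-- An edge that joins the last vertex of a path to a vertex of the path closes a cycle, unless it is
the last edge of the path. -/
theorem GraphicIndep.not_isLink_of_path {A : Finset (Fin n)} (hA : GraphicIndep G A) {k : ℕ}
    {x : ℕ → V} {e : ℕ → Fin n} (hx : ∀ i j, i ≤ k → j ≤ k → x i = x j → i = j)
    (he : ∀ i < k, e i ∈ A ∧ G.IsLink (e i) (x i) (x (i + 1))) {m : ℕ} (hm : m ≤ k) {e' : Fin n}
    (he' : e' ∈ A) (hne : ∀ i, i + 1 = k → e' ≠ e i) : ¬G.IsLink e' (x k) (x m) := by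
  intro hl
  have hlast : ∀ j : Fin (k - m + 1), ¬ j.val < k - m → j = Fin.last _ := fun j hj =>
    Fin.ext (by have := j.2; simp only [Fin.val_last]; omega)
  have hdiff : ∀ i, m ≤ i → i < k → e' ≠ e i := by
    rintro i hi hik rfl
    rcases hl.eq_and_eq_or_eq_and_eq (he i hik).2 with ⟨h, -⟩ | ⟨h, h'⟩
    · have := hx _ _ le_rfl hik.le h
      omega
    · have h1 := hx _ _ le_rfl hik h
      exact hne i h1.symm rfl
  refine hA ⟨k - m, fun j => x (m + j), fun j => if j.val < k - m then e (m + j) else e',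
    fun a b hab => ?_, fun a b hab => ?_, fun j => ?_, fun j => ?_⟩
  · have := hx _ _ (by omega) (by omega) hab
    exact Fin.ext (by omega)
  · dsimp only at hab
    split_ifs at hab with h1 h2 h2
    · rcases (he (m + a) (by omega)).2.eq_and_eq_or_eq_and_eq (hab ▸ (he (m + b) (by omega)).2)
        with ⟨h, -⟩ | ⟨h, h'⟩
      · have := hx _ _ (by omega) (by omega) h
        exact Fin.ext (by omega)
      · have h3 := hx _ _ (by omega) (by omega) h
        have h4 := hx _ _ (by omega) (by omega) h'
        omega
    · exact absurd hab.symm (hdiff _ (by omega) (by omega))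
    · exact absurd hab (hdiff _ (by omega) (by omega))
    · rw [hlast a h1, hlast b h2]
  · dsimp only
    split_ifs with h
    exacts [(he _ (by omega)).1, he']
  · dsimp only
    split_ifs with h
    · have h1 : ((j + 1 : Fin (k - m + 1)) : ℕ) = j + 1 :=
        Fin.val_add_one_of_lt (Fin.lt_def.2 (by simpa using h))
      rw [h1, ← add_assoc]
      exact (he _ (by omega)).2
    · rw [hlast j h, Fin.last_add_one]
      simpa [Nat.add_sub_cancel' hm] using hl

theorem GraphicIndep.ne_of_isLink {A : Finset (Fin n)} (hA : GraphicIndep G A) {e : Fin n}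
    (he : e ∈ A) {x y : V} (h : G.IsLink e x y) : x ≠ y := by
  rintro rfl
  exact hA.not_isLink_of_path (k := 0) (x := fun _ => x) (e := fun _ => e) (m := 0)
    (fun i j hi hj _ => by omega) (fun i hi => by omega) le_rfl he (fun i hi => by omega) h

/-- A nonempty forest has a leaf. -/
theorem GraphicIndep.exists_leaf [Finite V] {A : Finset (Fin n)} (hA : GraphicIndep G A)
    (hE : ∀ e, ∃ x y, G.IsLink e x y) (hne : A.Nonempty) :
    ∃ e ∈ A, ∃ x y, G.IsLink e x y ∧ ∀ e' ∈ A, ∀ z, G.IsLink e' x z → e' = e := by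
  by_contra hcon
  push Not at hcon
  -- Without a leaf a path can be prolonged forever; `e'` and `y` are the next edge and vertex.
  -- Values of `x` and `e` beyond the path are irrelevant.
  have hpath : ∀ k : ℕ, ∃ (x : ℕ → V) (e : ℕ → Fin n) (e' : Fin n) (y : V),
      (∀ i j, i ≤ k → j ≤ k → x i = x j → i = j) ∧
      (∀ i < k, e i ∈ A ∧ G.IsLink (e i) (x i) (x (i + 1))) ∧
      e' ∈ A ∧ G.IsLink e' (x k) y ∧ ∀ i, i + 1 = k → e' ≠ e i := by
    intro k
    induction k with
    | zero =>
      obtain ⟨e₀, he₀⟩ := hne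
      obtain ⟨x, y, h⟩ := hE e₀
      exact ⟨fun _ => x, fun _ => e₀, e₀, y, fun i j hi hj _ => by omega, fun i hi => by omega,
        he₀, h, fun i hi => by omega⟩
    | succ k ih =>
      obtain ⟨x, e, e', y, hx, he, he'A, hl, hne'⟩ := ih
      have hy : ∀ m ≤ k, x m ≠ y := fun m hm h =>
        hA.not_isLink_of_path hx he hm he'A hne' (h ▸ hl)
      obtain ⟨e'', he'', z, hz, hne''⟩ := hcon e' he'A y (x k) hl.symm
      refine ⟨fun i => if i ≤ k then x i else y, fun i => if i < k then e i else e', e'', z,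
        fun i j hi hj h => ?_, fun i hi => ?_, he'', ?_, fun i hi => ?_⟩
      · dsimp only at h
        split_ifs at h with h1 h2 h2
        · exact hx _ _ h1 h2 h
        · exact absurd h (hy _ h1)
        · exact absurd h.symm (hy _ h2)
        · omega
      · dsimp only
        rcases Nat.lt_succ_iff_lt_or_eq.1 hi with h | rfl
        · rw [if_pos h, if_pos h.le, if_pos (show i + 1 ≤ k from h)]
          exact he i h
        · rw [if_neg (lt_irrefl _), if_pos le_rfl, if_neg (by omega)]
          exact ⟨he'A, hl⟩
      · simpa using hz
      · dsimp only
        rwa [if_neg (by omega)]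
  have := Fintype.ofFinite V
  obtain ⟨x, -, -, -, hx, -⟩ := hpath (Fintype.card V)
  have h := Fintype.card_le_of_injective (fun i : Fin (Fintype.card V + 1) => x i)
    fun i j hij => Fin.ext (hx _ _ (by omega) (by omega) hij)
  rw [Fintype.card_fin] at h
  omega

/-- The edges of a forest can be assigned injectively to endpoints. -/
theorem GraphicIndep.exists_injOn [Finite V] {A : Finset (Fin n)} (hA : GraphicIndep G A)
    (hE : ∀ e, ∃ x y, G.IsLink e x y) :
    ∃ f : Fin n → V, Set.InjOn f A ∧ ∀ e ∈ A, ∃ y, G.IsLink e (f e) y := by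
  classical
  induction hm : A.card generalizing A with
  | zero =>
    rw [Finset.card_eq_zero] at hm
    subst hm
    choose f hf using hE
    exact ⟨f, by simp, by simp⟩
  | succ m ih =>
    -- The leaf edge receives its leaf `x`, which no other edge of `A` touches.
    obtain ⟨e, heA, x, y, hl, hleaf⟩ := hA.exists_leaf hE (Finset.card_pos.1 (by omega))
    obtain ⟨f, hf, hf'⟩ := ih (hA.mono (Finset.erase_subset e A))
      (by rw [Finset.card_erase_of_mem heA]; omega)
    have hfx : ∀ a ∈ A, a ≠ e → f a ≠ x := by
      rintro a ha hae h
      obtain ⟨z, hz⟩ := hf' a (Finset.mem_erase.2 ⟨hae, ha⟩)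
      exact hae (hleaf a ha z (h ▸ hz))
    refine ⟨Function.update f e x, fun a ha b hb hab => ?_, fun a ha => ?_⟩
    · by_cases hae : a = e <;> by_cases hbe : b = e
      · rw [hae, hbe]
      · subst hae
        rw [Function.update_self, Function.update_of_ne hbe] at hab
        exact absurd hab.symm (hfx b hb hbe)
      · subst hbe
        rw [Function.update_self, Function.update_of_ne hae] at hab
        exact absurd hab (hfx a ha hae)
      · rw [Function.update_of_ne hbe, Function.update_of_ne hae] at hab
        exact hf (Finset.mem_coe.2 (Finset.mem_erase.2 ⟨hae, ha⟩))
          (Finset.mem_coe.2 (Finset.mem_erase.2 ⟨hbe, hb⟩)) hab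
    · by_cases hae : a = e
      · subst hae
        exact ⟨y, by rwa [Function.update_self]⟩
      · rw [Function.update_of_ne hae]
        exact hf' a (Finset.mem_erase.2 ⟨hae, ha⟩)

/-- `x` is the endpoint of `e` with the larger potential. -/
def IsHead (G : Graph V (Fin n)) (φ : V → ℤ) (e : Fin n) (x : V) : Prop :=
  ∃ y, G.IsLink e x y ∧ φ y < φ x

theorem IsHead.unique {φ : V → ℤ} {e : Fin n} {x y : V} (hx : IsHead G φ e x)
    (hy : IsHead G φ e y) : x = y := by
  obtain ⟨x', hx, hx'⟩ := hx
  obtain ⟨y', hy, hy'⟩ := hy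
  rcases hx.eq_and_eq_or_eq_and_eq hy with ⟨h, -⟩ | ⟨rfl, rfl⟩
  · exact h
  · omega

/-- A set of edges with distinct heads contains no cycle. -/
theorem graphicIndep_of_heads {φ : V → ℤ} {A : Finset (Fin n)}
    (hA : TransversalIndep (IsHead G φ) A) : GraphicIndep G A := by
  obtain ⟨f, hf, hf'⟩ := hA
  rintro ⟨k, x, e, hx, he, heA, hl⟩
  -- A cycle vertex of maximal potential is the head of both incident cycle edges; injectivity then
  -- makes the cycle a loop, which has no head.
  obtain ⟨j, -, hj⟩ := Finset.exists_max_image Finset.univ (fun j => φ (x j)) Finset.univ_nonempty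
  have key : ∀ i z, G.IsLink (e i) (x j) (x z) → f ⟨e i, heA i⟩ = x j := by
    intro i z h
    obtain ⟨y, hy, hy'⟩ := hf' ⟨e i, heA i⟩
    rcases h.eq_and_eq_or_eq_and_eq hy with ⟨h, -⟩ | ⟨h, h'⟩
    · exact h.symm
    · have := hj z (Finset.mem_univ _)
      rw [h, h'] at this
      exact absurd hy' (not_lt.2 this)
  have h1 := key j (j + 1) (hl j)
  have h2 := key (j - 1) (j - 1) (by simpa using (hl (j - 1)).symm)
  have h3 := he (congrArg Subtype.val (hf (h1.trans h2.symm)))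
  have h4 : j + 1 = j := by
    conv_rhs => rw [← sub_add_cancel j 1, ← h3]
  obtain ⟨y, hy, hy'⟩ := hf' ⟨e j, heA j⟩
  have h5 := hl j
  rw [h4] at h5
  rcases h5.eq_and_eq_or_eq_and_eq hy with ⟨h, h'⟩ | ⟨h, h'⟩ <;>
  · rw [← h, ← h'] at hy'
    exact absurd hy' (lt_irrefl _)

/-- An edge has only one possible label, its head. If it misses that label, a higher edge already
has it, so no charging loss occurs here. -/
theorem value_le_firstValue_of_isHead {φ : V → ℤ} {R : Equiv.Perm (Fin n)} {v : Fin n → ℝ≥0}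
    (hv : ∀ a b, R a < R b → v b ≤ v a) (O : Finset (Fin n)) {e : Fin n} {x : V}
    (h : IsHead G φ e x) : (v e : ℝ) ≤ firstValue (IsHead G φ) R v x O := by
  rcases hl : greedyLabel (IsHead G φ) R O e with _ | y
  · obtain ⟨j, -, hj, hjl⟩ := exists_of_greedyLabel_eq_none hl h
    refine le_trans ?_ (le_firstValue hv hjl)
    exact_mod_cast hv _ _ hj
  · rw [h.unique (adj_of_greedyLabel hl)]
    exact le_firstValue hv hl

/-- Assign the forest edges injectively to endpoints. Each assigned endpoint is the head of its edge
for `φ` or for `-φ`, so it pays in one of the two orientations. -/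
theorem sum_le_firstValue_add_firstValue [Fintype V] {φ : V → ℤ} (hφ : Function.Injective φ)
    {R : Equiv.Perm (Fin n)} {v : Fin n → ℝ≥0} (hv : ∀ a b, R a < R b → v b ≤ v a)
    {A : Finset (Fin n)} (hA : GraphicIndep G A) (hE : ∀ e, ∃ x y, G.IsLink e x y)
    (O O' : Finset (Fin n)) :
    ∑ e ∈ A, (v e : ℝ) ≤ ∑ x, firstValue (IsHead G φ) R v x O +
      ∑ x, firstValue (IsHead G (-φ)) R v x O' := by
  classical
  obtain ⟨f, hf, hf'⟩ := hA.exists_injOn hE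
  rw [← Finset.sum_add_distrib]
  have h1 : ∀ e ∈ A, (v e : ℝ) ≤ firstValue (IsHead G φ) R v (f e) O +
      firstValue (IsHead G (-φ)) R v (f e) O' := by
    intro e he
    obtain ⟨y, hy⟩ := hf' e he
    have hn1 := firstValue_nonneg (adj := IsHead G φ) (R := R) v (f e) O
    have hn2 := firstValue_nonneg (adj := IsHead G (-φ)) (R := R) v (f e) O'
    rcases lt_trichotomy (φ (f e)) (φ y) with h | h | h
    · have := value_le_firstValue_of_isHead hv O' (φ := -φ) ⟨y, hy, by simpa using h⟩
      linarith
    · exact absurd (hφ h) (hA.ne_of_isLink he hy)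
    · have := value_le_firstValue_of_isHead hv O (φ := φ) ⟨y, hy, h⟩
      linarith
  refine (Finset.sum_le_sum h1).trans ?_
  rw [← Finset.sum_image (g := f) (f := fun x => firstValue (IsHead G φ) R v x O +
    firstValue (IsHead G (-φ)) R v x O') hf]
  exact Finset.sum_le_univ_sum_of_nonneg fun x =>
    add_nonneg (firstValue_nonneg _ _ _) (firstValue_nonneg _ _ _)

/-- Order-oblivious secretary algorithms for graphic matroids. -/
theorem exists_orderOblivious_graphic [Finite V] (G : Graph V (Fin n)) (hE : G.edgeSet = Set.univ) :
    ∃ S : ObserveFirstAlgorithm n, S.IsOrderOblivious (GraphicIndep G) (1 / 8) := by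
  have := Fintype.ofFinite V
  have hE' : ∀ e, ∃ x y, G.IsLink e x y := fun e =>
    (G.edge_mem_iff_exists_isLink e).1 (hE ▸ Set.mem_univ e)
  have h0 : (0 : ℝ) ≤ 1 / 2 := by norm_num
  have h1 : (1 / 2 : ℝ) ≤ 1 := by norm_num
  -- Any injective potential will do: distinct endpoints then always have a head. The Boolean coin
  -- chooses between `φ` and `-φ`, turning the factor 1/4 into 1/8.
  obtain ⟨g, hg⟩ := exists_injective_nat V
  set φ : V → ℤ := fun x => g x with hφ
  have hφi : Function.Injective φ := fun x y h => hg (Int.natCast_inj.1 h)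
  set ψ : Bool → V → ℤ := fun b => if b then φ else -φ
  refine ⟨ordinalAlgorithm Bool (1 / 2) h0 h1 (fun _ => 1) (fun b => matchingRule (IsHead G (ψ b))),
    ordinalAlgorithm_isFeasible (fun b => matchingRule_isLocal _)
      (fun b R O N _ κ hκ => graphicIndep_of_heads (matchingRule_feasible _ R O N κ hκ)),
    fun τ v => ?_⟩
  refine ofReal_mul_opt_le (by norm_num) fun A hA => le_trans (ENNReal.ofReal_le_ofReal ?_)
    (ordinalAlgorithm_expectedWeight (fun b => matchingRule_isLocal _)
      (fun b => matchingRule_anti _) τ v)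
  rw [Fintype.sum_bool, Fintype.card_bool]
  have ht := le_Ex_matchingRule h0 h1 (IsHead G (ψ true)) (ranking v 1) v
  have hf := le_Ex_matchingRule h0 h1 (IsHead G (ψ false)) (ranking v 1) v
  have hs := Ex_mono h0 h1 fun O => sum_le_firstValue_add_firstValue hφi (R := ranking v 1) (v := v)
    (fun a b h => value_le_of_ranking_lt h) hA hE' O O
  rw [Ex_add] at hs
  have hc : Ex (1 / 2) (fun _ : Finset (Fin n) => ∑ e ∈ A, (v e : ℝ)) = ∑ e ∈ A, (v e : ℝ) := by
    have := Ex_const_mul (n := n) (1 / 2) (∑ e ∈ A, (v e : ℝ)) fun _ => 1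
    simpa only [mul_one, Ex_one] using this
  rw [hc] at hs
  simp only [ψ, if_true, Bool.false_eq_true, if_false] at ht hf ⊢
  push_cast
  linarith

end graphic

/-! ### Matroids and rankings -/

/-- In a dependent set, the last element of a circuit would be spanned by the earlier ones. -/
theorem indep_of_notMem_closure {α β : Type*} [LinearOrder β] {M : Matroid α} (hM : M.E = Set.univ)
    (κ : α → β) (A : Finset α) (hκ : Set.InjOn κ A)
    (h : ∀ a ∈ A, a ∉ M.closure {b | b ∈ A ∧ κ b < κ a}) : M.Indep (A : Set α) := by
  by_contra hA
  have hdep : M.Dep (A : Set α) := ⟨hA, by simp [hM]⟩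
  obtain ⟨C, hCA, hC⟩ := hdep.exists_isCircuit_subset
  obtain ⟨a, haC, hmax⟩ := Set.exists_max_image C κ (A.finite_toSet.subset hCA) hC.nonempty
  refine h a (hCA haC) (M.closure_subset_closure ?_ (hC.mem_closure_sdiff_singleton_of_mem haC))
  rintro b ⟨hb, hba⟩
  exact ⟨hCA hb, lt_of_le_of_ne (hmax b hb) fun h => hba (hκ (hCA hb) (hCA haC) h)⟩

/-- `i` is not spanned by the observed elements of higher rank. -/
def Unspanned (M : Matroid (Fin n)) (R : Equiv.Perm (Fin n)) (O : Finset (Fin n)) (i : Fin n) :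
    Prop :=
  i ∉ M.closure {j | j ∈ O ∧ R j < R i}

theorem Unspanned.congr (M : Matroid (Fin n)) {R R' : Equiv.Perm (Fin n)} {O O' : Finset (Fin n)}
    {i : Fin n} (h : ∀ j, (j ∈ O ∧ R j < R i) ↔ (j ∈ O' ∧ R' j < R' i)) :
    Unspanned M R O i ↔ Unspanned M R' O' i := by
  have h1 : {j | j ∈ O ∧ R j < R i} = {j | j ∈ O' ∧ R' j < R' i} := Set.ext h
  rw [Unspanned, Unspanned, h1]

theorem Unspanned.anti {M : Matroid (Fin n)} {R : Equiv.Perm (Fin n)} {O O' : Finset (Fin n)}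
    {i : Fin n} (hO : O' ⊆ O) (h : Unspanned M R O i) : Unspanned M R O' i := by
  refine fun hi => h (M.closure_subset_closure ?_ hi)
  rintro j ⟨hj, hji⟩
  exact ⟨hO hj, hji⟩

open Classical in
/-- The basis found by the greedy algorithm. -/
def greedyBasis (M : Matroid (Fin n)) (R : Equiv.Perm (Fin n)) : Finset (Fin n) :=
  Finset.univ.filter (Unspanned M R Finset.univ)

/-- Layer-cake decomposition: `δ t` is the drop from `x t` to the next value, with `0` after the
last one. -/
theorem exists_layers (x : Fin n → ℝ) (hx : Antitone x) (h0 : ∀ i, 0 ≤ x i) :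
    ∃ δ : Fin n → ℝ, (∀ t, 0 ≤ δ t) ∧ ∀ j, x j = ∑ t, δ t * ind (j ≤ t) := by
  set y : ℕ → ℝ := fun m => if h : m < n then x ⟨m, h⟩ else 0 with hy
  have hyle : ∀ m, y (m + 1) ≤ y m := by
    intro m
    simp only [hy]
    split_ifs with h1 h2 h2
    · exact hx (Fin.mk_le_mk.2 (Nat.le_succ m))
    · omega
    · exact h0 _
    · exact le_rfl
  refine ⟨fun t => y t - y (t + 1), fun t => sub_nonneg.2 (hyle t), fun j => ?_⟩
  have h1 : ∑ t : Fin n, (y t - y (t + 1)) * ind (j ≤ t) =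
      ∑ t ∈ Finset.range n, (y t - y (t + 1)) * ind (j.val ≤ t) :=
    Fin.sum_univ_eq_sum_range (fun t => (y t - y (t + 1)) * ind (j.val ≤ t)) n
  rw [h1, ← Finset.sum_range_add_sum_Ico _ j.2.le, Finset.sum_eq_zero, zero_add]
  · rw [Finset.sum_congr rfl (g := fun t => y t - y (t + 1))]
    · rw [Finset.sum_Ico_eq_sum_range]
      have h2 := Finset.sum_range_sub' (fun t => y (j + t)) (n - j)
      simp only [add_assoc, add_zero, Nat.add_sub_cancel' j.2.le] at h2 ⊢
      rw [h2]
      simp [hy]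
    · intro t ht
      rw [ind_of_true (Finset.mem_Ico.1 ht).1, mul_one]
  · intro t ht
    rw [ind_of_false (by have := Finset.mem_range.1 ht; omega), mul_zero]

theorem sum_ind {ι : Type*} (A : Finset ι) (P : ι → Prop) [DecidablePred P] :
    ∑ j ∈ A, ind (P j) = ((A.filter P).card : ℝ) := by
  rw [Finset.card_filter, Nat.cast_sum]
  refine Finset.sum_congr rfl fun j _ => ?_
  by_cases h : P j
  · rw [ind_of_true h, if_pos h, Nat.cast_one]
  · rw [ind_of_false h, if_neg h, Nat.cast_zero]

/-- Majorization: by the layer decomposition both sides are the same nonnegative combination of the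
prefix counts. -/
theorem sum_value_le_of_card_le {R : Equiv.Perm (Fin n)} {v : Fin n → ℝ≥0}
    (hv : ∀ a b, R a < R b → v b ≤ v a) {A B : Finset (Fin n)}
    (h : ∀ t, (A.filter fun j => R j ≤ t).card ≤ (B.filter fun j => R j ≤ t).card) :
    ∑ j ∈ A, (v j : ℝ) ≤ ∑ j ∈ B, (v j : ℝ) := by
  obtain ⟨δ, hδ, hx⟩ := exists_layers (fun s => (v (R.symm s) : ℝ)) (fun a b hab => by
    rcases hab.lt_or_eq with hab | rfl
    · have := hv (R.symm a) (R.symm b) (by simpa using hab)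
      exact_mod_cast this
    · exact le_rfl) (fun i => (v _).2)
  have key : ∀ C : Finset (Fin n), ∑ j ∈ C, (v j : ℝ) =
      ∑ t, δ t * ((C.filter fun j => R j ≤ t).card : ℝ) := by
    intro C
    have : ∀ j, (v j : ℝ) = ∑ t, δ t * ind (R j ≤ t) := fun j => by
      rw [← hx (R j), Equiv.symm_apply_apply]
    simp only [this]
    rw [Finset.sum_comm]
    exact Finset.sum_congr rfl fun t _ => by rw [← Finset.mul_sum, sum_ind]
  rw [key A, key B]
  exact Finset.sum_le_sum fun t _ => mul_le_mul_of_nonneg_left (by exact_mod_cast h t) (hδ t)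

/-- The greedy algorithm finds an independent set of maximum value. -/
theorem sum_le_sum_greedyBasis {M : Matroid (Fin n)} (hM : M.E = Set.univ)
    {R : Equiv.Perm (Fin n)} {v : Fin n → ℝ≥0} (hv : ∀ a b, R a < R b → v b ≤ v a)
    {A : Finset (Fin n)} (hA : M.Indep (A : Set (Fin n))) :
    ∑ j ∈ A, (v j : ℝ) ≤ ∑ j ∈ greedyBasis M R, (v j : ℝ) := by
  classical
  refine sum_value_le_of_card_le hv fun t => ?_
  set T := (greedyBasis M R).filter fun j => R j ≤ t with hT
  -- Every element down to rank `t` is spanned by the greedy elements there, so those are at least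
  -- as many as any independent set has.
  have hspan : ∀ m : ℕ, ∀ j, (R j).val = m → R j ≤ t → j ∈ M.closure (T : Set (Fin n)) := by
    intro m
    induction m using Nat.strong_induction_on with
    | _ m ih =>
      intro j hjm hjt
      by_cases hj : j ∈ greedyBasis M R
      · exact M.subset_closure _ (by simp [hM]) (Finset.mem_coe.2 (Finset.mem_filter.2 ⟨hj, hjt⟩))
      · have hj' : j ∈ M.closure {k | k ∈ Finset.univ ∧ R k < R j} := by
          by_contra hcon
          exact hj (Finset.mem_filter.2 ⟨Finset.mem_univ _, hcon⟩)
        refine M.closure_subset_closure_of_subset_closure ?_ hj'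
        rintro k ⟨-, hk⟩
        exact ih (R k) (hjm ▸ hk) k rfl (hk.le.trans hjt)
  have h1 : ((A.filter fun j => R j ≤ t : Finset (Fin n)) : Set (Fin n)).encard ≤
      ((T : Finset (Fin n)) : Set (Fin n)).encard := by
    rw [← (hA.subset (Finset.coe_subset.2 (Finset.filter_subset _ A))).eRk_eq_encard]
    refine le_trans (M.eRk_mono fun j hj => ?_) ((M.eRk_closure_eq _).le.trans (M.eRk_le_encard T))
    exact hspan _ j rfl (Finset.mem_filter.1 (Finset.mem_coe.1 hj)).2
  rw [Set.encard_coe_eq_coe_finsetCard, Set.encard_coe_eq_coe_finsetCard] at h1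
  exact_mod_cast h1

/-- In a set of ranked elements, the numbers of predecessors are `0, 1, …`. -/
theorem image_card_filter_lt (R : Equiv.Perm (Fin n)) (D : Finset (Fin n)) :
    D.image (fun j => (D.filter fun i => R i < R j).card) = Finset.range D.card := by
  have hlt : ∀ i ∈ D, ∀ j, R i < R j →
      (D.filter fun k => R k < R i).card < (D.filter fun k => R k < R j).card := by
    intro i hi j hij
    refine Finset.card_lt_card (Finset.ssubset_iff.2 ⟨i, by simp, ?_⟩)
    intro k hk
    rcases Finset.mem_insert.1 hk with rfl | hk
    · exact Finset.mem_filter.2 ⟨hi, hij⟩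
    · rw [Finset.mem_filter] at hk ⊢
      exact ⟨hk.1, hk.2.trans hij⟩
  refine Finset.eq_of_subset_of_card_le (fun m hm => ?_) ?_
  · obtain ⟨j, hj, rfl⟩ := Finset.mem_image.1 hm
    rw [Finset.mem_range]
    refine Finset.card_lt_card (Finset.ssubset_iff.2 ⟨j, by simp, ?_⟩)
    exact Finset.insert_subset hj (Finset.filter_subset _ _)
  · rw [Finset.card_range, Finset.card_image_of_injOn]
    intro i hi j hj hij
    rcases lt_trichotomy (R i) (R j) with h | h | h
    · exact absurd hij (hlt i hi j h).ne
    · exact R.injective h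
    · exact absurd hij (hlt j hj i h).ne'

/-! ### Laminar matroids -/

section laminar

variable {F : Finset (Finset (Fin n))} {cap : Finset (Fin n) → ℕ}

theorem LaminarIndep.mono {A B : Finset (Fin n)} (hB : LaminarIndep F cap B) (h : A ⊆ B) :
    LaminarIndep F cap A := fun C hC =>
  (Finset.card_le_card (Finset.inter_subset_inter_right h)).trans (hB C hC)

/-- If no exchange is possible, every element of `J \ I` lies in a tight set. Maximal tight sets are
disjoint; inside each of them `I` has at least as many elements as `J`, and outside all of them `J`
is contained in `I`. -/
theorem LaminarIndep.exists_insert (hF : IsLaminar F) {I J : Finset (Fin n)}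
    (hI : LaminarIndep F cap I) (hJ : LaminarIndep F cap J) (hIJ : I.card < J.card) :
    ∃ e ∈ J, e ∉ I ∧ LaminarIndep F cap (insert e I) := by
  classical
  by_contra hcon
  push Not at hcon
  set T := F.filter fun B => cap B ≤ (I ∩ B).card with hT
  have htight : ∀ e ∈ J, e ∉ I → ∃ B ∈ T, e ∈ B := by
    intro e heJ heI
    have := hcon e heJ heI
    unfold LaminarIndep at this
    push Not at this
    obtain ⟨B, hB, hcard⟩ := this
    by_cases heB : e ∈ B
    · rw [Finset.insert_inter_of_mem heB, Finset.card_insert_of_notMem (by simp [heI])] at hcard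
      exact ⟨B, Finset.mem_filter.2 ⟨hB, by omega⟩, heB⟩
    · rw [Finset.insert_inter_of_notMem heB] at hcard
      exact absurd (hI B hB) (by omega)
  set 𝓜 := T.filter fun B => ∀ B' ∈ T, B ⊆ B' → B' ⊆ B with h𝓜
  have h𝓜F : ∀ B ∈ 𝓜, B ∈ F := fun B hB =>
    (Finset.mem_filter.1 (Finset.mem_filter.1 hB).1).1
  have hmax : ∀ B ∈ T, ∃ B' ∈ 𝓜, B ⊆ B' := by
    intro B hB
    obtain ⟨B', hle, hB'⟩ := T.exists_le_maximal hB
    exact ⟨B', Finset.mem_filter.2 ⟨hB'.prop, fun C hC h => hB'.le_of_ge hC h⟩, hle⟩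
  have hdisj : ∀ B ∈ 𝓜, ∀ B' ∈ 𝓜, B ≠ B' → Disjoint B B' := by
    intro B hB B' hB' hne
    rcases hF B (h𝓜F B hB) B' (h𝓜F B' hB') with h | h | h
    · exact absurd (h.antisymm
        ((Finset.mem_filter.1 hB).2 B' (Finset.mem_filter.1 hB').1 h)) hne
    · exact absurd (((Finset.mem_filter.1 hB').2 B (Finset.mem_filter.1 hB).1 h).antisymm h) hne
    · exact h
  set U := 𝓜.biUnion id with hU
  have hcard : ∀ C : Finset (Fin n), (C ∩ U).card = ∑ B ∈ 𝓜, (C ∩ B).card := by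
    intro C
    rw [hU, Finset.inter_biUnion, Finset.card_biUnion]
    · rfl
    · intro B hB B' hB' hne
      exact (hdisj B hB B' hB' hne).mono Finset.inter_subset_right Finset.inter_subset_right
  have h1 : (J ∩ U).card ≤ (I ∩ U).card := by
    rw [hcard, hcard]
    refine Finset.sum_le_sum fun B hB => (hJ B (h𝓜F B hB)).trans ?_
    exact (Finset.mem_filter.1 (Finset.mem_filter.1 hB).1).2
  have h2 : (J \ U).card ≤ (I \ U).card := by
    refine Finset.card_le_card fun e he => ?_
    rw [Finset.mem_sdiff] at he ⊢
    refine ⟨?_, he.2⟩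
    by_contra heI
    obtain ⟨B, hB, heB⟩ := htight e he.1 heI
    obtain ⟨B', hB', hle⟩ := hmax B hB
    exact he.2 (Finset.mem_biUnion.2 ⟨B', hB', hle heB⟩)
  have h3 := Finset.card_inter_add_card_sdiff J U
  have h4 := Finset.card_inter_add_card_sdiff I U
  omega

/-- Laminar matroids are matroids. -/
theorem exists_laminarMatroid (hF : IsLaminar F) (cap : Finset (Fin n) → ℕ) :
    ∃ M : Matroid (Fin n), M.E = Set.univ ∧
      ∀ A : Finset (Fin n), M.Indep (A : Set (Fin n)) ↔ LaminarIndep F cap A := by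
  have h1 : LaminarIndep F cap ∅ := fun B _ => by
    rw [Finset.empty_inter]
    exact Nat.zero_le _
  have h2 : ∀ ⦃I J⦄, LaminarIndep F cap J → I ⊆ J → LaminarIndep F cap I :=
    fun _ _ hJ h => hJ.mono h
  have h3 : ∀ ⦃I J⦄, LaminarIndep F cap I → LaminarIndep F cap J → I.card < J.card →
      ∃ e ∈ J, e ∉ I ∧ LaminarIndep F cap (insert e I) := fun _ _ hI hJ h => hI.exists_insert hF hJ h
  have h4 : ∀ ⦃I : Finset (Fin n)⦄, LaminarIndep F cap I → (I : Set (Fin n)) ⊆ Set.univ :=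
    fun _ _ => Set.subset_univ _
  exact ⟨(IndepMatroid.ofFinset Set.univ (LaminarIndep F cap) h1 h2 h3 h4).matroid, rfl,
    fun A => IndepMatroid.ofFinset_indep Set.univ (LaminarIndep F cap) h1 h2 h3 h4⟩

/-! ### The laminar rule and a product martingale for the number of rivals. -/

variable {M : Matroid (Fin n)}

open Classical in
/-- Accept an unspanned element if its addition to all unspanned elements revealed before violates
no capacity. -/
def laminarRule (M : Matroid (Fin n)) (F : Finset (Finset (Fin n))) (cap : Finset (Fin n) → ℕ)
    (R : Equiv.Perm (Fin n)) (O H : Finset (Fin n)) (i : Fin n) : Prop :=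
  Unspanned M R O i ∧
    ∀ B ∈ F, i ∈ B → (H.filter fun j => j ∈ B ∧ Unspanned M R O j).card < cap B

open Classical in
theorem laminarRule_isLocal (M : Matroid (Fin n)) (F : Finset (Finset (Fin n)))
    (cap : Finset (Fin n) → ℕ) : IsLocal (laminarRule M F cap) := by
  intro R R' O H i h
  have key : ∀ j, (j ∈ H ∨ j = i) → (Unspanned M R O j ↔ Unspanned M R' O j) := fun j hj =>
    Unspanned.congr M fun k => and_congr_right fun hk => h k j (Or.inl hk) (Or.inr hj)
  refine and_congr (key i (Or.inr rfl)) (forall₃_congr fun B _ _ => ?_)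
  rw [Finset.filter_congr fun j hj => and_congr_right fun _ => key j (Or.inl hj)]

open Classical in
theorem laminarRule_anti (M : Matroid (Fin n)) (F : Finset (Finset (Fin n)))
    (cap : Finset (Fin n) → ℕ) (R : Equiv.Perm (Fin n)) (O H H' : Finset (Fin n)) (i : Fin n)
    (hH : H' ⊆ H) (h : laminarRule M F cap R O H i) : laminarRule M F cap R O H' i :=
  ⟨h.1, fun B hB hi => (Finset.card_le_card (Finset.filter_subset_filter _ hH)).trans_lt
    (h.2 B hB hi)⟩

open Classical in
-- At the last accepted element of `B`, the rule has counted all earlier accepted ones, since each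
-- of them is unspanned.
theorem laminarRule_feasible (M : Matroid (Fin n)) (F : Finset (Finset (Fin n)))
    (cap : Finset (Fin n) → ℕ) (R : Equiv.Perm (Fin n)) (O N : Finset (Fin n)) (κ : Fin n → ℕ)
    (hκ : Set.InjOn κ N) :
    LaminarIndep F cap
      (N.filter fun i => laminarRule M F cap R O (N.filter fun j => κ j < κ i) i) := by
  intro B hB
  set X := N.filter fun i => laminarRule M F cap R O (N.filter fun j => κ j < κ i) i with hX
  rcases (X ∩ B).eq_empty_or_nonempty with h | h
  · simp [h]
  obtain ⟨i, hi, hmax⟩ := Finset.exists_max_image (X ∩ B) κ h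
  obtain ⟨hiX, hiB⟩ := Finset.mem_inter.1 hi
  have h1 := (Finset.mem_filter.1 hiX).2.2 B hB hiB
  have h2 : ((X ∩ B).erase i).card ≤
      ((N.filter fun j => κ j < κ i).filter fun j => j ∈ B ∧ Unspanned M R O j).card := by
    refine Finset.card_le_card fun j hj => ?_
    obtain ⟨hji, hj⟩ := Finset.mem_erase.1 hj
    obtain ⟨hjX, hjB⟩ := Finset.mem_inter.1 hj
    have hjN := (Finset.mem_filter.1 hjX).1
    refine Finset.mem_filter.2 ⟨Finset.mem_filter.2 ⟨hjN, ?_⟩, hjB,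
      (Finset.mem_filter.1 hjX).2.1⟩
    exact lt_of_le_of_ne (hmax j hj) fun h => hji (hκ hjN (Finset.mem_filter.1 hiX).1 h)
  rw [Finset.card_erase_of_mem hi] at h2
  omega

open Classical in
/-- The unspanned elements of `B` other than `e` that are not observed. -/
def rivals (M : Matroid (Fin n)) (R : Equiv.Perm (Fin n)) (B : Finset (Fin n)) (e : Fin n)
    (O : Finset (Fin n)) : Finset (Fin n) :=
  Finset.univ.filter fun j => j ∈ B ∧ j ≠ e ∧ Unspanned M R O j ∧ j ∉ O

open Classical in
/-- The unspanned elements of `B` other than `e` that have fewer than `k` rivals of higher rank. -/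
def active (M : Matroid (Fin n)) (R : Equiv.Perm (Fin n)) (B : Finset (Fin n)) (e : Fin n) (k : ℕ)
    (O : Finset (Fin n)) : Finset (Fin n) :=
  Finset.univ.filter fun j => j ∈ B ∧ j ≠ e ∧ Unspanned M R O j ∧
    ((rivals M R B e O).filter fun i => R i < R j).card < k

theorem Unspanned.eq_of_agree (M : Matroid (Fin n)) {R : Equiv.Perm (Fin n)} {i f : Fin n}
    (h : R i ≤ R f) {O O' : Finset (Fin n)} (hO : ∀ k, k ≠ f → (k ∈ O ↔ k ∈ O')) :
    Unspanned M R O i ↔ Unspanned M R O' i :=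
  Unspanned.congr M fun _ => and_congr_left fun hk => hO _ fun hkf => by
    subst hkf
    exact absurd (lt_of_lt_of_le hk h) (lt_irrefl _)

/-- Activity is predictable: it is decided by the coins of strictly higher elements. This is what
makes the potential a martingale. -/
theorem mem_active_iff_of_agree (R : Equiv.Perm (Fin n)) (B : Finset (Fin n)) (e : Fin n) (k : ℕ)
    {j f : Fin n} (h : R j ≤ R f) {O O' : Finset (Fin n)} (hO : ∀ i, i ≠ f → (i ∈ O ↔ i ∈ O')) :
    j ∈ active M R B e k O ↔ j ∈ active M R B e k O' := by
  simp only [active, Finset.mem_filter, Finset.mem_univ, true_and]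
  rw [Unspanned.eq_of_agree M h hO]
  have : ((rivals M R B e O).filter fun i => R i < R j) =
      (rivals M R B e O').filter fun i => R i < R j := by
    ext i
    simp only [rivals, Finset.mem_filter, Finset.mem_univ, true_and]
    refine and_congr_left fun hi => ?_
    rw [Unspanned.eq_of_agree M (hi.le.trans h) hO, hO i fun hif => by
      subst hif
      exact absurd (lt_of_lt_of_le hi h) (lt_irrefl _)]
  rw [this]

open Classical in
/-- The product of the factors `x` for unobserved and `y` for observed active elements among the
first `m` elements. -/
def potential (M : Matroid (Fin n)) (R : Equiv.Perm (Fin n)) (B : Finset (Fin n)) (e : Fin n)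
    (k : ℕ) (x y : ℝ) (m : ℕ) (O : Finset (Fin n)) : ℝ :=
  ∏ j ∈ (active M R B e k O).filter fun j => (R j).val < m, if j ∈ O then y else x

open Classical in
-- Revealing coins down the ranking, each active element multiplies the product by a factor of mean
-- `p * y + (1 - p) * x = 1`, independent of the past.
theorem Ex_potential {p x y : ℝ} (hxy : p * y + (1 - p) * x = 1) (R : Equiv.Perm (Fin n))
    (B : Finset (Fin n)) (e : Fin n) (k m : ℕ) (hm : m ≤ n) :
    Ex p (fun O => ind (e ∉ O) * potential M R B e k x y m O) = 1 - p := by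
  induction m with
  | zero => simp [potential, Ex_ind_notMem]
  | succ m ih =>
    set f : Fin n := R.symm ⟨m, hm⟩ with hf
    have hRf : (R f).val = m := by simp [hf]
    have hlt : ∀ j, (R j).val < m + 1 ↔ j = f ∨ (R j).val < m := by
      intro j
      rw [Nat.lt_succ_iff_lt_or_eq, or_comm, ← hRf]
      refine or_congr_left ?_
      rw [← Fin.ext_iff, R.injective.eq_iff]
    have hstep : ∀ O, potential M R B e k x y (m + 1) O = potential M R B e k x y m O +
        (if f ∈ O then y - 1 else x - 1) *
          (ind (f ∈ active M R B e k O) * potential M R B e k x y m O) := by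
      intro O
      by_cases hfa : f ∈ active M R B e k O
      · have h1 : ((active M R B e k O).filter fun j => (R j).val < m + 1) =
            insert f ((active M R B e k O).filter fun j => (R j).val < m) := by
          ext j
          simp only [Finset.mem_filter, Finset.mem_insert, hlt]
          constructor
          · rintro ⟨h, rfl | h'⟩
            exacts [Or.inl rfl, Or.inr ⟨h, h'⟩]
          · rintro (rfl | h)
            exacts [⟨hfa, Or.inl rfl⟩, ⟨h.1, Or.inr h.2⟩]
        rw [potential, h1, Finset.prod_insert (by simp [hRf]), ind_of_true hfa, one_mul,
          ← potential]
        split_ifs <;> ring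
      · have h1 : ((active M R B e k O).filter fun j => (R j).val < m + 1) =
            (active M R B e k O).filter fun j => (R j).val < m := by
          ext j
          simp only [Finset.mem_filter, hlt]
          refine and_congr_right fun hj => or_iff_right ?_
          rintro rfl
          exact hfa hj
        rw [potential, h1, ind_of_false hfa, ← potential]
        ring
    -- `e` is never active, so every nontrivial step uses a coin on which `ind (e ∉ O)` does not
    -- depend.
    by_cases hfe : f = e
    · have hna : ∀ O, f ∉ active M R B e k O := fun O h => (Finset.mem_filter.1 h).2.2.1 hfe
      simp only [hstep, ind_of_false (hna _), zero_mul, mul_zero, add_zero]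
      exact ih (by omega)
    · have haw : AwayFrom f fun O => ind (e ∉ O) *
          (ind (f ∈ active M R B e k O) * potential M R B e k x y m O) := by
        intro O O' hO
        dsimp only
        rw [hO e (Ne.symm hfe), mem_active_iff_of_agree R B e k le_rfl hO]
        congr 2
        have : ((active M R B e k O).filter fun j => (R j).val < m) =
            (active M R B e k O').filter fun j => (R j).val < m := by
          ext j
          simp only [Finset.mem_filter]
          refine and_congr_left fun hj => ?_
          rw [mem_active_iff_of_agree R B e k (Fin.le_def.2 (by omega)) hO]
        rw [potential, potential, this]
        refine Finset.prod_congr rfl fun j hj => ?_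
        have hjf : j ≠ f := by
          rintro rfl
          have := (Finset.mem_filter.1 hj).2
          omega
        simp only [hO j hjf]
      have h2 := Ex_mul_of_awayFrom p haw (y - 1) (x - 1)
      rw [show p * (y - 1) + (1 - p) * (x - 1) = 0 by linarith, zero_mul] at h2
      have h3 : ∀ O, ind (e ∉ O) * potential M R B e k x y (m + 1) O =
          ind (e ∉ O) * potential M R B e k x y m O + (if f ∈ O then y - 1 else x - 1) *
            (ind (e ∉ O) *
              (ind (f ∈ active M R B e k O) * potential M R B e k x y m O)) := by
        intro O
        rw [hstep]
        ring
      simp only [h3]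
      rw [Ex_add, h2, add_zero]
      exact ih (by omega)

open Classical in
-- With `k = cap B` rivals, the first `k` of them are active and contribute at least `x ^ k`.
-- Observed active elements lie above the `k`-th rival `f`; together with `f` they are independent
-- inside `B`, so there are at most `k - 1` of them.
theorem le_potential (hM : M.E = Set.univ)
    (hMF : ∀ A : Finset (Fin n), M.Indep (A : Set (Fin n)) ↔ LaminarIndep F cap A)
    {x y : ℝ} (hx : 1 ≤ x) (hy0 : 0 ≤ y) (hy1 : y ≤ 1) (R : Equiv.Perm (Fin n))
    {B : Finset (Fin n)} (hB : B ∈ F) (hc : 0 < cap B) (e : Fin n) {O : Finset (Fin n)}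
    (h : cap B ≤ (rivals M R B e O).card) :
    x ^ cap B * y ^ (cap B - 1) ≤ potential M R B e (cap B) x y n O := by
  set k := cap B with hk
  set D := rivals M R B e O with hD
  set c : Fin n → ℕ := fun j => (D.filter fun i => R i < R j).card with hcdef
  have himg : D.image c = Finset.range D.card := image_card_filter_lt R D
  have hmemD : ∀ j, j ∈ D ↔ j ∈ B ∧ j ≠ e ∧ Unspanned M R O j ∧ j ∉ O := fun j => by
    simp [hD, rivals]
  have hmemA : ∀ j, j ∈ active M R B e k O ↔ j ∈ B ∧ j ≠ e ∧ Unspanned M R O j ∧ c j < k :=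
    fun j => by simp [active, hcdef, hD]
  obtain ⟨f, hfD, hfc⟩ : ∃ f ∈ D, c f = k - 1 := by
    have : k - 1 ∈ D.image c := by rw [himg, Finset.mem_range]; omega
    simpa using this
  obtain ⟨hfB, hfe, hfu, hfO⟩ := (hmemD f).1 hfD
  have hpot : potential M R B e k x y n O =
      y ^ ((active M R B e k O).filter fun j => j ∈ O).card *
        x ^ ((active M R B e k O).filter fun j => j ∉ O).card := by
    rw [potential, Finset.filter_true_of_mem fun j _ => (R j).2, Finset.prod_ite,
      Finset.prod_const, Finset.prod_const]
  have hN : k ≤ ((active M R B e k O).filter fun j => j ∉ O).card := by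
    have h1 : Finset.range k ⊆ ((active M R B e k O).filter fun j => j ∉ O).image c := by
      intro m hm
      rw [Finset.mem_range] at hm
      have : m ∈ D.image c := by rw [himg, Finset.mem_range]; omega
      obtain ⟨j, hj, rfl⟩ := Finset.mem_image.1 this
      obtain ⟨h1, h2, h3, h4⟩ := (hmemD j).1 hj
      exact Finset.mem_image.2 ⟨j, Finset.mem_filter.2 ⟨(hmemA j).2 ⟨h1, h2, h3, hm⟩, h4⟩, rfl⟩
    have h2 := (Finset.card_le_card h1).trans Finset.card_image_le
    rwa [Finset.card_range] at h2
  have hO : ((active M R B e k O).filter fun j => j ∈ O).card ≤ k - 1 := by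
    set X := (active M R B e k O).filter fun j => j ∈ O with hX
    have hXf : ∀ j ∈ X, R j < R f := by
      intro j hj
      obtain ⟨hja, hjO⟩ := Finset.mem_filter.1 hj
      have hjk := ((hmemA j).1 hja).2.2.2
      rcases lt_trichotomy (R j) (R f) with h | h | h
      · exact h
      · exact absurd (R.injective h ▸ hjO) hfO
      · have : c f < c j := by
          refine Finset.card_lt_card (Finset.ssubset_iff.2 ⟨f, by simp, fun i hi => ?_⟩)
          rcases Finset.mem_insert.1 hi with rfl | hi
          · exact Finset.mem_filter.2 ⟨hfD, h⟩
          · rw [Finset.mem_filter] at hi ⊢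
            exact ⟨hi.1, hi.2.trans h⟩
        omega
    have hfX : f ∉ X := fun hf => hfO (Finset.mem_filter.1 hf).2
    -- All members are unspanned by higher observed elements. Although `f` is unobserved, it is last
    -- in the ranking and so never occurs among the predecessors.
    have hind : M.Indep ((insert f X : Finset (Fin n)) : Set (Fin n)) := by
      refine indep_of_notMem_closure hM R _ R.injective.injOn fun a ha hcl => ?_
      have hau : Unspanned M R O a := by
        rcases Finset.mem_insert.1 ha with rfl | ha
        · exact hfu
        · exact ((hmemA a).1 (Finset.mem_filter.1 ha).1).2.2.1
      refine hau (M.closure_subset_closure ?_ hcl)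
      rintro b ⟨hb, hba⟩
      refine ⟨?_, hba⟩
      rcases Finset.mem_insert.1 hb with rfl | hb
      · rcases Finset.mem_insert.1 ha with rfl | ha
        · exact absurd hba (lt_irrefl _)
        · exact absurd (hXf a ha) (not_lt.2 hba.le)
      · exact (Finset.mem_filter.1 hb).2
    have h1 := (hMF _).1 hind B hB
    rw [Finset.inter_eq_left.2, Finset.card_insert_of_notMem hfX] at h1
    · omega
    · refine Finset.insert_subset hfB fun j hj => ?_
      exact ((hmemA j).1 (Finset.mem_filter.1 hj).1).1
  rw [hpot, mul_comm]
  exact mul_le_mul (pow_le_pow_of_le_one hy0 hy1 hO) (pow_le_pow_right₀ hx hN) (by positivity)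
    (by positivity)

/-- Markov's inequality for the potential, whose mean on `e ∉ O` is 1/10. -/
theorem Ex_many_rivals_le (hM : M.E = Set.univ)
    (hMF : ∀ A : Finset (Fin n), M.Indep (A : Set (Fin n)) ↔ LaminarIndep F cap A)
    (R : Equiv.Perm (Fin n)) {B : Finset (Fin n)} (hB : B ∈ F) (hc : 0 < cap B) (e : Fin n) :
    Ex (9 / 10) (fun O => ind (e ∉ O ∧ cap B ≤ (rivals M R B e O).card)) ≤
      1 / 18 * (9 / 25) ^ cap B := by
  have h0 : (0 : ℝ) ≤ 9 / 10 := by norm_num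
  have h1 : (9 / 10 : ℝ) ≤ 1 := by norm_num
  -- The factors 5 and 5/9 each contribute 1/2 to the mean. A matched pair grows by 25/9, which
  -- yields the decay rate 9/25.
  have hpot := Ex_potential (M := M) (p := 9 / 10) (x := 5) (y := 5 / 9) (by norm_num) R B e
    (cap B) n le_rfl
  have hle : Ex (9 / 10) (fun O => (5 ^ cap B * (5 / 9) ^ (cap B - 1)) *
      ind (e ∉ O ∧ cap B ≤ (rivals M R B e O).card)) ≤ 1 / 10 := by
    rw [show (1 / 10 : ℝ) = 1 - 9 / 10 by norm_num, ← hpot]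
    refine Ex_mono h0 h1 fun O => ?_
    by_cases h : e ∉ O ∧ cap B ≤ (rivals M R B e O).card
    · rw [ind_of_true h, ind_of_true h.1, mul_one, one_mul]
      exact le_potential hM hMF (by norm_num) (by norm_num) (by norm_num) R hB hc e h.2
    · rw [ind_of_false h, mul_zero]
      refine mul_nonneg (ind_nonneg _) (Finset.prod_nonneg fun j _ => ?_)
      split_ifs <;> norm_num
  rw [Ex_const_mul] at hle
  obtain ⟨k, hk⟩ : ∃ k, cap B = k + 1 := ⟨cap B - 1, by omega⟩
  rw [hk] at hle ⊢
  rw [Nat.add_sub_cancel] at hle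
  set E := Ex (9 / 10) (fun O => ind (e ∉ O ∧ k + 1 ≤ (rivals M R B e O).card)) with hE
  have h2 : (5 : ℝ) ^ (k + 1) * (5 / 9) ^ k * (9 / 25) ^ k = 5 := by
    calc (5 : ℝ) ^ (k + 1) * (5 / 9) ^ k * (9 / 25) ^ k = 5 * (5 * (5 / 9) * (9 / 25)) ^ k := by
          rw [mul_pow, mul_pow, pow_succ]
          ring
      _ = 5 := by norm_num
  have h3 := mul_le_mul_of_nonneg_right hle (by positivity : (0 : ℝ) ≤ (9 / 25) ^ k)
  have h4 : (5 : ℝ) ^ (k + 1) * (5 / 9) ^ k * E * (9 / 25) ^ k = 5 * E := by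
    rw [mul_right_comm, h2]
  rw [h4] at h3
  rw [pow_succ]
  linarith

open Classical in
-- A greedy basis element is unspanned for every `O`, so only capacities can reject it. The union
-- bound costs at most `1/18 * 9/16 = 1/32` of the probability 1/10 of being unobserved.
theorem le_Ex_mem_surelyAccepted_laminar (hF : IsLaminar F) (hcap : ∀ B ∈ F, 0 < cap B)
    (hM : M.E = Set.univ)
    (hMF : ∀ A : Finset (Fin n), M.Indep (A : Set (Fin n)) ↔ LaminarIndep F cap A)
    (R : Equiv.Perm (Fin n)) {e : Fin n} (he : e ∈ greedyBasis M R) :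
    11 / 160 ≤ Ex (9 / 10) fun O => ind (e ∈ surelyAccepted (laminarRule M F cap) R O) := by
  have h0 : (0 : ℝ) ≤ 9 / 10 := by norm_num
  have h1 : (9 / 10 : ℝ) ≤ 1 := by norm_num
  set Fe := F.filter fun B => e ∈ B with hFe
  -- The sets through `e` form a chain. Among those of equal capacity the largest has the most
  -- rivals, so one bad event per capacity suffices and the sum is geometric.
  have hlargest : ∀ k ∈ Fe.image cap, ∃ B ∈ Fe, cap B = k ∧ ∀ B' ∈ Fe, cap B' = k → B' ⊆ B := by
    intro k hk
    obtain ⟨B₀, hB₀, hk₀⟩ := Finset.mem_image.1 hk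
    obtain ⟨B, hB, hmax⟩ := Finset.exists_max_image (Fe.filter fun B => cap B = k) Finset.card
      ⟨B₀, Finset.mem_filter.2 ⟨hB₀, hk₀⟩⟩
    obtain ⟨hBFe, hBk⟩ := Finset.mem_filter.1 hB
    refine ⟨B, hBFe, hBk, fun B' hB' hk' => ?_⟩
    have hle := hmax B' (Finset.mem_filter.2 ⟨hB', hk'⟩)
    obtain ⟨hBF, heB⟩ := Finset.mem_filter.1 hBFe
    obtain ⟨hBF', heB'⟩ := Finset.mem_filter.1 hB'
    rcases hF B' hBF' B hBF with h | h | h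
    · exact h
    · exact (Finset.eq_of_subset_of_card_le h hle).ge
    · exact absurd heB (Finset.disjoint_left.1 h heB')
  choose! L hL using hlargest
  have hpt : ∀ O, ind (e ∉ O) - ∑ k ∈ Fe.image cap,
      ind (e ∉ O ∧ cap (L k) ≤ (rivals M R (L k) e O).card) ≤
      ind (e ∈ surelyAccepted (laminarRule M F cap) R O) := by
    intro O
    have hnn : ∀ k ∈ Fe.image cap,
        0 ≤ ind (e ∉ O ∧ cap (L k) ≤ (rivals M R (L k) e O).card) := fun _ _ => ind_nonneg _
    by_cases heO : e ∈ O
    · rw [ind_of_false (by simpa using heO)]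
      have := Finset.sum_nonneg hnn
      have h2 := ind_nonneg (e ∈ surelyAccepted (laminarRule M F cap) R O)
      linarith
    by_cases hbad : ∃ k ∈ Fe.image cap, cap (L k) ≤ (rivals M R (L k) e O).card
    · obtain ⟨k, hk, hbad⟩ := hbad
      have h2 := Finset.single_le_sum hnn hk
      rw [ind_of_true ⟨heO, hbad⟩] at h2
      have h3 := ind_le_one (e ∉ O)
      have h4 := ind_nonneg (e ∈ surelyAccepted (laminarRule M F cap) R O)
      linarith
    · push Not at hbad
      rw [ind_of_true (P := e ∈ surelyAccepted (laminarRule M F cap) R O)]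
      · have := Finset.sum_nonneg hnn
        have h3 := ind_le_one (e ∉ O)
        linarith
      · refine mem_surelyAccepted.2 ⟨heO,
          Unspanned.anti (Finset.subset_univ O) (Finset.mem_filter.1 he).2, fun B hB heB => ?_⟩
        have hBe : B ∈ Fe := Finset.mem_filter.2 ⟨hB, heB⟩
        have hk := Finset.mem_image_of_mem cap hBe
        obtain ⟨-, hLk, hLs⟩ := hL _ hk
        have h2 := hbad _ hk
        rw [hLk] at h2
        refine lt_of_le_of_lt (Finset.card_le_card fun j hj => ?_) h2
        obtain ⟨hj1, hjB, hju⟩ := Finset.mem_filter.1 hj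
        rw [Finset.mem_erase, Finset.mem_compl] at hj1
        exact Finset.mem_filter.2
          ⟨Finset.mem_univ _, hLs B hBe rfl hjB, hj1.1, hju, hj1.2⟩
  refine le_trans ?_ (Ex_mono h0 h1 hpt)
  rw [Ex_sub, Ex_sum, Ex_ind_notMem]
  have hpos : ∀ k ∈ Fe.image cap, 1 ≤ k := by
    intro k hk
    obtain ⟨B, hB, rfl⟩ := Finset.mem_image.1 hk
    exact hcap B (Finset.mem_filter.1 hB).1
  have hsum : ∑ k ∈ Fe.image cap,
      Ex (9 / 10) (fun O => ind (e ∉ O ∧ cap (L k) ≤ (rivals M R (L k) e O).card)) ≤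
      ∑ k ∈ Fe.image cap, 1 / 18 * (9 / 25 : ℝ) ^ k := by
    refine Finset.sum_le_sum fun k hk => ?_
    obtain ⟨hLF, hLk, -⟩ := hL k hk
    have hLF' := (Finset.mem_filter.1 hLF).1
    have := Ex_many_rivals_le hM hMF R hLF' (hcap _ hLF') e
    rwa [hLk] at this ⊢
  have hgeom : ∑ k ∈ Fe.image cap, (9 / 25 : ℝ) ^ k ≤ 9 / 16 := by
    have hsub : Fe.image cap ⊆ Finset.Ico 1 ((Fe.image cap).sup id + 1) := fun k hk =>
      Finset.mem_Ico.2 ⟨hpos k hk, Nat.lt_succ_of_le (Finset.le_sup (f := id) hk)⟩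
    refine (Finset.sum_le_sum_of_subset_of_nonneg hsub fun _ _ _ => by positivity).trans ?_
    refine (geom_sum_Ico_le_of_lt_one (by norm_num) (by norm_num)).trans ?_
    norm_num
  rw [← Finset.mul_sum] at hsum
  linarith

end laminar

theorem le_Ex_sum_surelyAccepted {p : ℝ} (hp0 : 0 ≤ p) (hp1 : p ≤ 1)
    (sel : Equiv.Perm (Fin n) → Finset (Fin n) → Finset (Fin n) → Fin n → Prop)
    (R : Equiv.Perm (Fin n)) (v : Fin n → ℝ≥0) (A : Finset (Fin n)) :
    ∑ i ∈ A, (v i : ℝ) * Ex p (fun O => ind (i ∈ surelyAccepted sel R O)) ≤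
      Ex p fun O => ∑ i ∈ surelyAccepted sel R O, (v i : ℝ) := by
  classical
  simp only [← Ex_const_mul]
  rw [← Ex_sum]
  refine Ex_mono hp0 hp1 fun O => ?_
  refine (Finset.sum_le_sum_of_subset_of_nonneg (Finset.subset_univ A) fun i _ _ =>
    mul_nonneg (v i).2 (ind_nonneg _)).trans (le_of_eq ?_)
  simp only [ind, mul_ite, mul_one, mul_zero]
  rw [← Finset.sum_filter]
  congr 1
  ext i
  simp

/-- Order-oblivious secretary algorithms for laminar matroids. -/
theorem exists_orderOblivious_laminar {F : Finset (Finset (Fin n))} {cap : Finset (Fin n) → ℕ}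
    (hF : IsLaminar F) (hcap : ∀ B ∈ F, 0 < cap B) :
    ∃ S : ObserveFirstAlgorithm n,
      S.IsOrderOblivious (LaminarIndep F cap) (1 / (12 * Real.sqrt 3)) := by
  obtain ⟨M, hM, hMF⟩ := exists_laminarMatroid hF cap
  have h0 : (0 : ℝ) ≤ 9 / 10 := by norm_num
  have h1 : (9 / 10 : ℝ) ≤ 1 := by norm_num
  refine ⟨ordinalAlgorithm Unit (9 / 10) h0 h1 (fun _ => 1) (fun _ => laminarRule M F cap),
    ordinalAlgorithm_isFeasible (fun _ => laminarRule_isLocal M F cap)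
      (fun _ R O N _ κ hκ => laminarRule_feasible M F cap R O N κ hκ), fun τ v => ?_⟩
  refine ofReal_mul_opt_le (by positivity) fun A hA => le_trans (ENNReal.ofReal_le_ofReal ?_)
    (ordinalAlgorithm_expectedWeight (fun _ => laminarRule_isLocal M F cap)
      (fun _ => laminarRule_anti M F cap) τ v)
  simp only [Finset.univ_unique, Finset.sum_singleton, Fintype.card_unit, Nat.cast_one, div_one]
  refine le_trans ?_ (le_Ex_sum_surelyAccepted h0 h1 _ _ v (greedyBasis M (ranking v 1)))
  have h2 := sum_le_sum_greedyBasis hM (R := ranking v 1) (v := v)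
    (fun a b h => value_le_of_ranking_lt h) ((hMF A).2 hA)
  -- The crude bound `√3 ≥ 3/2` already reduces this to `1/18 ≤ 11/160`.
  have h3 : (1 : ℝ) / (12 * Real.sqrt 3) ≤ 11 / 160 := by
    have h4 : (3 / 2 : ℝ) ≤ Real.sqrt 3 := Real.le_sqrt_of_sq_le (by norm_num)
    rw [div_le_div_iff₀ (by positivity) (by norm_num)]
    linarith
  calc 1 / (12 * Real.sqrt 3) * ∑ i ∈ A, (v i : ℝ)
      ≤ 11 / 160 * ∑ i ∈ greedyBasis M (ranking v 1), (v i : ℝ) :=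
        mul_le_mul h3 h2 (Finset.sum_nonneg fun i _ => (v i).2) (by norm_num)
    _ ≤ _ := by
        rw [Finset.mul_sum]
        refine Finset.sum_le_sum fun e he => ?_
        rw [mul_comm]
        exact mul_le_mul_of_nonneg_left
          (le_Ex_mem_surelyAccepted_laminar hF hcap hM hMF _ he) (v e).2

/-! ### A decomposition of a matroid by density -/

section density

/-- The rank of a set of elements. -/
def rk (M : Matroid (Fin n)) (X : Set (Fin n)) : ℕ := (M.eRk X).toNat

variable (M : Matroid (Fin n))

theorem coe_rk (X : Set (Fin n)) : ((rk M X : ℕ) : ℕ∞) = M.eRk X :=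
  ENat.natCast_toNat (M.isRkFinite_of_finite X.toFinite).eRk_lt_top.ne

theorem rk_mono {X Y : Set (Fin n)} (h : X ⊆ Y) : rk M X ≤ rk M Y := by
  have := M.eRk_mono h
  rw [← coe_rk, ← coe_rk] at this
  exact_mod_cast this

theorem rk_closure (X : Set (Fin n)) : rk M (M.closure X) = rk M X := by
  rw [rk, M.eRk_closure_eq, rk]

theorem rk_union_add_rk_inter (X Y : Finset (Fin n)) :
    rk M (X ∪ Y : Finset (Fin n)) + rk M (X ∩ Y : Finset (Fin n)) ≤ rk M X + rk M Y := by
  have := M.eRk_inter_add_eRk_union_le X Y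
  rw [← Finset.coe_inter, ← Finset.coe_union] at this
  simp only [← coe_rk] at this
  have h : rk M (X ∩ Y : Finset (Fin n)) + rk M (X ∪ Y : Finset (Fin n)) ≤ rk M X + rk M Y := by
    exact_mod_cast this
  omega

theorem rk_union_le (X : Set (Fin n)) (Y : Finset (Fin n)) : rk M (X ∪ Y) ≤ rk M X + Y.card := by
  have := M.eRk_union_le_eRk_add_encard X Y
  rw [← coe_rk, ← coe_rk, Set.encard_coe_eq_coe_finsetCard] at this
  exact_mod_cast this

theorem rk_le_add_card_sdiff (X Y : Finset (Fin n)) : rk M X ≤ rk M Y + (X \ Y).card := by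
  refine (rk_mono M ?_).trans (rk_union_le M Y (X \ Y))
  rw [← Finset.coe_union, Finset.coe_subset]
  exact fun x hx => by by_cases h : x ∈ Y <;> simp [h, hx]

theorem rk_empty : rk M (∅ : Set (Fin n)) = 0 := by simp [rk]

theorem card_le_rk {A : Finset (Fin n)} {X : Set (Fin n)} (hA : M.Indep (A : Set (Fin n)))
    (h : (A : Set (Fin n)) ⊆ X) : A.card ≤ rk M X := by
  have := hA.encard_le_eRk_of_subset h
  rw [← coe_rk, Set.encard_coe_eq_coe_finsetCard] at this
  exact_mod_cast this

theorem exists_level (t : ℕ) : ∃ A : Finset (Fin n),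
    (∀ Y : Finset (Fin n), (n : ℤ) * rk M A - t * A.card ≤ n * rk M Y - t * Y.card) ∧
      ∀ Y : Finset (Fin n), (n : ℤ) * rk M Y - t * Y.card ≤ n * rk M A - t * A.card →
        Y.card ≤ A.card := by
  classical
  set g : Finset (Fin n) → ℤ := fun Y => n * rk M Y - t * Y.card with hg
  obtain ⟨B, -, hB⟩ := Finset.exists_min_image Finset.univ g Finset.univ_nonempty
  obtain ⟨A, hA, hmax⟩ := Finset.exists_max_image (Finset.univ.filter fun Y => g Y ≤ g B)
    Finset.card ⟨B, by simp⟩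
  have hA' := (Finset.mem_filter.1 hA).2
  refine ⟨A, fun Y => hA'.trans (hB Y (Finset.mem_univ _)), fun Y hY => hmax Y ?_⟩
  exact Finset.mem_filter.2 ⟨Finset.mem_univ _, hY.trans hA'⟩

/-- The largest set `A` that minimizes `n * rk A - t * |A|`. -/
def level (t : ℕ) : Finset (Fin n) := (exists_level M t).choose

theorem level_min (t : ℕ) (Y : Finset (Fin n)) :
    (n : ℤ) * rk M (level M t) - t * (level M t).card ≤ n * rk M Y - t * Y.card :=
  (exists_level M t).choose_spec.1 Y

theorem level_max {t : ℕ} {Y : Finset (Fin n)}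
    (h : (n : ℤ) * rk M Y - t * Y.card ≤ n * rk M (level M t) - t * (level M t).card) :
    Y.card ≤ (level M t).card :=
  (exists_level M t).choose_spec.2 Y h

/-- Submodularity and minimality of `A` against `A ∩ B` show that `A ∪ B` also minimizes at `t`;
since `B` is a largest minimizer, it contains `A`. -/
theorem level_mono {s t : ℕ} (hst : s ≤ t) : level M s ⊆ level M t := by
  set A := level M s with hA
  set B := level M t with hB
  have h1 : ((rk M (A ∪ B : Finset (Fin n)) : ℕ) : ℤ) + rk M (A ∩ B : Finset (Fin n)) ≤
      rk M A + rk M B := by exact_mod_cast rk_union_add_rk_inter M A B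
  have h2 : (((A ∪ B).card : ℕ) : ℤ) + (A ∩ B).card = A.card + B.card := by
    exact_mod_cast Finset.card_union_add_card_inter A B
  have h3 := level_min M s (A ∩ B)
  rw [← hA] at h3
  have h4 : ((A ∩ B).card : ℤ) ≤ A.card := by
    exact_mod_cast Finset.card_le_card Finset.inter_subset_left
  have h5 : (s : ℤ) ≤ t := by exact_mod_cast hst
  have h6 : (A ∪ B).card ≤ B.card := by
    refine level_max M (t := t) ?_
    rw [← hB]
    have h7 := mul_le_mul_of_nonneg_left h1 (Int.natCast_nonneg n)
    have h8 := mul_nonneg (sub_nonneg.2 h5) (sub_nonneg.2 h4)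
    have h9 : ((A ∪ B).card : ℤ) = A.card + B.card - (A ∩ B).card := by linarith
    rw [h9]
    nlinarith
  have h7 : B = A ∪ B := Finset.eq_of_subset_of_card_le Finset.subset_union_right h6
  rw [h7]
  exact Finset.subset_union_left

/-- Adding an element raises the rank by at most one, so at `t = n` the whole universe is a
minimizer. -/
theorem level_eq_univ : level M n = Finset.univ := by
  refine (Finset.card_eq_iff_eq_univ _).1 (le_antisymm (Finset.card_le_univ _) ?_)
  rw [← Finset.card_univ]
  refine level_max M ?_
  have h1 : ((rk M (Finset.univ : Finset (Fin n)) : ℕ) : ℤ) ≤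
      rk M (level M n) + (Finset.univ \ level M n).card := by
    exact_mod_cast rk_le_add_card_sdiff M Finset.univ (level M n)
  have h2 : (((Finset.univ \ level M n).card : ℕ) : ℤ) =
      (Finset.univ : Finset (Fin n)).card - (level M n).card := by
    have := Finset.card_sdiff_add_card_eq_card (Finset.subset_univ (level M n))
    have h3 : (((Finset.univ \ level M n).card : ℕ) : ℤ) + (level M n).card =
      (Finset.univ : Finset (Fin n)).card := by exact_mod_cast this
    linarith
  rw [h2] at h1
  have h3 := mul_le_mul_of_nonneg_left h1 (Int.natCast_nonneg n)
  linarith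

/-- The first level that contains `e`. -/
def lvl (e : Fin n) : ℕ := sInf {t | e ∈ level M t}

theorem mem_level_iff {e : Fin n} {t : ℕ} : e ∈ level M t ↔ lvl M e ≤ t := by
  refine ⟨fun h => Nat.sInf_le h, fun h => level_mono M h ?_⟩
  exact Nat.sInf_mem (s := {t | e ∈ level M t}) ⟨n, by simp [level_eq_univ]⟩

theorem lvl_le (e : Fin n) : lvl M e ≤ n :=
  (mem_level_iff M).1 (by simp [level_eq_univ])

theorem rk_level_zero : rk M (level M 0) = 0 := by
  rcases Nat.eq_zero_or_pos n with hn | hn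
  · subst hn
    rw [show (level M 0 : Set (Fin 0)) = ∅ from Set.eq_empty_of_isEmpty _, rk_empty]
  · have h1 := level_min M 0 ∅
    rw [Finset.coe_empty, rk_empty] at h1
    simp only [Nat.cast_zero, mul_zero, zero_mul, sub_zero] at h1
    have h2 : (n : ℤ) * rk M (level M 0) ≤ 0 := h1
    have h3 : (0 : ℤ) < n := by exact_mod_cast hn
    nlinarith

/-- Telescoping: comparing `level M (t + 1)` with `level M t` bounds `n` times the rank increment by
`t + 1` per new element. -/
theorem mul_rk_level_le (t : ℕ) : n * rk M (level M t) ≤ ∑ e ∈ level M t, lvl M e := by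
  induction t with
  | zero => rw [rk_level_zero, mul_zero]; exact Nat.zero_le _
  | succ t ih =>
    have h1 := level_min M (t + 1) (level M t)
    have hsub := level_mono M (Nat.le_succ t)
    have h2 : ∑ e ∈ level M (t + 1) \ level M t, lvl M e =
        (t + 1) * (level M (t + 1) \ level M t).card := by
      rw [Finset.sum_congr rfl (g := fun _ => t + 1), Finset.sum_const, smul_eq_mul, mul_comm]
      intro e he
      rw [Finset.mem_sdiff, mem_level_iff, mem_level_iff] at he
      omega
    have h3 := Finset.sum_sdiff (f := fun e => lvl M e) hsub
    have h4 := Finset.card_sdiff_add_card_eq_card hsub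
    zify at ih h2 h3 h4 ⊢
    rw [← h3, h2]
    push_cast at h1
    have h5 : ((level M (t + 1)).card : ℤ) =
        (level M (t + 1) \ level M t).card + (level M t).card := by linarith
    rw [h5] at h1
    linarith

/-- A set `X` spans few elements of level `l` beyond the previous level. -/
theorem card_spanned_le (hM : M.E = Set.univ) {l : ℕ} (hl : 0 < l) {X S : Finset (Fin n)}
    (hS : ∀ e ∈ S, lvl M e = l ∧ e ∈ M.closure ((level M (l - 1) : Set (Fin n)) ∪ X)) :
    max (l - 1) 1 * S.card ≤ n * X.card := by
  set L := level M (l - 1) with hL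
  have hdisj : Disjoint L S := Finset.disjoint_left.2 fun e heL heS => by
    rw [hL, mem_level_iff, (hS e heS).1] at heL
    omega
  have h1 : rk M (L ∪ S : Finset (Fin n)) ≤ rk M L + X.card := by
    refine le_trans (rk_mono M ?_) ((rk_closure M _).le.trans (rk_union_le M L X))
    intro e he
    rcases Finset.mem_union.1 (Finset.mem_coe.1 he) with h | h
    · exact M.subset_closure _ (by simp [hM]) (Or.inl h)
    · exact (hS e h).2
  have hSn : S.card ≤ n := by simpa using S.card_le_univ
  -- For `l > 1`, minimality of the previous level gives density at least `l - 1`. For `l = 1` that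
  -- is void; instead, maximality of level 0 forces `S = ∅` when `X = ∅`, and otherwise `|S| ≤ n` is
  -- enough.
  rcases Nat.lt_or_ge 1 l with h | h
  · rw [max_eq_left (by omega)]
    have h2 := level_min M (l - 1) (L ∪ S)
    rw [Finset.card_union_of_disjoint hdisj, ← hL] at h2
    push_cast at h2
    zify at h1 ⊢
    have h3 := mul_le_mul_of_nonneg_left h1 (Int.natCast_nonneg n)
    linarith
  · obtain rfl : l = 1 := by omega
    rw [max_eq_right (by omega), one_mul]
    rcases X.card.eq_zero_or_pos with h0 | h0
    · rw [h0, add_zero] at h1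
      have h2 := level_max M (t := 0) (Y := L ∪ S) (by
        have h3 : ((rk M (L ∪ S : Finset (Fin n)) : ℕ) : ℤ) ≤ rk M L := by exact_mod_cast h1
        have h4 := mul_le_mul_of_nonneg_left h3 (Int.natCast_nonneg n)
        simpa [hL] using h4)
      rw [Finset.card_union_of_disjoint hdisj] at h2
      simp only [hL, Nat.sub_self] at h2
      omega
    · exact hSn.trans (Nat.le_mul_of_pos_right _ h0)

/-! ### The acceptance rule -/

/-- Fewer observed elements of higher rank than the level of `j`. -/
def IsCandidate (R : Equiv.Perm (Fin n)) (O : Finset (Fin n)) (j : Fin n) : Prop :=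
  (O.filter fun i => R i < R j).card < lvl M j

/-- Accept the candidates that are not spanned by the lower levels together with the candidates of
the same level that were revealed before. -/
def densityRule (R : Equiv.Perm (Fin n)) (O H : Finset (Fin n)) (i : Fin n) : Prop :=
  IsCandidate M R O i ∧ i ∉ M.closure ((level M (lvl M i - 1) : Set (Fin n)) ∪
    {j | j ∈ H ∧ lvl M j = lvl M i ∧ IsCandidate M R O j})

theorem densityRule_isLocal : IsLocal (densityRule M) := by
  intro R R' O H i h
  have key : ∀ j, (j ∈ H ∨ j = i) → (IsCandidate M R O j ↔ IsCandidate M R' O j) := by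
    intro j hj
    rw [IsCandidate, IsCandidate, Finset.filter_congr fun k hk => h k j (Or.inl hk) (Or.inr hj)]
  have hset : {j | j ∈ H ∧ lvl M j = lvl M i ∧ IsCandidate M R O j} =
      {j | j ∈ H ∧ lvl M j = lvl M i ∧ IsCandidate M R' O j} :=
    Set.ext fun j => and_congr_right fun hj => and_congr_right fun _ => key j (Or.inl hj)
  rw [densityRule, densityRule, key i (Or.inr rfl), hset]

theorem densityRule_anti (R : Equiv.Perm (Fin n)) (O H H' : Finset (Fin n)) (i : Fin n)
    (hH : H' ⊆ H) (h : densityRule M R O H i) : densityRule M R O H' i := by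
  refine ⟨h.1, fun hi => h.2 (M.closure_subset_closure (Set.union_subset_union_right _ ?_) hi)⟩
  rintro j ⟨hj, hj'⟩
  exact ⟨hH hj, hj'⟩

open Classical in
-- In the lexicographic order by level and then arrival time, no accepted element is spanned by its
-- predecessors.
theorem densityRule_feasible (hM : M.E = Set.univ) (R : Equiv.Perm (Fin n))
    (O N : Finset (Fin n)) (κ : Fin n → ℕ) (hκ : Set.InjOn κ N) :
    MatroidIndep M
      (N.filter fun i => densityRule M R O (N.filter fun j => κ j < κ i) i) := by
  refine indep_of_notMem_closure hM (fun i => toLex (lvl M i, κ i)) _ ?_ ?_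
  · intro a ha b hb hab
    have h := congrArg (fun x : ℕ ×ₗ ℕ => (ofLex x).2) hab
    exact hκ (Finset.mem_filter.1 ha).1 (Finset.mem_filter.1 hb).1 h
  · intro a ha hcl
    refine (Finset.mem_filter.1 ha).2.2 (M.closure_subset_closure ?_ hcl)
    rintro b ⟨hb, hba⟩
    obtain ⟨hbN, hb⟩ := Finset.mem_filter.1 hb
    rw [Prod.Lex.toLex_lt_toLex] at hba
    rcases hba with h | ⟨h1, h2⟩
    · refine Or.inl ?_
      rw [Finset.mem_coe, mem_level_iff]
      dsimp only at h
      omega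
    · exact Or.inr ⟨Finset.mem_filter.2 ⟨hbN, h2⟩, h1, hb.1⟩

/-! ### Sums over permutations -/

theorem sum_perm_apply_eq (f : Fin n → ℝ) (a b : Fin n) :
    ∑ σ : Equiv.Perm (Fin n), f (σ a) = ∑ σ : Equiv.Perm (Fin n), f (σ b) := by
  refine Fintype.sum_equiv (Equiv.mulRight (Equiv.swap a b)) _ _ fun σ => ?_
  simp

/-- The image of a fixed point under a uniform permutation is uniform. -/
theorem mul_sum_perm_apply (f : Fin n → ℝ) (a : Fin n) :
    n * ∑ σ : Equiv.Perm (Fin n), f (σ a) = Fintype.card (Equiv.Perm (Fin n)) * ∑ b, f b := by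
  have h1 : ∑ b, ∑ σ : Equiv.Perm (Fin n), f (σ b) = n * ∑ σ : Equiv.Perm (Fin n), f (σ a) := by
    rw [Finset.sum_congr rfl fun b _ => sum_perm_apply_eq f b a]
    simp
  rw [← h1, Finset.sum_comm, Finset.sum_congr rfl fun σ _ => Equiv.sum_comp σ f]
  simp

theorem Ex_map (p : ℝ) (f : Finset (Fin n) → ℝ) (π : Equiv.Perm (Fin n)) :
    Ex p (fun O => f (O.map π.toEmbedding)) = Ex p f := by
  refine Fintype.sum_equiv (Equiv.finsetCongr π) _ _ fun T => ?_
  rw [Equiv.finsetCongr_apply, Finset.card_map]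

end density

/-! ### Acceptance probabilities under a random assignment. -/

section matroid

/-- The positions other than `t` outside `U` that come after fewer than `l` positions of `U`. -/
def openPositions (U : Finset (Fin n)) (t : Fin n) (l : ℕ) : Finset (Fin n) :=
  Finset.univ.filter fun u => u ≠ t ∧ u ∉ U ∧ (U.filter fun i => i < u).card < l

theorem card_filter_card_lt_le (U : Finset (Fin n)) (l : ℕ) :
    (U.filter fun u => (U.filter fun i => i < u).card < l).card ≤ l := by
  have himg := image_card_filter_lt 1 U
  have hinj : Set.InjOn (fun u => (U.filter fun i => i < u).card) U :=
    Finset.card_image_iff.1 (by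
      refine (congrArg Finset.card himg).trans (Finset.card_range _))
  have h := Finset.card_le_card_of_injOn (s := U.filter fun u => (U.filter fun i => i < u).card < l)
    (t := Finset.range l) (fun u => (U.filter fun i => i < u).card)
    (fun u hu => by simpa using (Finset.mem_filter.1 hu).2)
    (hinj.mono (Finset.coe_subset.2 (Finset.filter_subset _ _)))
  simpa using h

/-- For each position `u`, the count condition is independent of the coin of `u`. Unselected
positions satisfying it are thus `(1 - p) / p` times as frequent as selected ones, of which there
are at most `l`. -/
theorem mul_Ex_card_openPositions_le {p : ℝ} (hp0 : 0 ≤ p) (hp1 : p ≤ 1) (t : Fin n) (l : ℕ) :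
    p * Ex p (fun U => ind (t ∉ U) * (openPositions U t l).card) ≤ (1 - p) * ((1 - p) * l) := by
  set K : Fin n → Finset (Fin n) → Prop := fun u U =>
    u ≠ t ∧ t ∉ U ∧ (U.filter fun i => i < u).card < l with hK
  have haway : ∀ u, AwayFrom u (K u) := by
    intro u O O' hO
    by_cases hu : u = t
    · simp [hK, hu]
    · have h1 : (O.filter fun i => i < u) = O'.filter fun i => i < u := by
        ext i
        simp only [Finset.mem_filter]
        exact and_congr_left fun hi => hO i hi.ne
      simp only [hK, h1, hO t (Ne.symm hu)]
  have h1 : ∀ U, ind (t ∉ U) * ((openPositions U t l).card : ℝ) =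
      ∑ u, ind (u ∉ U ∧ K u U) := by
    intro U
    rw [openPositions, ← sum_ind, Finset.mul_sum]
    refine Finset.sum_congr rfl fun u _ => ?_
    by_cases ht : t ∈ U
    · rw [ind_of_false (not_not.2 ht), zero_mul,
        ind_of_false (P := u ∉ U ∧ K u U) fun h => h.2.2.1 ht]
    · rw [ind_of_true ht, one_mul]
      congr 1
      simp only [hK, ht, not_false_eq_true, true_and, eq_iff_iff]
      tauto
  have h2 : ∀ U, ∑ u, ind (u ∈ U ∧ K u U) ≤ l * ind (t ∉ U) := by
    intro U
    by_cases ht : t ∈ U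
    · rw [Finset.sum_eq_zero fun u _ => ind_of_false fun h => h.2.2.1 ht]
      exact mul_nonneg (Nat.cast_nonneg _) (ind_nonneg _)
    · rw [ind_of_true ht, mul_one]
      refine le_trans (b := ∑ u, ind (u ∈ U ∧ (U.filter fun i => i < u).card < l))
        (Finset.sum_le_sum fun u _ => ind_mono fun h => ⟨h.1, h.2.2.2⟩) ?_
      rw [sum_ind, ← Finset.filter_filter, Finset.filter_univ_mem]
      exact_mod_cast card_filter_card_lt_le U l
  have h3 := Ex_mono hp0 hp1 h2
  rw [Ex_const_mul, Ex_ind_notMem, Ex_sum] at h3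
  simp only [h1]
  rw [Ex_sum]
  simp only [fun u => Ex_ind_mem_and p (haway u), fun u => Ex_ind_notMem_and p (haway u),
    ← Finset.mul_sum] at h3 ⊢
  have h4 := mul_le_mul_of_nonneg_left h3 (by linarith : (0 : ℝ) ≤ 1 - p)
  linarith

variable (M : Matroid (Fin n))

/-- `i` is spanned by the elements below level `l` and the elements of level `l` at positions
in `C`. -/
def IsBlocked (l : ℕ) (C : Finset (Fin n)) (σ : Equiv.Perm (Fin n)) (i : Fin n) : Prop :=
  i ∈ M.closure ((level M (l - 1) : Set (Fin n)) ∪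
    ((C.map σ.toEmbedding).filter fun j => lvl M j = l : Finset (Fin n)))

theorem map_mul_swap {C : Finset (Fin n)} {s t : Fin n} (hs : s ∉ C) (ht : t ∉ C)
    (σ : Equiv.Perm (Fin n)) : C.map (σ * Equiv.swap s t).toEmbedding = C.map σ.toEmbedding := by
  rw [Finset.map_eq_image, Finset.map_eq_image]
  refine Finset.image_congr fun x hx => ?_
  have h1 : x ≠ s := fun h => hs (h ▸ hx)
  have h2 : x ≠ t := fun h => ht (h ▸ hx)
  simp [Equiv.swap_apply_of_ne_of_ne h1 h2]

/-- A random element of level `l` is rarely spanned by few random positions. -/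
theorem mul_sum_isBlocked_le (hM : M.E = Set.univ) {l : ℕ} (hl : 0 < l) {C : Finset (Fin n)}
    {t : Fin n} (ht : t ∉ C) :
    ((max (l - 1) 1 : ℕ) : ℝ) *
        ∑ σ : Equiv.Perm (Fin n), ind (lvl M (σ t) = l ∧ IsBlocked M l C σ (σ t)) ≤
      C.card * ∑ σ : Equiv.Perm (Fin n), ind (lvl M (σ t) = l) := by
  classical
  set d : ℝ := ((max (l - 1) 1 : ℕ) : ℝ) with hd
  have hd0 : 0 ≤ d := Nat.cast_nonneg _
  set b : ℝ := ∑ σ : Equiv.Perm (Fin n), ind (lvl M (σ t) = l ∧ IsBlocked M l C σ (σ t)) with hb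
  set z : ℝ := ∑ σ : Equiv.Perm (Fin n), ind (lvl M (σ t) = l) with hz
  have hz' : ∀ j, ∑ σ : Equiv.Perm (Fin n), ind (lvl M (σ j) = l) = z := fun j =>
    sum_perm_apply_eq (fun e => ind (lvl M e = l)) j t
  -- Transposing two positions outside `C` leaves the blocking elements unchanged, so all such
  -- positions are equally likely to be blocked.
  have hb' : ∀ j ∉ C, ∑ σ : Equiv.Perm (Fin n),
      ind (lvl M (σ j) = l ∧ IsBlocked M l C σ (σ j)) = b := by
    intro j hj
    refine Fintype.sum_equiv (Equiv.mulRight (Equiv.swap j t)) _ _ fun σ => ?_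
    rw [Equiv.coe_mulRight, IsBlocked, IsBlocked, map_mul_swap hj ht]
    simp
  have hbz : b ≤ z := Finset.sum_le_sum fun σ _ => ind_mono fun h => h.1
  have hC : ∀ j ∈ C, ∑ σ : Equiv.Perm (Fin n),
      ind (lvl M (σ j) = l ∧ IsBlocked M l C σ (σ j)) = z := by
    intro j hj
    rw [← hz' j]
    refine Finset.sum_congr rfl fun σ _ => congrArg ind (propext (and_iff_left_of_imp fun h => ?_))
    refine M.subset_closure _ (by simp [hM]) (Or.inr ?_)
    simp [h, hj]
  -- The deterministic density bound for one assignment; summing over assignments and using symmetry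
  -- among positions gives the claim.
  have hpt : ∀ σ : Equiv.Perm (Fin n),
      d * ∑ j, ind (lvl M (σ j) = l ∧ IsBlocked M l C σ (σ j)) ≤
        n * ∑ j ∈ C, ind (lvl M (σ j) = l) := by
    intro σ
    have h1 : ∑ j ∈ C, ind (lvl M (σ j) = l) =
        (((C.map σ.toEmbedding).filter fun j => lvl M j = l).card : ℝ) := by
      rw [← sum_ind, Finset.sum_map]
      rfl
    have h2 := Equiv.sum_comp σ fun e => ind (lvl M e = l ∧ IsBlocked M l C σ e)
    rw [h1, h2, sum_ind]
    have h3 := card_spanned_le M hM hl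
      (S := Finset.univ.filter fun e => lvl M e = l ∧ IsBlocked M l C σ e)
      (X := (C.map σ.toEmbedding).filter fun j => lvl M j = l)
      fun e he => (Finset.mem_filter.1 he).2
    rw [hd]
    exact_mod_cast h3
  have hsum := Finset.sum_le_sum fun σ (_ : σ ∈ Finset.univ) => hpt σ
  rw [← Finset.mul_sum, ← Finset.mul_sum, Finset.sum_comm, Finset.sum_comm (t := C)] at hsum
  simp only [hz', Finset.sum_const, nsmul_eq_mul] at hsum
  rw [← Finset.sum_add_sum_compl C, Finset.sum_congr rfl hC,
    Finset.sum_congr rfl fun j hj => hb' j (Finset.mem_compl.1 hj), Finset.sum_const,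
    Finset.sum_const, nsmul_eq_mul, nsmul_eq_mul, Finset.card_compl, Fintype.card_fin,
    Nat.cast_sub (by simpa using C.card_le_univ)] at hsum
  have hn : (0 : ℝ) < n := by exact_mod_cast t.pos
  have h4 : 0 ≤ d * (C.card * (z - b)) :=
    mul_nonneg hd0 (mul_nonneg (Nat.cast_nonneg _) (sub_nonneg.2 hbz))
  refine le_of_mul_le_mul_left ?_ hn
  linarith

/-- Positions are ranks: `σ t` is the element of rank `t`. Only `t` elements precede it, so `t <
lvl` makes it a candidate, and its unobserved competitors of the same level sit in the open
positions. -/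
theorem mem_surelyAccepted_densityRule {σ : Equiv.Perm (Fin n)} {U : Finset (Fin n)} {t : Fin n}
    (ht : t ∉ U) (hlt : t.val < lvl M (σ t))
    (h : ¬IsBlocked M (lvl M (σ t)) (openPositions U t (lvl M (σ t))) σ (σ t)) :
    σ t ∈ surelyAccepted (densityRule M) σ.symm (U.map σ.toEmbedding) := by
  have hcard : ∀ u, ((U.map σ.toEmbedding).filter fun i => σ.symm i < u).card =
      (U.filter fun i => i < u).card := by
    intro u
    rw [Finset.filter_map, Finset.card_map]
    congr 1
    refine Finset.filter_congr fun i _ => ?_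
    simp
  refine mem_surelyAccepted.2 ⟨by simpa using ht, ?_, fun hcl => h ?_⟩
  · rw [IsCandidate, hcard, Equiv.symm_apply_apply]
    refine lt_of_le_of_lt ?_ hlt
    refine (Finset.card_le_card (t := Finset.Iio t) fun i hi => ?_).trans (by simp)
    exact Finset.mem_Iio.2 (Finset.mem_filter.1 hi).2
  · refine M.closure_subset_closure (Set.union_subset_union_right _ ?_) hcl
    rintro j ⟨hj, hjl, hjc⟩
    rw [IsCandidate, hcard, hjl] at hjc
    simp only [Finset.mem_erase, Finset.mem_compl, Finset.mem_map_equiv] at hj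
    rw [Finset.mem_coe, Finset.mem_filter, Finset.mem_map_equiv]
    refine ⟨Finset.mem_filter.2 ⟨Finset.mem_univ _, ?_, hj.2, hjc⟩, hjl⟩
    rintro h
    exact hj.1 (by rw [← h, Equiv.apply_symm_apply])

/-- Being unobserved has probability 1/10, and blocking costs at most `l / (90 * d) ≤ 1/45`, leaving
7/90. The positions `U` are drawn independently of the assignment `σ`. -/
theorem le_sum_Ex_mem_surelyAccepted_of_level (hM : M.E = Set.univ) (t : Fin n) {l : ℕ}
    (hl : t.val < l) :
    7 / 90 * ∑ σ : Equiv.Perm (Fin n), ind (lvl M (σ t) = l) ≤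
      ∑ σ : Equiv.Perm (Fin n), Ex (9 / 10) fun U => ind (lvl M (σ t) = l ∧
        σ t ∈ surelyAccepted (densityRule M) σ.symm (U.map σ.toEmbedding)) := by
  have h0 : (0 : ℝ) ≤ 9 / 10 := by norm_num
  have h1 : (9 / 10 : ℝ) ≤ 1 := by norm_num
  set z : ℝ := ∑ σ : Equiv.Perm (Fin n), ind (lvl M (σ t) = l) with hz
  have hz0 : 0 ≤ z := Finset.sum_nonneg fun _ _ => ind_nonneg _
  set d : ℝ := ((max (l - 1) 1 : ℕ) : ℝ) with hd
  have hd0 : 0 < d := by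
    rw [hd]
    exact_mod_cast lt_of_lt_of_le Nat.one_pos (le_max_right (l - 1) 1)
  -- The maximum with 1 in `d` covers `l = 1`, where equality holds only up to this factor 2.
  have hld : (l : ℝ) ≤ 2 * d := by
    rw [hd]
    have : l ≤ 2 * max (l - 1) 1 := by omega
    exact_mod_cast this
  have hpt : ∀ U, z * ind (t ∉ U) - z / d * (ind (t ∉ U) * (openPositions U t l).card) ≤
      ∑ σ : Equiv.Perm (Fin n), ind (lvl M (σ t) = l ∧
        σ t ∈ surelyAccepted (densityRule M) σ.symm (U.map σ.toEmbedding)) := by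
    intro U
    by_cases ht : t ∈ U
    · rw [ind_of_false (by simpa using ht), mul_zero, zero_mul, mul_zero, sub_zero]
      exact Finset.sum_nonneg fun _ _ => ind_nonneg _
    · rw [ind_of_true ht, mul_one, one_mul]
      have h2 := mul_sum_isBlocked_le M hM (by omega : 0 < l) (C := openPositions U t l) (t := t)
        (by simp [openPositions])
      rw [← hz, ← hd, mul_comm, ← le_div_iff₀ hd0] at h2
      have h3 : z - ∑ σ : Equiv.Perm (Fin n),
          ind (lvl M (σ t) = l ∧ IsBlocked M l (openPositions U t l) σ (σ t)) ≤
          ∑ σ : Equiv.Perm (Fin n), ind (lvl M (σ t) = l ∧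
            σ t ∈ surelyAccepted (densityRule M) σ.symm (U.map σ.toEmbedding)) := by
        rw [hz, ← Finset.sum_sub_distrib]
        refine Finset.sum_le_sum fun σ _ => ?_
        by_cases hσ : lvl M (σ t) = l
        · by_cases hbl : IsBlocked M l (openPositions U t l) σ (σ t)
          · rw [ind_of_true hσ, ind_of_true (P := _ ∧ IsBlocked _ _ _ _ _) ⟨hσ, hbl⟩, sub_self]
            exact ind_nonneg _
          · rw [ind_of_true (P := _ ∧ _ ∈ surelyAccepted _ _ _) ⟨hσ,
              mem_surelyAccepted_densityRule M ht (by rw [hσ]; exact hl) (by rwa [hσ])⟩]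
            have h4 := ind_le_one (lvl M (σ t) = l)
            have h5 := ind_nonneg (lvl M (σ t) = l ∧ IsBlocked M l (openPositions U t l) σ (σ t))
            linarith
        · rw [ind_of_false hσ]
          have h4 := ind_nonneg (lvl M (σ t) = l ∧ IsBlocked M l (openPositions U t l) σ (σ t))
          have h5 := ind_nonneg (lvl M (σ t) = l ∧
            σ t ∈ surelyAccepted (densityRule M) σ.symm (U.map σ.toEmbedding))
          linarith
      have h4 : z / d * (openPositions U t l).card = (openPositions U t l).card * z / d := by ring
      linarith
  have h2 := Ex_mono h0 h1 hpt
  rw [Ex_sub, Ex_const_mul, Ex_const_mul, Ex_ind_notMem, Ex_sum] at h2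
  refine le_trans ?_ h2
  have h3 := mul_Ex_card_openPositions_le h0 h1 t l
  have h4 : Ex (9 / 10) (fun U => ind (t ∉ U) * ((openPositions U t l).card : ℝ)) ≤
      1 / 45 * d := by linarith
  have h5 := mul_le_mul_of_nonneg_left h4 (div_nonneg hz0 hd0.le)
  have h6 : z / d * (1 / 45 * d) = 1 / 45 * z := by field_simp
  linarith

theorem le_sum_Ex_mem_surelyAccepted (hM : M.E = Set.univ) (t : Fin n) :
    7 / 90 * ∑ σ : Equiv.Perm (Fin n), ind (t.val < lvl M (σ t)) ≤
      ∑ σ : Equiv.Perm (Fin n), Ex (9 / 10) fun O =>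
        ind (σ t ∈ surelyAccepted (densityRule M) σ.symm O) := by
  have h0 : (0 : ℝ) ≤ 9 / 10 := by norm_num
  have h1 : (9 / 10 : ℝ) ≤ 1 := by norm_num
  have h2 := Finset.sum_le_sum fun l (hl : l ∈ Finset.Ioc t.val n) =>
    le_sum_Ex_mem_surelyAccepted_of_level M hM t (Finset.mem_Ioc.1 hl).1
  rw [← Finset.mul_sum, Finset.sum_comm, Finset.sum_comm (t := Finset.univ)] at h2
  have hsum : ∀ σ : Equiv.Perm (Fin n), ∀ P : Prop,
      ∑ l ∈ Finset.Ioc t.val n, ind (lvl M (σ t) = l ∧ P) = ind (t.val < lvl M (σ t) ∧ P) := by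
    intro σ P
    by_cases h : t.val < lvl M (σ t)
    · rw [Finset.sum_eq_single (lvl M (σ t))]
      · simp [h]
      · exact fun l _ hl => ind_of_false fun h => hl h.1.symm
      · exact fun h' => absurd (Finset.mem_Ioc.2 ⟨h, lvl_le M _⟩) h'
    · rw [ind_of_false fun h' => h h'.1]
      refine Finset.sum_eq_zero fun l hl => ind_of_false fun h' => h ?_
      rw [h'.1]
      exact (Finset.mem_Ioc.1 hl).1
  have hsum' : ∀ σ : Equiv.Perm (Fin n),
      ∑ l ∈ Finset.Ioc t.val n, ind (lvl M (σ t) = l) = ind (t.val < lvl M (σ t)) := fun σ => by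
    simpa using hsum σ True
  simp only [hsum'] at h2
  refine h2.trans (Finset.sum_le_sum fun σ _ => ?_)
  -- Observed positions and observed elements have the same law, as the product law is invariant
  -- under `σ`.
  rw [← Ex_sum, ← Ex_map (9 / 10) (fun O => ind (σ t ∈ surelyAccepted (densityRule M) σ.symm O)) σ]
  refine Ex_mono h0 h1 fun U => ?_
  rw [hsum]
  exact ind_mono fun h => h.2

end matroid

/-! ### Comparison with the expected optimum. -/

section matroid

variable (M : Matroid (Fin n))

/-- Split the top `s + 1` elements at `level M (s + 1)`: inside, the rank is bounded by the sum of
levels divided by `n`; each element outside is among the top with probability `(s + 1) / n`. -/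
theorem mul_sum_rk_le (s : Fin n) :
    (n : ℝ) * ∑ R : Equiv.Perm (Fin n), (rk M {e | R e ≤ s} : ℝ) ≤
      Fintype.card (Equiv.Perm (Fin n)) * ∑ e, ((min (lvl M e) (s + 1) : ℕ) : ℝ) := by
  classical
  set L := level M (s + 1) with hL
  have hpt : ∀ R : Equiv.Perm (Fin n), (n : ℝ) * rk M {e | R e ≤ s} ≤
      ∑ e ∈ L, (lvl M e : ℝ) + n * ∑ e ∈ Lᶜ, ind (R e ≤ s) := by
    intro R
    have h1 := rk_le_add_card_sdiff M (Finset.univ.filter fun e => R e ≤ s) L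
    have h2 : (Finset.univ.filter fun e => R e ≤ s) \ L = Lᶜ.filter fun e => R e ≤ s := by
      ext e; simp [and_comm]
    rw [h2, Finset.coe_filter] at h1
    simp only [Finset.mem_univ, true_and] at h1
    have h3 := mul_rk_level_le M (s + 1)
    have h4 : n * rk M {e | R e ≤ s} ≤
        ∑ e ∈ L, lvl M e + n * (Lᶜ.filter fun e => R e ≤ s).card := by
      refine (Nat.mul_le_mul_left n h1).trans ?_
      rw [mul_add]
      exact Nat.add_le_add_right h3 _
    rw [sum_ind]
    exact_mod_cast h4
  rw [Finset.mul_sum]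
  refine (Finset.sum_le_sum fun R _ => hpt R).trans (le_of_eq ?_)
  rw [Finset.sum_add_distrib, Finset.sum_const, ← Finset.mul_sum, Finset.sum_comm, Finset.mul_sum]
  have h5 : ∀ e, (n : ℝ) * ∑ R : Equiv.Perm (Fin n), ind (R e ≤ s) =
      Fintype.card (Equiv.Perm (Fin n)) * ((s + 1 : ℕ) : ℝ) := by
    intro e
    have h := mul_sum_perm_apply (fun b => ind (b ≤ s)) e
    rwa [sum_ind (ι := Fin n), show (Finset.univ.filter fun b => b ≤ s) = Finset.Iic s by ext; simp,
      Fin.card_Iic] at h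
  simp only [h5]
  rw [← Finset.sum_add_sum_compl L fun e => ((min (lvl M e) (s + 1) : ℕ) : ℝ), Finset.card_univ,
    nsmul_eq_mul, ← Finset.mul_sum, ← mul_add]
  congr 2
  · refine Finset.sum_congr rfl fun e he => ?_
    rw [min_eq_left ((mem_level_iff M).1 he)]
  · refine Finset.sum_congr rfl fun e he => ?_
    rw [Finset.mem_compl, mem_level_iff] at he
    rw [min_eq_right (by omega)]

theorem sum_ind_le_mul_ind_lt (s : Fin n) {l : ℕ} (hl : l ≤ n) :
    ∑ t : Fin n, ind (t ≤ s) * ind (t.val < l) = ((min l (s + 1) : ℕ) : ℝ) := by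
  have h1 : ∀ t : Fin n, ind (t ≤ s) * ind (t.val < l) = ind (t.val < min l (s + 1)) := by
    intro t
    have h2 : t.val < min l (s + 1) ↔ t ≤ s ∧ t.val < l := by
      rw [lt_min_iff, Nat.lt_succ_iff, and_comm, Fin.le_def]
    rw [h2]
    by_cases ha : t ≤ s
    · rw [ind_of_true ha, one_mul]
      simp [ha]
    · rw [ind_of_false ha, zero_mul, ind_of_false fun h => ha h.1]
  simp only [h1]
  rw [sum_ind, Fin.card_filter_val_lt, min_eq_right (by omega)]

/-- The acceptance rule on randomly ordered weights obtains a constant fraction of the optimum. -/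
theorem sum_le_sum_Ex_surelyAccepted (hM : M.E = Set.univ) {x : Fin n → ℝ≥0} (hx : Antitone x)
    {A : Equiv.Perm (Fin n) → Finset (Fin n)} (hA : ∀ R, MatroidIndep M (A R)) :
    7 / 90 * ∑ R, ∑ i ∈ A R, (x (R i) : ℝ) ≤
      ∑ R, Ex (9 / 10) fun O => ∑ i ∈ surelyAccepted (densityRule M) R O, (x (R i) : ℝ) := by
  classical
  have h0 : (0 : ℝ) ≤ 9 / 10 := by norm_num
  have h1 : (9 / 10 : ℝ) ≤ 1 := by norm_num
  rcases Nat.eq_zero_or_pos n with rfl | hn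
  · simp [Finset.eq_empty_of_isEmpty, Ex]
  obtain ⟨δ, hδ, hxδ⟩ := exists_layers (fun s => (x s : ℝ))
    (fun a b h => by exact_mod_cast hx h) fun i => (x i).2
  set P : ℝ := (Fintype.card (Equiv.Perm (Fin n)) : ℝ) with hP
  have hopt : n * ∑ R, ∑ i ∈ A R, (x (R i) : ℝ) ≤
      P * ∑ s, δ s * ∑ e, ((min (lvl M e) (s + 1) : ℕ) : ℝ) := by
    have h2 : ∀ R : Equiv.Perm (Fin n), ∑ i ∈ A R, (x (R i) : ℝ) ≤
        ∑ s, δ s * (rk M {e | R e ≤ s} : ℝ) := by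
      intro R
      simp only [hxδ]
      rw [Finset.sum_comm]
      refine Finset.sum_le_sum fun s _ => ?_
      rw [← Finset.mul_sum, sum_ind]
      refine mul_le_mul_of_nonneg_left (Nat.cast_le.2 ?_) (hδ s)
      refine card_le_rk M ((hA R).subset (Finset.coe_subset.2 (Finset.filter_subset _ _))) ?_
      intro e he
      exact (Finset.mem_filter.1 (Finset.mem_coe.1 he)).2
    refine (mul_le_mul_of_nonneg_left (Finset.sum_le_sum fun R _ => h2 R)
      (Nat.cast_nonneg n)).trans ?_
    rw [Finset.sum_comm, Finset.mul_sum, Finset.mul_sum]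
    refine Finset.sum_le_sum fun s _ => ?_
    rw [← Finset.mul_sum]
    have h3 := mul_le_mul_of_nonneg_left (mul_sum_rk_le M s) (hδ s)
    linarith
  have halg : ∑ t, (x t : ℝ) * (7 / 90 * ∑ σ : Equiv.Perm (Fin n), ind (t.val < lvl M (σ t))) ≤
      ∑ R, Ex (9 / 10) fun O => ∑ i ∈ surelyAccepted (densityRule M) R O, (x (R i) : ℝ) := by
    refine le_trans (Finset.sum_le_sum fun t _ =>
      mul_le_mul_of_nonneg_left (le_sum_Ex_mem_surelyAccepted M hM t) (x t).2) ?_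
    simp only [Finset.mul_sum]
    -- Passing to inverses turns assignments `σ` into rankings `R`.
    rw [Finset.sum_comm, ← Equiv.sum_comp (Equiv.inv (Equiv.Perm (Fin n)))]
    refine Finset.sum_le_sum fun R _ => ?_
    refine le_trans (le_of_eq ?_)
      (le_Ex_sum_surelyAccepted h0 h1 (densityRule M) R (fun i => x (R i)) Finset.univ)
    rw [← Equiv.sum_comp R]
    refine Finset.sum_congr rfl fun i _ => ?_
    have : (Equiv.inv (Equiv.Perm (Fin n))) R = R.symm := rfl
    rw [this, Equiv.symm_symm, Equiv.symm_apply_apply]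
  refine le_trans (le_of_mul_le_mul_left ?_ (by exact_mod_cast hn : (0 : ℝ) < n)) halg
  -- Both bounds meet here: in each layer `s`, counting positions `t ≤ s` with `t < lvl M e` gives
  -- the truncated level of `e`.
  have hkey : ∑ t, (x t : ℝ) * ∑ e, ind (t.val < lvl M e) =
      ∑ s, δ s * ∑ e, ((min (lvl M e) (s + 1) : ℕ) : ℝ) := by
    simp only [hxδ, Finset.sum_mul, ← fun s e => sum_ind_le_mul_ind_lt s (lvl_le M e)]
    rw [Finset.sum_comm]
    refine Finset.sum_congr rfl fun s _ => ?_
    rw [Finset.sum_comm, Finset.mul_sum]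
    refine Finset.sum_congr rfl fun t _ => ?_
    rw [← Finset.mul_sum, mul_assoc]
  have h4 : (n : ℝ) * ∑ t, (x t : ℝ) *
      (7 / 90 * ∑ σ : Equiv.Perm (Fin n), ind (t.val < lvl M (σ t))) =
      7 / 90 * (P * ∑ t, (x t : ℝ) * ∑ e, ind (t.val < lvl M e)) := by
    rw [Finset.mul_sum, Finset.mul_sum, Finset.mul_sum]
    refine Finset.sum_congr rfl fun t _ => ?_
    have := mul_sum_perm_apply (fun e => ind (t.val < lvl M e)) t
    rw [← hP] at this
    linear_combination (7 / 90 * (x t : ℝ)) * this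
  rw [h4, hkey]
  linarith

end matroid

/-! ### Arbitrary weights: sorting and random tie-breaking. -/

theorem exists_opt_eq {J : Finset (Fin n) → Prop} (hJ : J ∅) (v : Fin n → ℝ≥0) :
    ∃ A, J A ∧ opt J v = ENNReal.ofReal (∑ i ∈ A, (v i : ℝ)) := by
  classical
  obtain ⟨A, hA, hmax⟩ := Finset.exists_max_image (Finset.univ.filter J) (weight v) ⟨∅, by simpa⟩
  have hA := (Finset.mem_filter.1 hA).2
  refine ⟨A, hA, ?_⟩
  rw [ENNReal.ofReal_sum_of_nonneg fun i _ => NNReal.coe_nonneg (v i)]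
  simp only [ENNReal.ofReal_coe_nnreal]
  refine le_antisymm (iSup₂_le fun B hB => hmax B (by simpa using hB)) ?_
  exact le_iSup₂ (f := fun A (_ : J A) => weight v A) A hA

/-- The weights in decreasing order. -/
def sortedWeights (w : Fin n → ℝ≥0) : Fin n → ℝ≥0 := w ∘ (ranking w 1).symm

theorem antitone_comp_ranking_symm (w : Fin n → ℝ≥0) (t : Equiv.Perm (Fin n)) :
    Antitone (w ∘ (ranking w t).symm) := by
  intro a b hab
  rcases hab.lt_or_eq with h | rfl
  · exact value_le_of_ranking_lt (v := w) (t := t) (by simpa using h)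
  · exact le_rfl

/-- Two decreasing rearrangements of the same weights coincide, whatever the tie-breaks. -/
theorem comp_eq_sortedWeights_comp (w : Fin n → ℝ≥0) (ρ t : Equiv.Perm (Fin n)) :
    w ∘ ρ = sortedWeights w ∘ ranking (w ∘ ρ) t := by
  have h := Tuple.unique_antitone (f := w) (σ := (ranking w 1).symm)
    (τ := ρ * (ranking (w ∘ ρ) t).symm) (antitone_comp_ranking_symm w 1)
    (antitone_comp_ranking_symm (w ∘ ρ) t)
  funext i
  have h2 := congrFun h (ranking (w ∘ ρ) t i)
  simp only [Function.comp_apply, Equiv.Perm.coe_mul, Equiv.symm_apply_apply] at h2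
  exact h2.symm

/-- Order-oblivious secretary algorithms for matroids in the random assignment model. -/
theorem exists_orderObliviousRandomAssignment {M : Matroid (Fin n)} (hM : M.E = Set.univ) :
    ∃ S : ObserveFirstAlgorithm n,
      S.IsOrderObliviousRandomAssignment (MatroidIndep M) ((1 - 1 / Real.exp 1) / 20) := by
  have h0 : (0 : ℝ) ≤ 9 / 10 := by norm_num
  have h1 : (9 / 10 : ℝ) ≤ 1 := by norm_num
  -- The coin is the tie-breaking permutation itself: with a fixed one, tied weights would give a
  -- ranking that is not uniform.
  refine ⟨ordinalAlgorithm (Equiv.Perm (Fin n)) (9 / 10) h0 h1 id fun _ => densityRule M,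
    ordinalAlgorithm_isFeasible (fun _ => densityRule_isLocal M)
      (fun _ R O N _ κ hκ => densityRule_feasible M hM R O N κ hκ), fun τ w => ?_⟩
  set x := sortedWeights w with hx
  set P : ℝ := (Fintype.card (Equiv.Perm (Fin n)) : ℝ) with hP
  have hP0 : 0 < P := by rw [hP]; exact_mod_cast Fintype.card_pos
  set Q : Equiv.Perm (Fin n) → ℝ := fun R =>
    Ex (9 / 10) fun O => ∑ i ∈ surelyAccepted (densityRule M) R O, (x (R i) : ℝ) with hQ
  have hQ0 : ∀ R, 0 ≤ Q R := fun R => Finset.sum_nonneg fun O _ => by positivity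
  choose A hA hAopt using fun R : Equiv.Perm (Fin n) =>
    exists_opt_eq (J := MatroidIndep M) (by simp [MatroidIndep]) (x ∘ R)
  have halg : ∀ ρ : Equiv.Perm (Fin n),
      ENNReal.ofReal ((∑ t, Q (ranking (w ∘ ρ) t)) / P) ≤
        (ordinalAlgorithm (Equiv.Perm (Fin n)) (9 / 10) h0 h1 id
          fun _ => densityRule M).expectedWeight τ (w ∘ ρ) := by
    intro ρ
    refine le_trans (le_of_eq ?_) (ordinalAlgorithm_expectedWeight
      (fun _ => densityRule_isLocal M) (fun _ => densityRule_anti M) τ (w ∘ ρ))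
    congr 2
    refine Finset.sum_congr rfl fun t _ => ?_
    have h2 : ∀ i, (w ∘ ρ) i = x (ranking (w ∘ ρ) t i) :=
      congrFun (comp_eq_sortedWeights_comp w ρ t)
    simp only [hQ, ← h2, id]
  -- Replacing the tie-break `t` by `t * ρ` turns the ranking into `ranking w t * ρ`, which is
  -- uniform in `ρ` for each `t`.
  have hsumQ : ∑ ρ : Equiv.Perm (Fin n), (∑ t, Q (ranking (w ∘ ρ) t)) / P = ∑ R, Q R := by
    have h2 : ∀ ρ : Equiv.Perm (Fin n), ∑ t, Q (ranking (w ∘ ρ) t) =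
        ∑ t, Q (ranking w t * ρ) := by
      intro ρ
      rw [← Equiv.sum_comp (Equiv.mulRight ρ)]
      exact Finset.sum_congr rfl fun t _ => by rw [Equiv.coe_mulRight, ranking_comp]
    have h3 : ∀ t, ∑ ρ : Equiv.Perm (Fin n), Q (ranking w t * ρ) = ∑ R, Q R := fun t =>
      Equiv.sum_comp (Equiv.mulLeft (ranking w t)) Q
    rw [← Finset.sum_div, Finset.sum_congr rfl fun ρ _ => h2 ρ, Finset.sum_comm,
      Finset.sum_congr rfl fun t _ => h3 t,
      Finset.sum_const, Finset.card_univ, nsmul_eq_mul, mul_div_cancel_left₀ _ hP0.ne']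
  have hsumO : ∑ ρ : Equiv.Perm (Fin n), opt (MatroidIndep M) (w ∘ ρ) =
      ENNReal.ofReal (∑ R, ∑ i ∈ A R, (x (R i) : ℝ)) := by
    rw [ENNReal.ofReal_sum_of_nonneg fun R _ => Finset.sum_nonneg fun i _ => (x (R i)).2,
      ← Equiv.sum_comp (Equiv.mulLeft (ranking w 1))
        fun R => ENNReal.ofReal (∑ i ∈ A R, (x (R i) : ℝ))]
    refine Finset.sum_congr rfl fun ρ _ => ?_
    have h2 : w ∘ ρ = x ∘ (ranking w 1 * ρ : Equiv.Perm (Fin n)) := by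
      funext i; simp [hx, sortedWeights]
    rw [h2, hAopt]
    rfl
  have hreal := sum_le_sum_Ex_surelyAccepted M hM (antitone_comp_ranking_symm w 1) hA
  -- Dropping `1 / e` altogether leaves `1/20`, which is already below `7/90`.
  have hα : (1 - 1 / Real.exp 1) / 20 ≤ 7 / 90 := by
    have : 0 < 1 / Real.exp 1 := by positivity
    linarith
  have hOpt0 : 0 ≤ ∑ R, ∑ i ∈ A R, (x (R i) : ℝ) :=
    Finset.sum_nonneg fun R _ => Finset.sum_nonneg fun i _ => (x (R i)).2
  simp only [PMF.uniformOfFintype_apply, ← Finset.mul_sum]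
  rw [mul_left_comm]
  refine mul_le_mul_right ?_ _
  rw [hsumO]
  refine le_trans ?_ (Finset.sum_le_sum fun ρ _ => halg ρ)
  rw [← ENNReal.ofReal_sum_of_nonneg fun ρ _ =>
    div_nonneg (Finset.sum_nonneg fun t _ => hQ0 _) hP0.le, hsumQ,
    ← ENNReal.ofReal_mul' hOpt0]
  exact ENNReal.ofReal_le_ofReal ((mul_le_mul_of_nonneg_right hα hOpt0).trans hreal)

end SSPI

end

theorem corollary1 :
    (∀ (n : ℕ) (V : Type*) [Finite V] (G : Graph V (Fin n)), G.edgeSet = Set.univ →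
      ∃ S : SSPI.ObserveFirstAlgorithm n,
        S.IsOrderOblivious (SSPI.GraphicIndep G) (1 / 8) ∧
        S.reduction.IsProphetInequality (SSPI.GraphicIndep G) (1 / 8)) ∧
    (∀ (n : ℕ) (R : Type*) [Finite R] (adj : Fin n → R → Prop),
      ∃ S : SSPI.ObserveFirstAlgorithm n,
        S.IsOrderOblivious (SSPI.TransversalIndep adj) (1 / 16) ∧
        S.reduction.IsProphetInequality (SSPI.TransversalIndep adj) (1 / 16)) ∧
    (∀ (n : ℕ) (F : Finset (Finset (Fin n))) (cap : Finset (Fin n) → ℕ),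
      SSPI.IsLaminar F → (∀ B ∈ F, 0 < cap B) →
      ∃ S : SSPI.ObserveFirstAlgorithm n,
        S.IsOrderOblivious (SSPI.LaminarIndep F cap) (1 / (12 * Real.sqrt 3)) ∧
        S.reduction.IsProphetInequality (SSPI.LaminarIndep F cap) (1 / (12 * Real.sqrt 3))) ∧
    (∀ (n : ℕ) (M : Matroid (Fin n)), M.E = Set.univ →
      ∃ S : SSPI.ObserveFirstAlgorithm n,
        S.IsOrderObliviousRandomAssignment (SSPI.MatroidIndep M) ((1 - 1 / Real.exp 1) / 20) ∧
        S.reduction.IsIIDProphetInequality (SSPI.MatroidIndep M)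
          ((1 - 1 / Real.exp 1) / 20)) := by
  refine ⟨fun n V _ G hE => ?_, fun n R _ adj => ?_, fun n F cap hF hcap => ?_, fun n M hM => ?_⟩
  · obtain ⟨S, hS⟩ := SSPI.exists_orderOblivious_graphic G hE
    exact ⟨S, hS, hS.isProphetInequality⟩
  · obtain ⟨S, hS⟩ := SSPI.exists_orderOblivious_transversal adj
    exact ⟨S, hS, hS.isProphetInequality⟩
  · obtain ⟨S, hS⟩ := SSPI.exists_orderOblivious_laminar hF hcap
    exact ⟨S, hS, hS.isProphetInequality⟩
  · obtain ⟨S, hS⟩ := SSPI.exists_orderObliviousRandomAssignment hM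
    exact ⟨S, hS, hS.isIIDProphetInequality⟩
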